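/- Setting. Let $\Omega\subseteq\mathbb R^d$ ($d\ge 1$) be open. Consider the symmetric linear hyperbolic system $\partial_t g(u)+\operatorname{div}_x f(u)=0$ for $u$ with values in $\mathbb R^b$, where $g(u)=\mathcal G u$ and the $j$-th column of $f(u)\in\mathbb R^{b\times d}$ is $\mathcal L^{(j)}u$. Here $\mathcal G,\mathcal L^{(1)},\dots,\mathcal L^{(d)}$ are measurable symmetric $b\times b$ matrix functions on $\overline\Omega$ with entries bounded by $\Lambda$, $\mathcal G\ge\gamma>0$, $\sum_j\partial_j\mathcal L^{(j)}=0$ in the sense of distributions on $\Omega$, and for almost all $x$ all wave speeds (the numbers $c$ such that $\sum_j\nu_j\mathcal L^{(j)}(x)\xi=c\,\mathcal G(x)\xi$ for some unit vector $\nu$ and some $\xi\neq0$) satisfy $|c|\le\bar c$, where $\bar c<c_{\max}$ and $c_{\max}>0$. Let $\mathcal T$ be a conforming, locally finite simplicial mesh of $\overline\Omega$ of maximal element diameter $h$, such that each element $K$ contains a ball of some radius $\rho_K>0$ with $\operatorname{diam}K\le\kappa\rho_K$. On the facets of $\mathcal T$ the values of the $\mathcal L^{(j)}$ are understood such that $\mathcal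 D=\sum_j\nu_j\mathcal L^{(j)}$ ($\nu$ a unit normal of the facet) is the normal trace of $(\mathcal L^{(1)},\dots,\mathcal L^{(d)})$. Let $S$ be a constant symmetric positive semidefinite $b\times b$ matrix with entries bounded by $\Lambda$. Let $\mathrm v\in\Omega$ be a vertex of $\mathcal T$, and let $\Omega^{\mathrm v}$ be its vertex patch, the union of the elements having $\mathrm v$ as a vertex. Let $\varphi_{\rm bot}\le\varphi_{\rm top}$ be continuous piecewise linear functions on $\Omega^{\mathrm v}$ (affine on each element) that agree at all vertices of the patch other than $\mathrm v$ and satisfy the causality conditions $\|\operatorname{grad}\varphi_{\rm bot}\|<1/c_{\max}$ and $\|\operatorname{grad}\varphi_{\rm top}\|<1/c_{\max}$ on each element of the patch. They bound the tent $\{(x,t):x\in\Omega^{\mathrm v},\ \varphi_{\rm bot}(x)\le t\le\varphi_{\rm top}(x)\}$. Put $\delta=\varphi_{\rm top}-\varphi_{\rm bot}$. Let $V_h$ be the space of functions on $\Omega^{\mathrm v}$ that on each element are $b$-tuples of polynomials of degree at most $p$, let $(\cdot,\cdot)$ be the $L^2(\Omega^{\mathrm v})$ inner product, and let $M_0,M_1,A:V_h\to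 V_h$ be the linear operators given, for all $u,w\in V_h$, by $$(M_0u,w)=(g(u)-f(u)\operatorname{grad}\varphi_{\rm bot},w),\qquad (M_1u,w)=(f(u)\operatorname{grad}\delta,w),$$ $$(Au,w)=\sum_{K\subseteq\Omega^{\mathrm v}}\int_K\delta f(u):\operatorname{grad}w\,dx+\sum_F\int_F\delta\,(\mathcal D\{u\}-S[\![u]\!])\cdot[\![w]\!]\,d\sigma ,$$ where $F$ runs over the facets of the patch, $[\![u]\!]=u(x+0\,\nu)-u(x-0\,\nu)$ is the jump, and $\{u\}$ is the average of the two one-sided values. (Facets on $\partial\Omega^{\mathrm v}$ do not contribute, as $\delta=0$ there.) Write $M(\hat t)=M_0-\hat tM_1$ and $\|v\|_B=\sqrt{(Bv,v)}$. Let $s\ge1$. For an integer $r\ge1$ put $\tau=1/r$, which divides the tent into $r$ subtents. For $l=1,\dots,r$ put $M_0^{[l]}=M_0-(l-1)\tau M_1$, $M^{[l]}=M_0^{[l]}-\tau M_1$, $X^{[l]}_0=I$, $X^{[l]}_i=\tau (M_0^{[l]})^{-1}(A+iM_1)X^{[l]}_{i-1}$ for $i\ge1$, $$R_{[l],s}=\sum_{i=0}^{s-1}\frac1{i!}X_i^{[l]}+(M^{[l]})^{-1}M_0^{[l]}\,\frac1{s!}X_s^{[l]},\qquad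 R_{r,s}=R_{[r],s}\circ\cdots\circ R_{[1],s}.$$ Theorem. There are constants $c_0>0$ and $C>0$, depending only on $d,b,p,s,\kappa,\Lambda,\gamma,\bar c,c_{\max}$ (in particular not on $h$, $r$, the mesh or the tent), such that, if $\tau=1/r\le c_0h^{1/s}$, then $$\|R_{r,s}v\|_{M(1)}\le(1+Ch)\,\|v\|_{M_0}\qquad\text{for all }v\in V_h .$$ -/

import Mathlib

open MeasureTheory
open scoped Matrix ContDiff

noncomputable section

namespace TentSAT

/-- `ℝ^d` with its Euclidean norm. -/
abbrev Pt (d : ℕ) := EuclideanSpace ℝ (Fin d)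

/-! ### Meshes -/

/-- A conforming simplicial mesh of `closure Ω`: a locally finite simplicial complex, all of whose
faces are faces of `d`-simplices, and which covers exactly `closure Ω`.  (For a bounded `Ω` such a
mesh is finite; `Ω = ℝ^d` with a periodic mesh is the covering space of a periodic problem.) -/
structure Mesh (d : ℕ) (Ω : Set (Pt d)) where
  complex : Geometry.SimplicialComplex ℝ (Pt d)
  pure : ∀ s ∈ complex.faces, ∃ K ∈ complex.faces, s ⊆ K ∧ K.card = d + 1
  covers : complex.space = closure Ω
  locallyFinite : LocallyFinite
    fun K : {K : Finset (Pt d) // K ∈ complex.faces} => convexHull ℝ (K.1 : Set (Pt d))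

/-- The closed simplex with vertex set `K`. -/
abbrev hull {d : ℕ} (K : Finset (Pt d)) : Set (Pt d) := convexHull ℝ (K : Set (Pt d))

namespace Mesh

variable {d : ℕ} {Ω : Set (Pt d)} (𝒯 : Mesh d Ω)

/-- The elements of the mesh: its `d`-simplices, given by their vertex sets. -/
def elements : Set (Finset (Pt d)) := {K | K ∈ 𝒯.complex.faces ∧ K.card = d + 1}

theorem finite_star (v : Pt d) : {K | K ∈ 𝒯.elements ∧ v ∈ K}.Finite := by
  refine ((𝒯.locallyFinite.point_finite v).image Subtype.val).subset ?_
  rintro K ⟨hK, hv⟩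
  exact ⟨⟨K, hK.1⟩, subset_convexHull ℝ _ hv, rfl⟩

/-- The vertex patch of `v`: the elements that have `v` as a vertex. -/
def patch (v : Pt d) : Finset (Finset (Pt d)) := (𝒯.finite_star v).toFinset

/-- Shape regularity with constant `κ`: every element `K` contains a ball of radius at least
`diam K / κ`. -/
def ShapeRegular (κ : ℝ) : Prop :=
  ∀ K ∈ 𝒯.elements, ∃ x : Pt d, ∃ r : ℝ, 0 < r ∧ Metric.closedBall x r ⊆ hull K ∧
    Metric.diam (hull K) ≤ κ * r

/-- `h` is the mesh size, the maximal diameter of the elements. -/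
def IsMeshSize (h : ℝ) : Prop :=
  IsGreatest ((fun K => Metric.diam (hull K)) '' 𝒯.elements) h

end Mesh

open Classical in
/-- The facet of the simplex `K` opposite to the vertex `a`. -/
def facet {d : ℕ} (K : Finset (Pt d)) (a : Pt d) : Finset (Pt d) := K.erase a

/-- The outward unit normal of the simplex `K` on its facet `F`: the unit vector `n` such that `K`
lies on the non-positive side of the hyperplane through `F` with normal `n`. -/
def outwardNormal {d : ℕ} (K F : Finset (Pt d)) : Pt d :=
  Classical.epsilon fun n => ‖n‖ = 1 ∧ ∀ x ∈ F, ∀ y ∈ K, inner ℝ n (y - x) ≤ 0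

/-! ### The hyperbolic system `∂ₜ (𝒢 u) + ∑ⱼ ∂ⱼ (ℒ⁽ʲ⁾ u) = 0` -/

/-- The coefficients `𝒢`, `ℒ⁽ʲ⁾` and the stabilization matrix `S` of the numerical flux. -/
structure System (d b : ℕ) where
  𝒢 : Pt d → Matrix (Fin b) (Fin b) ℝ
  ℒ : Fin d → Pt d → Matrix (Fin b) (Fin b) ℝ
  S : Matrix (Fin b) (Fin b) ℝ

namespace System

variable {d b : ℕ} (sys : System d b)

/-- `∑ⱼ νⱼ ℒ⁽ʲ⁾(x)`. -/
def normalMatrix (ν x : Pt d) : Matrix (Fin b) (Fin b) ℝ := ∑ j, ν j • sys.ℒ j x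

/-- The standing assumptions on the coefficients on `Ω`, quantified: all coefficients are bounded
by `Λ`, `𝒢 ≥ γ`, and all hyperbolic wave speeds are at most `cbar`. -/
structure IsAdmissible (Ω : Set (Pt d)) (Λ γ cbar : ℝ) : Prop where
  measurable_𝒢 : ∀ k l, Measurable fun x => sys.𝒢 x k l
  measurable_ℒ : ∀ j k l, Measurable fun x => sys.ℒ j x k l
  symm_𝒢 : ∀ x ∈ closure Ω, (sys.𝒢 x).IsSymm
  symm_ℒ : ∀ j, ∀ x ∈ closure Ω, (sys.ℒ j x).IsSymm
  bound_𝒢 : ∀ x ∈ closure Ω, ∀ k l, |sys.𝒢 x k l| ≤ Λ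
  bound_ℒ : ∀ j, ∀ x ∈ closure Ω, ∀ k l, |sys.ℒ j x k l| ≤ Λ
  /-- uniform positive definiteness -/
  pos_𝒢 : ∀ x ∈ closure Ω, ∀ ξ : Fin b → ℝ, γ * (ξ ⬝ᵥ ξ) ≤ ξ ⬝ᵥ (sys.𝒢 x *ᵥ ξ)
  /-- `∑ⱼ ∂ⱼ ℒ⁽ʲ⁾ = 0` in the sense of distributions on `Ω` -/
  div_free : ∀ ψ : Pt d → ℝ, ContDiff ℝ ∞ ψ → HasCompactSupport ψ → tsupport ψ ⊆ Ω →
    ∀ k l, ∫ x, ∑ j, sys.ℒ j x k l * gradient ψ x j = 0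
  /-- the wave speeds in a unit direction `ν` are the eigenvalues `c` of the pencil
  `∑ⱼ νⱼ ℒ⁽ʲ⁾ ξ = c 𝒢 ξ` -/
  wave_speed : ∀ᵐ x ∂(volume.restrict (closure Ω)), ∀ ν : Pt d, ‖ν‖ = 1 →
    ∀ (c : ℝ) (ξ : Fin b → ℝ), ξ ≠ 0 →
      sys.normalMatrix ν x *ᵥ ξ = c • (sys.𝒢 x *ᵥ ξ) → |c| ≤ cbar
  posSemidef_S : sys.S.PosSemidef
  bound_S : ∀ k l, |sys.S k l| ≤ Λ

/-- The numerical flux on a facet involves `∑ⱼ νⱼ ℒ⁽ʲ⁾`, whereas a merely bounded `ℒ⁽ʲ⁾` is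
determined only up to null sets.  This predicate says that the values of the `ℒ⁽ʲ⁾` on the facets
of the mesh are chosen such that `∑ⱼ νⱼ ℒ⁽ʲ⁾` is the normal trace, in the usual weak sense, of the
divergence-free field `(ℒ⁽¹⁾, …, ℒ⁽ᵈ⁾)`.  It restricts nothing but the choice of these values, and
holds by the divergence theorem if the `ℒ⁽ʲ⁾` are continuously differentiable. -/
def HasNormalTraces {Ω : Set (Pt d)} (𝒯 : Mesh d Ω) : Prop :=
  ∀ K ∈ 𝒯.elements, ∀ ψ : Pt d → ℝ, ContDiff ℝ ∞ ψ → ∀ k l,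
    ∫ x in hull K, ∑ j, sys.ℒ j x k l * gradient ψ x j =
      ∑ a ∈ K, ∫ x in hull (facet K a),
        sys.normalMatrix (outwardNormal K (facet K a)) x k l * ψ x ∂μHE[d - 1]

end System

/-! ### Tents -/

/-- `φbot ≤ φtop` are the bottom and the top front of a tent over the patch of `v`: they are
continuous and piecewise linear on the patch (being affine on each closed element), satisfy the
causality condition `‖grad φ‖ < 1 / cmax`, and differ only through the tent pole at `v`. -/
structure IsTent {d : ℕ} {Ω : Set (Pt d)} (𝒯 : Mesh d Ω) (v : Pt d) (cmax : ℝ)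
    (φbot φtop : Pt d → ℝ) : Prop where
  affine_bot : ∀ K ∈ 𝒯.patch v, ∃ g : Pt d →ᵃ[ℝ] ℝ, Set.EqOn φbot g (hull K)
  affine_top : ∀ K ∈ 𝒯.patch v, ∃ g : Pt d →ᵃ[ℝ] ℝ, Set.EqOn φtop g (hull K)
  causal_bot : ∀ K ∈ 𝒯.patch v, ∀ x ∈ interior (hull K), ‖gradient φbot x‖ < 1 / cmax
  causal_top : ∀ K ∈ 𝒯.patch v, ∀ x ∈ interior (hull K), ‖gradient φtop x‖ < 1 / cmax
  eq_of_ne : ∀ K ∈ 𝒯.patch v, ∀ w ∈ K, w ≠ v → φtop w = φbot w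
  pole : φbot v ≤ φtop v

/-! ### The discontinuous Galerkin discretization on a patch -/

section DG

variable {d b p : ℕ} {P : Finset (Finset (Pt d))}

/-- The DG space `V_h` on a patch `P`: on each element, a `b`-tuple of polynomials of degree at
most `p`. -/
abbrev DG (P : Finset (Finset (Pt d))) (b p : ℕ) : Type :=
  P → Fin b → MvPolynomial.restrictTotalDegree (Fin d) ℝ p

/-- The value at `x` of the polynomial representing `u` on the element `K`. -/
def val (u : DG P b p) (K : P) (x : Pt d) : Fin b → ℝ :=
  fun l => MvPolynomial.eval (fun i => x i) (u K l : MvPolynomial (Fin d) ℝ)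

/-- The `j`-th partial derivative at `x` of the polynomial representing `u` on `K`. -/
def pderivVal (u : DG P b p) (K : P) (j : Fin d) (x : Pt d) : Fin b → ℝ :=
  fun l => MvPolynomial.eval (fun i => x i)
    (MvPolynomial.pderiv j (u K l : MvPolynomial (Fin d) ℝ))

/-- The `L²` inner product on the patch. -/
def ip (u w : DG P b p) : ℝ := ∑ K : P, ∫ x in hull K.1, val u K x ⬝ᵥ val w K x

/-- The linear operator on `V_h` that represents the bilinear form `B`. -/
def opOf (B : DG P b p → DG P b p → ℝ) : Module.End ℝ (DG P b p) :=
  Classical.epsilon fun T => ∀ u w, ip (T u) w = B u w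

/-- `‖v‖_B = √(B v, v)`. -/
def energyNorm (B : Module.End ℝ (DG P b p)) (v : DG P b p) : ℝ := √(ip (B v) v)

variable (sys : System d b)

/-- `(M₀ u, w) = (g(u) - f(u) grad φbot, w)`. -/
def M₀ (φbot : Pt d → ℝ) : Module.End ℝ (DG P b p) :=
  opOf fun u w => ∑ K : P, ∫ x in hull K.1,
    (sys.𝒢 x *ᵥ val u K x - sys.normalMatrix (gradient φbot x) x *ᵥ val u K x) ⬝ᵥ val w K x

/-- `(M₁ u, w) = (f(u) grad δ, w)` with `δ = φtop - φbot`. -/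
def M₁ (φbot φtop : Pt d → ℝ) : Module.End ℝ (DG P b p) :=
  opOf fun u w => ∑ K : P, ∫ x in hull K.1,
    (sys.normalMatrix (gradient (fun y => φtop y - φbot y) x) x *ᵥ val u K x) ⬝ᵥ val w K x

/-- The integral over the facet shared by `K` and `K'` of `δ (𝒟 {u} - S ⟦u⟧) · ⟦w⟧`, where the unit
normal `ν` of the facet points from `K` to `K'`.  It is symmetric in `K` and `K'`. -/
def facetFlux (δ : Pt d → ℝ) (u w : DG P b p) (K K' : P) (F : Finset (Pt d)) : ℝ :=
  ∫ x in hull F,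
    δ x * ((sys.normalMatrix (outwardNormal K.1 F) x *ᵥ ((1 / 2 : ℝ) • (val u K' x + val u K x)) -
      sys.S *ᵥ (val u K' x - val u K x)) ⬝ᵥ (val w K' x - val w K x)) ∂μHE[d - 1]

open Classical in
/-- `(A u, w) = (δ f(u), grad w) + (δ F̂, ⟦w⟧)_ℱ` with `δ = φtop - φbot`.  Only the facets shared by
two elements of the patch contribute, as `δ` vanishes on all others; each of them occurs for two
ordered pairs of elements, whence the factor `1 / 2`. -/
def A (φbot φtop : Pt d → ℝ) : Module.End ℝ (DG P b p) :=
  opOf fun u w =>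
    (∑ K : P, ∫ x in hull K.1,
      (φtop x - φbot x) * ∑ j, (sys.ℒ j x *ᵥ val u K x) ⬝ᵥ pderivVal w K j x) +
    (1 / 2) * ∑ K : P, ∑ K' : P, if (K.1 ∩ K'.1).card = d then
      facetFlux sys (fun x => φtop x - φbot x) u w K K' (K.1 ∩ K'.1) else 0

end DG

/-! ### Structure-aware Taylor (SAT) timestepping -/

section SAT

variable {V : Type*} [AddCommGroup V] [Module ℝ V]

/-- `X₀ = I`, `Xᵢ = τ M₀⁻¹ (A + i M₁) Xᵢ₋₁`. -/
def X (τ : ℝ) (M0 M1 A : Module.End ℝ V) : ℕ → Module.End ℝ V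
  | 0 => 1
  | i + 1 => τ • (Ring.inverse M0 * (A + ((i + 1 : ℕ) : ℝ) • M1) * X τ M0 M1 A i)

/-- The SAT propagator of order `s` over a pseudotime step `τ`,
`∑_{i<s} Xᵢ / i! + M(τ)⁻¹ M₀ X_s / s!` with `M(τ) = M₀ - τ M₁`. -/
def R (s : ℕ) (τ : ℝ) (M0 M1 A : Module.End ℝ V) : Module.End ℝ V :=
  ∑ i ∈ Finset.range s, ((i.factorial : ℝ)⁻¹) • X τ M0 M1 A i +
    Ring.inverse (M0 - τ • M1) * M0 * (((s.factorial : ℝ)⁻¹) • X τ M0 M1 A s)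

/-- The composition of the propagators over the first `l` subtents of pseudotime length `τ`; the
`l`-th subtent starts with the mass operator `M₀ - (l - 1) τ M₁`. -/
def composedR (s : ℕ) (τ : ℝ) (M0 M1 A : Module.End ℝ V) : ℕ → Module.End ℝ V
  | 0 => 1
  | l + 1 => R s τ (M0 - ((l : ℝ) * τ) • M1) M1 A * composedR s τ M0 M1 A l

end SAT

end TentSAT

end

/-! The SAT scheme is a Taylor method for `(M(t) u)' = A u` with `M(t) = M₀ - t M₁`, that is, for `M
u' = (A + M₁) u`. Differentiating `i` times at `t = 0` gives `M₀ u⁽ⁱ⁺¹⁾ = (A + (i + 1) M₁) u⁽ⁱ⁾`, so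
`Xᵢ = τ^i u⁽ⁱ⁾(0)`.

Abstractly, let `M₀` and `M₁` be symmetric, `M(t)` uniformly coercive, all operators bounded, and `2
(A u, u) + (M₁ u, u) ≤ 0`. The Taylor polynomial `q` of degree `s` violates the equation only by one
term of order `t^s` (`residual`). Since `d/dt (M q, q) = 2 (M q', q) - (M₁ q, q)`, dissipativity
lets the energy grow over one step by at most `O(τ^(s+1))` (`energy_taylor_le`). The factor `M(τ)⁻¹
M₀` in the last term changes the result only by `O(τ^(s+1))` (`R_apply_eq`). Over `r = 1/τ` steps
the growth is at most `(1 + k τ^(s+1))^r ≤ 1 + k exp(k) τ^s`, and the step restriction says `τ^s ≤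
h`.

It remains to verify the abstract hypotheses with constants independent of the mesh and of the tent.

Coercivity is causality: `M(t)` belongs to the front `φbot + t δ`, whose gradient is a convex
combination of the two given ones, and a Rayleigh quotient argument turns the bound on the wave
speeds into a bound for the quadratic form (`dotProduct_le_of_pencil`).

The bound for `A` is a matter of scaling: `δ` vanishes at the vertices other than the pole, so
causality gives `δ = O(diam K)`, which offsets the inverse powers of the element size in the inverse
and trace estimates.

Dissipativity is Green's formula on each element, which turns `2 (δ f(u), grad u) + (f(u) grad δ,
u)` into boundary fluxes weighted by `δ` (`green`). The facet opposite to the pole carries `δ = 0`.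
As the pole is interior to `Ω`, every other facet has exactly one neighbour in the patch, and there
the central flux cancels the two one-sided fluxes while `S ≥ 0` gives the sign. -/

noncomputable section

namespace TentSAT

/-! ### Stability of SAT timestepping for abstract operators on an inner product space -/

section SATStability

variable {E : Type} [NormedAddCommGroup E] [InnerProductSpace ℝ E]

local notation "⟪" x ", " y "⟫" => inner ℝ x y

/-- The operators of a tent: symmetric, uniformly bounded mass operators and a dissipative `A`. -/
structure TentOperators (m C τ : ℝ) (M0 M1 A : Module.End ℝ E) : Prop where
  symm₀ : ∀ u w, ⟪M0 u, w⟫ = ⟪u, M0 w⟫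
  symm₁ : ∀ u w, ⟪M1 u, w⟫ = ⟪u, M1 w⟫
  coercive : ∀ t, 0 ≤ t → t ≤ τ → ∀ u, m * ‖u‖ ^ 2 ≤ ⟪(M0 - t • M1) u, u⟫
  bound₀ : ∀ u, ‖M0 u‖ ≤ C * ‖u‖
  bound₁ : ∀ u, ‖M1 u‖ ≤ C * ‖u‖
  boundA : ∀ u, ‖A u‖ ≤ C * ‖u‖
  dissipative : ∀ u, 2 * ⟪A u, u⟫ + ⟪M1 u, u⟫ ≤ 0

/-- A bound for the norm of the `i`-th pseudotime derivative. -/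
def derivBound (m C : ℝ) : ℕ → ℝ
  | 0 => 1
  | i + 1 => C * (i + 2) / m * derivBound m C i

theorem derivBound_nonneg {m C : ℝ} (hm : 0 < m) (hC : 0 ≤ C) (i : ℕ) : 0 ≤ derivBound m C i := by
  induction i with
  | zero => simp [derivBound]
  | succ i ih => simp only [derivBound]; positivity

/-- The `i`-th pseudotime derivative at `0` of the solution of `(M u)' = A u`. -/
def derivAt (M0 M1 A : Module.End ℝ E) (u : E) : ℕ → E
  | 0 => u
  | i + 1 => Ring.inverse M0 ((A + ((i + 1 : ℕ) : ℝ) • M1) (derivAt M0 M1 A u i))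

/-- Both recursions are the same up to one factor `τ` per step; this identifies the sum of the `Xᵢ /
i!` as a Taylor polynomial at `t = τ`. -/
theorem X_apply_eq (τ : ℝ) (M0 M1 A : Module.End ℝ E) (u : E) (i : ℕ) :
    X τ M0 M1 A i u = τ ^ i • derivAt M0 M1 A u i := by
  induction i with
  | zero => simp [X, derivAt]
  | succ i ih =>
    rw [X, LinearMap.smul_apply, Module.End.mul_apply, Module.End.mul_apply, ih, derivAt, map_smul,
      map_smul, smul_smul, pow_succ']

theorem isUnit_of_coercive [FiniteDimensional ℝ E] {m : ℝ} (hm : 0 < m) {M : Module.End ℝ E}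
    (h : ∀ u, m * ‖u‖ ^ 2 ≤ ⟪M u, u⟫) : IsUnit M := by
  rw [LinearMap.isUnit_iff_ker_eq_bot, LinearMap.ker_eq_bot']
  intro u hu
  have := h u
  rw [hu, inner_zero_left] at this
  by_contra hne
  have : 0 < ‖u‖ := norm_pos_iff.2 hne
  nlinarith [mul_pos hm (pow_pos this 2)]

theorem norm_inverse_le [FiniteDimensional ℝ E] {m : ℝ} (hm : 0 < m) {M : Module.End ℝ E}
    (h : ∀ u, m * ‖u‖ ^ 2 ≤ ⟪M u, u⟫) (w : E) : ‖Ring.inverse M w‖ ≤ ‖w‖ / m := by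
  have hM : M (Ring.inverse M w) = w := by
    rw [← Module.End.mul_apply, Ring.mul_inverse_cancel _ (isUnit_of_coercive hm h),
      Module.End.one_apply]
  set x := Ring.inverse M w
  have h1 := h x
  rw [hM] at h1
  have h2 := real_inner_le_norm w x
  rw [le_div_iff₀ hm]
  by_contra! hlt
  rcases (norm_nonneg x).eq_or_lt with h0 | h0
  · rw [← h0] at hlt
    nlinarith [norm_nonneg w]
  · nlinarith

/-- The Taylor polynomial of degree `s`. -/
def taylor (M0 M1 A : Module.End ℝ E) (u : E) (s : ℕ) (t : ℝ) : E :=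
  ∑ i ∈ Finset.range (s + 1), (t ^ i / (i.factorial : ℝ)) • derivAt M0 M1 A u i

theorem hasDerivAt_taylor (M0 M1 A : Module.End ℝ E) (u : E) (s : ℕ) (t : ℝ) :
    HasDerivAt (taylor M0 M1 A u s)
      (∑ i ∈ Finset.range s, (t ^ i / (i.factorial : ℝ)) • derivAt M0 M1 A u (i + 1)) t := by
  induction s with
  | zero =>
    have : taylor M0 M1 A u 0 = fun _ => u := by
      ext
      simp [taylor, derivAt]
    rw [this, Finset.range_zero, Finset.sum_empty]
    exact hasDerivAt_const t u
  | succ s ih =>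
    rw [Finset.sum_range_succ]
    have : taylor M0 M1 A u (s + 1) = fun t => taylor M0 M1 A u s t +
        (t ^ (s + 1) / ((s + 1).factorial : ℝ)) • derivAt M0 M1 A u (s + 1) := by
      ext t
      rw [taylor, Finset.sum_range_succ, taylor]
    rw [this]
    refine ih.add ?_
    have h := ((hasDerivAt_pow (s + 1) t).div_const ((s + 1).factorial : ℝ)).smul_const
      (derivAt M0 M1 A u (s + 1))
    convert h using 2
    rw [Nat.factorial_succ]
    push_cast
    have := Nat.factorial_ne_zero s
    field_simp

/-- A bound for the norm of the Taylor polynomial. -/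
def taylorBound (m C : ℝ) (s : ℕ) : ℝ :=
  ∑ i ∈ Finset.range (s + 1), derivBound m C i

/-- The growth constant of one SAT step for the squared energy norm. -/
def stepConst (m C : ℝ) (s : ℕ) : ℝ :=
  (2 * (C * (s + 2) * derivBound m C s) * taylorBound m C s +
    (2 * (2 * C * taylorBound m C s) * (C / m * derivBound m C s) +
      2 * C * (C / m * derivBound m C s) ^ 2)) / m

theorem taylorBound_nonneg {m C : ℝ} (hm : 0 < m) (hC : 0 ≤ C) (s : ℕ) :
    0 ≤ taylorBound m C s :=
  Finset.sum_nonneg fun i _ => derivBound_nonneg hm hC i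

theorem stepConst_nonneg {m C : ℝ} (hm : 0 < m) (hC : 0 ≤ C) (s : ℕ) :
    0 ≤ stepConst m C s := by
  have := taylorBound_nonneg hm hC s
  have := derivBound_nonneg hm hC s
  unfold stepConst
  positivity

namespace TentOperators

variable [FiniteDimensional ℝ E] {m C τ : ℝ} {M0 M1 A : Module.End ℝ E}

theorem norm_derivAt_le (H : TentOperators m C τ M0 M1 A) (hm : 0 < m) (hC : 0 ≤ C) (hτ : 0 ≤ τ)
    (u : E) (i : ℕ) : ‖derivAt M0 M1 A u i‖ ≤ derivBound m C i * ‖u‖ := by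
  have h0 : ∀ u, m * ‖u‖ ^ 2 ≤ ⟪M0 u, u⟫ := fun u => by simpa using H.coercive 0 le_rfl hτ u
  induction i with
  | zero => simp [derivAt, derivBound]
  | succ i ih =>
    rw [derivAt, derivBound]
    refine (norm_inverse_le hm h0 _).trans ?_
    rw [div_le_iff₀ hm]
    set x := derivAt M0 M1 A u i
    have h1 : ‖(A + ((i + 1 : ℕ) : ℝ) • M1) x‖ ≤ C * (i + 2) * ‖x‖ := by
      rw [LinearMap.add_apply, LinearMap.smul_apply]
      refine (norm_add_le _ _).trans ?_
      rw [norm_smul, Real.norm_natCast]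
      have := H.boundA x
      have := mul_le_mul_of_nonneg_left (H.bound₁ x) (Nat.cast_nonneg (α := ℝ) (i + 1))
      push_cast at *
      linarith
    refine h1.trans ((mul_le_mul_of_nonneg_left ih (by positivity)).trans (le_of_eq ?_))
    field_simp

/-- In `M q' - (A + M₁) q` the recursion for the derivatives cancels all powers of `t` below the
`s`-th. Raising the degree replaces the old residual by the next one, which is why induction on `s`
works. -/
theorem residual (H : TentOperators m C τ M0 M1 A) (hm : 0 < m) (hτ : 0 ≤ τ) (u : E) (s : ℕ)
    (t : ℝ) :
    (M0 - t • M1) (∑ i ∈ Finset.range s, (t ^ i / (i.factorial : ℝ)) • derivAt M0 M1 A u (i + 1)) =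
      (A + M1) (taylor M0 M1 A u s t) -
        (t ^ s / (s.factorial : ℝ)) • (A + ((s + 1 : ℕ) : ℝ) • M1) (derivAt M0 M1 A u s) := by
  have h0 : ∀ u, m * ‖u‖ ^ 2 ≤ ⟪M0 u, u⟫ := fun u => by simpa using H.coercive 0 le_rfl hτ u
  have hM : ∀ w, M0 (Ring.inverse M0 w) = w := fun w => by
    rw [← Module.End.mul_apply, Ring.mul_inverse_cancel _ (isUnit_of_coercive hm h0),
      Module.End.one_apply]
  induction s with
  | zero => simp [taylor, derivAt]
  | succ s ih =>
    have hT : taylor M0 M1 A u (s + 1) t = taylor M0 M1 A u s t +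
        (t ^ (s + 1) / ((s + 1).factorial : ℝ)) • derivAt M0 M1 A u (s + 1) := by
      rw [taylor, Finset.sum_range_succ, taylor]
    have hd : M0 (derivAt M0 M1 A u (s + 1)) =
        (A + ((s + 1 : ℕ) : ℝ) • M1) (derivAt M0 M1 A u s) := hM _
    rw [Finset.sum_range_succ, map_add, ih, hT, map_smul, map_add (A + M1), map_smul (A + M1),
      LinearMap.sub_apply, hd, LinearMap.smul_apply]
    simp only [LinearMap.add_apply, LinearMap.smul_apply]
    -- The part `-t M₁` of the mass operator acting on the new term contributes `s + 1` copies of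
    -- `M₁` at order `t^(s+1)`; together with the copy in `A + M₁` they make up the factor `s + 2`
    -- of the new residual.
    have e : t ^ s / (s.factorial : ℝ) * t =
        t ^ (s + 1) / ((s + 1).factorial : ℝ) * (s + 1 : ℝ) := by
      rw [Nat.factorial_succ]
      push_cast
      have := Nat.factorial_ne_zero s
      field_simp
      ring
    rw [smul_sub, smul_smul, e]
    push_cast
    module

theorem norm_taylor_le (H : TentOperators m C τ M0 M1 A) (hm : 0 < m) (hC : 0 ≤ C) (hτ : 0 ≤ τ)
    (u : E) (s : ℕ) {t : ℝ} (ht : 0 ≤ t) (ht1 : t ≤ 1) :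
    ‖taylor M0 M1 A u s t‖ ≤ taylorBound m C s * ‖u‖ := by
  rw [taylor, taylorBound, Finset.sum_mul]
  refine (norm_sum_le _ _).trans (Finset.sum_le_sum fun i _ => ?_)
  rw [norm_smul, Real.norm_of_nonneg (by positivity)]
  have h1 : t ^ i / (i.factorial : ℝ) ≤ 1 := by
    rw [div_le_one (by positivity)]
    refine (pow_le_one₀ ht ht1).trans ?_
    exact_mod_cast Nat.one_le_iff_ne_zero.2 (Nat.factorial_ne_zero i)
  calc _ ≤ 1 * ‖derivAt M0 M1 A u i‖ := by gcongr
    _ ≤ _ := by rw [one_mul]; exact H.norm_derivAt_le hm hC hτ u i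

/-- By symmetry the energy has derivative `2 (M q', q) - (M₁ q, q)`. Inserting the residual identity
leaves `2 (A q, q) + (M₁ q, q) ≤ 0` and a residual of order `t^s`, which integrates to order
`τ^(s+1)`. -/
theorem energy_taylor_le (H : TentOperators m C τ M0 M1 A) (hm : 0 < m) (hC : 0 ≤ C) (hτ : 0 ≤ τ)
    (hτ1 : τ ≤ 1) (u : E) (s : ℕ) :
    ⟪(M0 - τ • M1) (taylor M0 M1 A u s τ), taylor M0 M1 A u s τ⟫ ≤ ⟪M0 u, u⟫ +
      τ ^ (s + 1) * (2 * (C * (s + 2) * derivBound m C s) * taylorBound m C s) * ‖u‖ ^ 2 := by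
  set p := taylor M0 M1 A u s with hp
  set p' : ℝ → E := fun t =>
    ∑ i ∈ Finset.range s, (t ^ i / (i.factorial : ℝ)) • derivAt M0 M1 A u (i + 1) with hp'
  have hd : ∀ t, HasDerivAt p (p' t) t := fun t => hasDerivAt_taylor M0 M1 A u s t
  have hL : ∀ (L : Module.End ℝ E) t, HasDerivAt (fun t => L (p t)) (L (p' t)) t := fun L t =>
    (LinearMap.toContinuousLinearMap L).hasFDerivAt.comp_hasDerivAt t (hd t)
  set f : ℝ → ℝ := fun t => ⟪(M0 - t • M1) (p t), p t⟫ with hf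
  have hfd : ∀ t, HasDerivAt f (2 * ⟪(M0 - t • M1) (p' t), p t⟫ - ⟪M1 (p t), p t⟫) t := by
    intro t
    have h1 := (((hL M0 t).sub ((hasDerivAt_id t).smul (hL M1 t)))).inner ℝ (hd t)
    refine HasDerivAt.congr_deriv (f := f) h1 ?_
    simp only [Pi.sub_apply, Pi.smul_apply', LinearMap.sub_apply, LinearMap.smul_apply, id,
      inner_sub_left, inner_add_left, inner_smul_left, H.symm₀ (p' t) (p t), H.symm₁ (p' t) (p t),
      one_smul]
    rw [real_inner_comm (M0 (p t)), real_inner_comm (M1 (p t))]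
    simp only [conj_trivial]
    ring
  set B := 2 * (C * (s + 2) * derivBound m C s) * taylorBound m C s * ‖u‖ ^ 2 with hB
  have hbd : ∀ t ∈ Set.Icc (0 : ℝ) τ,
      2 * ⟪(M0 - t • M1) (p' t), p t⟫ - ⟪M1 (p t), p t⟫ ≤ τ ^ s * B := by
    intro t ht
    have hr := H.residual hm hτ u s t
    rw [hr, inner_sub_left, LinearMap.add_apply, inner_add_left, inner_smul_left]
    have h1 := H.dissipative (p t)
    set x := derivAt M0 M1 A u s
    have hx : ‖x‖ ≤ derivBound m C s * ‖u‖ := H.norm_derivAt_le hm hC hτ u s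
    have hpt : ‖p t‖ ≤ taylorBound m C s * ‖u‖ :=
      H.norm_taylor_le hm hC hτ u s ht.1 (ht.2.trans hτ1)
    have h2 : ‖(A + ((s + 1 : ℕ) : ℝ) • M1) x‖ ≤ C * (s + 2) * ‖x‖ := by
      rw [LinearMap.add_apply, LinearMap.smul_apply]
      refine (norm_add_le _ _).trans ?_
      rw [norm_smul, Real.norm_natCast]
      have := H.boundA x
      have := mul_le_mul_of_nonneg_left (H.bound₁ x) (Nat.cast_nonneg (α := ℝ) (s + 1))
      push_cast at *
      linarith
    have h3 := abs_real_inner_le_norm ((A + ((s + 1 : ℕ) : ℝ) • M1) x) (p t)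
    have hdb := derivBound_nonneg hm hC s
    have h4 : |⟪(A + ((s + 1 : ℕ) : ℝ) • M1) x, p t⟫| ≤
        C * (s + 2) * (derivBound m C s * ‖u‖) * (taylorBound m C s * ‖u‖) := by
      refine h3.trans (mul_le_mul (h2.trans ?_) hpt (norm_nonneg _) (by positivity))
      gcongr
    have h5 : t ^ s / (s.factorial : ℝ) ≤ τ ^ s := by
      have : (1 : ℝ) ≤ s.factorial := by
        exact_mod_cast Nat.one_le_iff_ne_zero.2 (Nat.factorial_ne_zero s)
      exact (div_le_self (pow_nonneg ht.1 s) this).trans (pow_le_pow_left₀ ht.1 ht.2 s)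
    have h6 : 0 ≤ t ^ s / (s.factorial : ℝ) := div_nonneg (pow_nonneg ht.1 _) (by positivity)
    have h7 : -(t ^ s / (s.factorial : ℝ) * ⟪(A + ((s + 1 : ℕ) : ℝ) • M1) x, p t⟫) ≤
        τ ^ s * (C * (s + 2) * (derivBound m C s * ‖u‖) * (taylorBound m C s * ‖u‖)) := by
      rw [← mul_neg]
      calc _ ≤ t ^ s / (s.factorial : ℝ) * |⟪(A + ((s + 1 : ℕ) : ℝ) • M1) x, p t⟫| := by
            gcongr
            exact neg_le_abs _
        _ ≤ _ := by gcongr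
    simp only [conj_trivial]
    rw [hB]
    nlinarith
  -- Subtracting the linear function with the maximal slope makes the energy nonincreasing; this
  -- replaces an integration over `[0, τ]`.
  have hmono : AntitoneOn (fun t => f t - τ ^ s * B * t) (Set.Icc 0 τ) := by
    refine antitoneOn_of_deriv_nonpos (convex_Icc _ _) ?_ ?_ ?_
    · exact (continuous_iff_continuousAt.2 fun t => (((hfd t).sub
        ((hasDerivAt_id t).const_mul _)).continuousAt)).continuousOn
    · exact fun t _ => ((hfd t).sub
        ((hasDerivAt_id t).const_mul _)).differentiableAt.differentiableWithinAt
    · intro t ht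
      rw [interior_Icc] at ht
      have hfd' : HasDerivAt (fun t => f t - τ ^ s * B * t) _ t :=
        (hfd t).sub ((hasDerivAt_id t).const_mul _)
      rw [hfd'.deriv]
      have := hbd t ⟨ht.1.le, ht.2.le⟩
      linarith
  have := hmono (Set.left_mem_Icc.2 hτ) (Set.right_mem_Icc.2 hτ) hτ
  have hp0 : p 0 = u := by
    rw [hp, taylor, Finset.sum_range_succ']
    simp [derivAt]
  simp only [hf, hp0] at this
  simp only [zero_smul, sub_zero, mul_zero] at this
  rw [hB] at this
  rw [pow_succ]
  linarith

/-- `M(τ)⁻¹ M₀ = I + τ M(τ)⁻¹ M₁`, so the modified last term is the ordinary last Taylor term plus a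
correction with one more power of `τ`. -/
theorem R_apply_eq (H : TentOperators m C τ M0 M1 A) (hm : 0 < m) (hτ : 0 ≤ τ) (u : E) (s : ℕ) :
    R s τ M0 M1 A u = taylor M0 M1 A u s τ + (τ ^ (s + 1) / (s.factorial : ℝ)) •
      Ring.inverse (M0 - τ • M1) (M1 (derivAt M0 M1 A u s)) := by
  have hM : ∀ w, Ring.inverse (M0 - τ • M1) ((M0 - τ • M1) w) = w := fun w => by
    rw [← Module.End.mul_apply,
      Ring.inverse_mul_cancel _ (isUnit_of_coercive hm (H.coercive τ hτ le_rfl)),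
      Module.End.one_apply]
  set x := derivAt M0 M1 A u s
  have h0 : M0 x = (M0 - τ • M1) x + τ • M1 x := by simp
  rw [R, taylor, Finset.sum_range_succ]
  simp only [LinearMap.add_apply, LinearMap.sum_apply, LinearMap.smul_apply, Module.End.mul_apply,
    map_smul, X_apply_eq]
  rw [h0, map_add, hM, map_smul]
  simp only [smul_smul, smul_add, add_assoc]
  congr 1
  · exact Finset.sum_congr rfl fun i _ => by rw [div_eq_inv_mul]
  · congr 2 <;> ring

/-- With `e` the correction of order `τ^(s+1)`, the energy of `q + e` exceeds that of the Taylor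
polynomial `q` by `2 (M q, e) + (M e, e)`, which is of the order already allowed. -/
theorem step (H : TentOperators m C τ M0 M1 A) (hm : 0 < m) (hC : 0 ≤ C) (hτ : 0 ≤ τ)
    (hτ1 : τ ≤ 1) (s : ℕ) (u : E) :
    ⟪(M0 - τ • M1) (R s τ M0 M1 A u), R s τ M0 M1 A u⟫ ≤
      (1 + stepConst m C s * τ ^ (s + 1)) * ⟪M0 u, u⟫ := by
  have hen := H.energy_taylor_le hm hC hτ hτ1 u s
  rw [H.R_apply_eq hm hτ]
  set p := taylor M0 M1 A u s τ
  have hpn : ‖p‖ ≤ taylorBound m C s * ‖u‖ := H.norm_taylor_le hm hC hτ u s hτ hτ1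
  set y := Ring.inverse (M0 - τ • M1) (M1 (derivAt M0 M1 A u s))
  have hy : ‖y‖ ≤ C / m * derivBound m C s * ‖u‖ := by
    refine (norm_inverse_le hm (H.coercive τ hτ le_rfl) _).trans ?_
    rw [div_le_iff₀ hm]
    refine (H.bound₁ _).trans ((mul_le_mul_of_nonneg_left
      (H.norm_derivAt_le hm hC hτ u s) hC).trans (le_of_eq ?_))
    field_simp
  have hdb := derivBound_nonneg hm hC s
  have htb := taylorBound_nonneg hm hC s
  set e := (τ ^ (s + 1) / (s.factorial : ℝ)) • y
  have he : ‖e‖ ≤ τ ^ (s + 1) * (C / m * derivBound m C s * ‖u‖) := by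
    rw [norm_smul, Real.norm_of_nonneg (by positivity)]
    have : (1 : ℝ) ≤ s.factorial := by
      exact_mod_cast Nat.one_le_iff_ne_zero.2 (Nat.factorial_ne_zero s)
    gcongr
    exact div_le_self (by positivity) this
  have hMb : ∀ w, ‖(M0 - τ • M1) w‖ ≤ 2 * C * ‖w‖ := fun w => by
    rw [LinearMap.sub_apply, LinearMap.smul_apply]
    refine (norm_sub_le _ _).trans ?_
    rw [norm_smul, Real.norm_of_nonneg hτ]
    have h1 := H.bound₀ w
    have h2 := H.bound₁ w
    have h3 := mul_le_mul_of_nonneg_right hτ1 (norm_nonneg (M1 w))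
    linarith
  have hsym : ⟪(M0 - τ • M1) e, p⟫ = ⟪(M0 - τ • M1) p, e⟫ := by
    simp only [LinearMap.sub_apply, LinearMap.smul_apply, inner_sub_left, inner_smul_left,
      H.symm₀ e p, H.symm₁ e p]
    rw [real_inner_comm e (M0 p), real_inner_comm e (M1 p)]
  have h1 : ⟪(M0 - τ • M1) p, e⟫ ≤
      2 * C * (taylorBound m C s * ‖u‖) * (τ ^ (s + 1) * (C / m * derivBound m C s * ‖u‖)) := by
    refine (real_inner_le_norm _ _).trans (mul_le_mul ((hMb p).trans ?_) he (norm_nonneg _)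
      (by positivity))
    gcongr
  have h2 : ⟪(M0 - τ • M1) e, e⟫ ≤
      τ ^ (s + 1) * (2 * C * (C / m * derivBound m C s * ‖u‖) ^ 2) := by
    have h3 : ⟪(M0 - τ • M1) e, e⟫ ≤ 2 * C * ‖e‖ ^ 2 := by
      refine (real_inner_le_norm _ _).trans ?_
      rw [pow_two, ← mul_assoc]
      exact mul_le_mul_of_nonneg_right (hMb e) (norm_nonneg _)
    have h4 : ‖e‖ ^ 2 ≤ (τ ^ (s + 1) * (C / m * derivBound m C s * ‖u‖)) ^ 2 := by gcongr
    have h5 : τ ^ (s + 1) ≤ 1 := pow_le_one₀ hτ hτ1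
    have h6 : 0 ≤ τ ^ (s + 1) := by positivity
    -- The quadratic term is of higher order; `τ ≤ 1` lets it be absorbed in the same power of `τ`.
    have h7 : (τ ^ (s + 1)) ^ 2 ≤ τ ^ (s + 1) := by nlinarith
    refine h3.trans ?_
    calc _ ≤ 2 * C * (τ ^ (s + 1) * (C / m * derivBound m C s * ‖u‖)) ^ 2 := by gcongr
      _ = (τ ^ (s + 1)) ^ 2 * (2 * C * (C / m * derivBound m C s * ‖u‖) ^ 2) := by ring
      _ ≤ _ := by gcongr
  have hmu : ‖u‖ ^ 2 ≤ ⟪M0 u, u⟫ / m := by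
    rw [le_div_iff₀ hm, mul_comm]
    simpa using H.coercive 0 le_rfl hτ u
  rw [map_add, inner_add_left, inner_add_right, inner_add_right, hsym]
  -- The three summands of `stepConst` are, in this order, the Taylor residual, the cross term with
  -- `e` and the square of `e`; its division by `m` converts `‖u‖ ^ 2` into the energy.
  have hfin : ⟪(M0 - τ • M1) p, p⟫ + ⟪(M0 - τ • M1) p, e⟫ +
      (⟪(M0 - τ • M1) p, e⟫ + ⟪(M0 - τ • M1) e, e⟫) ≤
      ⟪M0 u, u⟫ + (stepConst m C s * m) * τ ^ (s + 1) * ‖u‖ ^ 2 := by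
    have hk : stepConst m C s * m = 2 * (C * (s + 2) * derivBound m C s) * taylorBound m C s +
        (2 * (2 * C * taylorBound m C s) * (C / m * derivBound m C s) +
          2 * C * (C / m * derivBound m C s) ^ 2) := by
      rw [stepConst, div_mul_cancel₀ _ hm.ne']
    rw [hk]
    linarith
  refine hfin.trans ?_
  have : (stepConst m C s * m) * τ ^ (s + 1) * ‖u‖ ^ 2 ≤
      (stepConst m C s * m) * τ ^ (s + 1) * (⟪M0 u, u⟫ / m) := by
    have := stepConst_nonneg hm hC s
    gcongr
  refine (add_le_add_right this _).trans (le_of_eq ?_)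
  field_simp

/-- The energy norm at the end of a subtent is the one at the start of the next, so the growth
factors multiply without any loss from equivalence of norms. -/
theorem composed {τ : ℝ} {r : ℕ} (hr : r * τ = 1) (H : TentOperators m C 1 M0 M1 A) (hm : 0 < m)
    (hC : 0 ≤ C) (hτ : 0 ≤ τ) (s : ℕ) (u : E) (l : ℕ) (hl : l ≤ r) :
    ⟪(M0 - ((l : ℝ) * τ) • M1) (composedR s τ M0 M1 A l u), composedR s τ M0 M1 A l u⟫ ≤
      (1 + stepConst m (2 * C) s * τ ^ (s + 1)) ^ l * ⟪M0 u, u⟫ := by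
  induction l with
  | zero => simp [composedR]
  | succ l ih =>
    have hlr : ((l + 1 : ℕ) : ℝ) * τ ≤ 1 := by
      rw [← hr]
      gcongr
    push_cast at hlr
    have hlτ : 0 ≤ (l : ℝ) * τ := by positivity
    -- The shifted operator `M₀ - l τ M₁` is bounded by twice the constant because `l τ ≤ 1`.
    -- Coercivity is inherited with the same `m`, since `l τ + t` stays in `[0, 1]`.
    have H' : TentOperators m (2 * C) τ (M0 - ((l : ℝ) * τ) • M1) M1 A :=
      { symm₀ := fun u w => by
          simp only [LinearMap.sub_apply, LinearMap.smul_apply, inner_sub_left, inner_sub_right,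
            inner_smul_left, inner_smul_right, H.symm₀, H.symm₁, conj_trivial]
        symm₁ := H.symm₁
        coercive := fun t ht htτ u => by
          have := H.coercive ((l : ℝ) * τ + t) (by positivity) (by linarith) u
          rwa [add_smul, ← sub_sub] at this
        bound₀ := fun w => by
          rw [LinearMap.sub_apply, LinearMap.smul_apply]
          refine (norm_sub_le _ _).trans ?_
          rw [norm_smul, Real.norm_of_nonneg hlτ]
          have h1 := H.bound₀ w
          have h2 := H.bound₁ w
          have h3 := mul_le_mul_of_nonneg_right (show (l : ℝ) * τ ≤ 1 by linarith)
            (norm_nonneg (M1 w))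
          linarith
        bound₁ := fun w => (H.bound₁ w).trans (by gcongr; linarith)
        boundA := fun w => (H.boundA w).trans (by gcongr; linarith)
        dissipative := H.dissipative }
    have hs := H'.step hm (by positivity) hτ (by linarith) s (composedR s τ M0 M1 A l u)
    have hk := stepConst_nonneg hm (show 0 ≤ 2 * C by positivity) s
    rw [sub_sub, ← add_smul, show (l : ℝ) * τ + τ = ((l + 1 : ℕ) : ℝ) * τ by push_cast; ring] at hs
    rw [composedR, Module.End.mul_apply]
    refine hs.trans ?_
    rw [pow_succ' (1 + _), mul_assoc]
    gcongr
    exact ih (by omega)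

/-- Stability of structure-aware Taylor timestepping. -/
theorem stable {r : ℕ} (hr : 1 ≤ r) (H : TentOperators m C 1 M0 M1 A) (hm : 0 < m) (hC : 0 ≤ C)
    (s : ℕ) (u : E) :
    √⟪(M0 - M1) (composedR s (1 / r : ℝ) M0 M1 A r u), composedR s (1 / r : ℝ) M0 M1 A r u⟫ ≤
      (1 + stepConst m (2 * C) s * Real.exp (stepConst m (2 * C) s) * (1 / r : ℝ) ^ s) *
        √⟪M0 u, u⟫ := by
  have hr0 : (r : ℝ) ≠ 0 := by positivity
  have h1 : (r : ℝ) * (1 / r) = 1 := by field_simp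
  have h := H.composed h1 hm hC (by positivity) s u r le_rfl
  rw [h1, one_smul] at h
  set k := stepConst m (2 * C) s
  have hk : 0 ≤ k := stepConst_nonneg hm (show 0 ≤ 2 * C by positivity) s
  set τ : ℝ := 1 / r with hτ
  have hτ0 : 0 ≤ τ := by positivity
  have hτ1 : τ ≤ 1 := by
    rw [hτ, div_le_one (by positivity)]
    exact_mod_cast hr
  -- With `y = k τ^s ≤ k`, the product is at most `exp y`, and `exp y ≤ 1 + y exp y` follows from `1
  -- - y ≤ exp (-y)`.
  have hpow : (1 + k * τ ^ (s + 1)) ^ r ≤ 1 + k * Real.exp k * τ ^ s := by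
    have hx : 0 ≤ k * τ ^ s := by positivity
    have hxk : k * τ ^ s ≤ k := mul_le_of_le_one_right hk (pow_le_one₀ hτ0 hτ1)
    calc (1 + k * τ ^ (s + 1)) ^ r ≤ (Real.exp (k * τ ^ (s + 1))) ^ r := by
          gcongr
          rw [add_comm]
          exact Real.add_one_le_exp _
      _ = Real.exp (k * τ ^ s) := by
          rw [← Real.exp_nat_mul]
          congr 1
          rw [pow_succ]
          linear_combination (k * τ ^ s) * h1
      _ ≤ 1 + (k * τ ^ s) * Real.exp (k * τ ^ s) := by
          have := Real.add_one_le_exp (-(k * τ ^ s))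
          have h2 := mul_le_mul_of_nonneg_right this (Real.exp_pos (k * τ ^ s)).le
          rw [← Real.exp_add] at h2
          simp at h2
          linarith
      _ ≤ 1 + (k * τ ^ s) * Real.exp k := by gcongr
      _ = _ := by ring
  have hM0 : 0 ≤ ⟪M0 u, u⟫ := by
    have := H.coercive 0 le_rfl zero_le_one u
    rw [zero_smul, sub_zero] at this
    exact le_trans (by positivity) this
  set x := k * Real.exp k * τ ^ s
  have hx : 0 ≤ x := by positivity
  -- The square root keeps the factor because `1 + x ≤ (1 + x) ^ 2`.
  refine Real.sqrt_le_iff.2 ⟨by positivity,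
    (h.trans (mul_le_mul_of_nonneg_right hpow hM0)).trans ?_⟩
  rw [mul_pow, Real.sq_sqrt hM0]
  gcongr
  nlinarith

end TentOperators

end SATStability

/-! ### Polynomials on `ℝ^d` and inverse estimates -/

section Polynomials

variable {d : ℕ}

/-- The evaluation of a polynomial at a point of `ℝ^d`. -/
abbrev evalPt (x : Pt d) (q : MvPolynomial (Fin d) ℝ) : ℝ := MvPolynomial.eval (fun i => x i) q

theorem contDiff_evalPt (q : MvPolynomial (Fin d) ℝ) : ContDiff ℝ ∞ fun x : Pt d => evalPt x q := by
  induction q using MvPolynomial.induction_on with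
  | C a => simpa using contDiff_const
  | add p q hp hq => simpa using hp.add hq
  | mul_X p i hp =>
    simp only [evalPt, map_mul, MvPolynomial.eval_X]
    exact hp.mul (by fun_prop)

@[fun_prop]
theorem continuous_evalPt (q : MvPolynomial (Fin d) ℝ) : Continuous fun x : Pt d => evalPt x q :=
  (contDiff_evalPt q).continuous

theorem fderiv_evalPt (q : MvPolynomial (Fin d) ℝ) (x : Pt d) (j : Fin d) :
    fderiv ℝ (fun x : Pt d => evalPt x q) x (EuclideanSpace.single j 1) =
      evalPt x (MvPolynomial.pderiv j q) := by
  have hd : ∀ q, DifferentiableAt ℝ (fun x : Pt d => evalPt x q) x := fun q =>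
    (contDiff_evalPt q).differentiable (by simp) x
  induction q using MvPolynomial.induction_on with
  | C a => simp [evalPt]
  | add p q hp hq =>
    have : (fun x : Pt d => evalPt x (p + q)) = fun x => evalPt x p + evalPt x q := by
      ext; simp [evalPt]
    rw [this, fderiv_fun_add (hd p) (hd q), add_apply, hp, hq]
    simp [evalPt]
  | mul_X p i hp =>
    have : (fun x : Pt d => evalPt x (p * MvPolynomial.X i)) = fun x => evalPt x p * x i := by
      ext; simp [evalPt]
    have hi : HasFDerivAt (fun x : Pt d => x i) (EuclideanSpace.proj (𝕜 := ℝ) i) x :=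
      (EuclideanSpace.proj (𝕜 := ℝ) i : Pt d →L[ℝ] ℝ).hasFDerivAt
    rw [this, fderiv_fun_mul (hd p) hi.differentiableAt, hi.fderiv, add_apply,
      smul_apply, smul_apply, hp]
    by_cases hij : i = j
    · subst hij
      simp [evalPt, MvPolynomial.pderiv_X]
    · simp [evalPt, MvPolynomial.pderiv_X, hij]

/-- An open set contains a cube, a product of infinite sets, and a polynomial that vanishes on such
a product is zero. The detour through `Fin d → ℝ` makes the balls of the metric into cubes. -/
theorem eq_zero_of_eqOn_isOpen {U : Set (Pt d)} (hU : IsOpen U) (hne : U.Nonempty)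
    {q : MvPolynomial (Fin d) ℝ} (h : ∀ x ∈ U, evalPt x q = 0) : q = 0 := by
  obtain ⟨x, hx⟩ := hne
  have hV : IsOpen ((WithLp.toLp 2 : (Fin d → ℝ) → Pt d) ⁻¹' U) :=
    hU.preimage (PiLp.continuous_toLp 2 _)
  obtain ⟨ε, hε, hball⟩ := Metric.isOpen_iff.1 hV (fun i => x i) hx
  refine MvPolynomial.funext_set (fun i => Metric.ball (x i) ε) (fun i => ?_) fun y hy => ?_
  · exact infinite_of_mem_nhds (x i) (Metric.ball_mem_nhds _ hε)
  · rw [map_zero]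
    refine h (WithLp.toLp 2 y) (hball ?_)
    rw [ball_pi _ hε]
    exact hy

theorem eq_zero_of_setIntegral_sq {s : Set (Pt d)} (hs : (interior s).Nonempty)
    (hc : IsCompact s) {q : MvPolynomial (Fin d) ℝ} (h : ∫ x in s, evalPt x q ^ 2 = 0) : q = 0 := by
  have hcont : Continuous fun x : Pt d => evalPt x q ^ 2 := by fun_prop
  have hi : IntegrableOn (fun x : Pt d => evalPt x q ^ 2) s :=
    hcont.continuousOn.integrableOn_compact hc
  rw [setIntegral_eq_zero_iff_of_nonneg_ae
    (Filter.Eventually.of_forall fun x => sq_nonneg _) hi] at h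
  have h' : (fun x : Pt d => evalPt x q ^ 2) =ᵐ[volume.restrict (interior s)] 0 :=
    ae_restrict_of_ae_restrict_of_subset interior_subset h
  have := Measure.eqOn_open_of_ae_eq h' isOpen_interior hcont.continuousOn continuousOn_const
  exact eq_zero_of_eqOn_isOpen isOpen_interior hs fun x hx => by simpa using this hx

/-- The substitution `x ↦ x₀ + ρ x`. -/
def affineSubst (x₀ : Pt d) (ρ : ℝ) : MvPolynomial (Fin d) ℝ →ₐ[ℝ] MvPolynomial (Fin d) ℝ :=
  MvPolynomial.bind₁ fun i => MvPolynomial.C (x₀ i) + MvPolynomial.C ρ * MvPolynomial.X i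

theorem evalPt_affineSubst (x₀ : Pt d) (ρ : ℝ) (q : MvPolynomial (Fin d) ℝ) (z : Pt d) :
    evalPt z (affineSubst x₀ ρ q) = evalPt (x₀ + ρ • z) q := by
  induction q using MvPolynomial.induction_on with
  | C a => simp [affineSubst, evalPt]
  | add p q hp hq => simp only [map_add, evalPt] at *; rw [hp, hq]
  | mul_X p i hp =>
    simp only [map_mul, evalPt] at *
    rw [hp]
    simp [affineSubst]

theorem pderiv_affineSubst (x₀ : Pt d) (ρ : ℝ) (q : MvPolynomial (Fin d) ℝ) (j : Fin d) :
    MvPolynomial.pderiv j (affineSubst x₀ ρ q) =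
      MvPolynomial.C ρ * affineSubst x₀ ρ (MvPolynomial.pderiv j q) := by
  induction q using MvPolynomial.induction_on with
  | C a => simp [affineSubst]
  | add p q hp hq => simp only [map_add, hp, hq, mul_add]
  | mul_X p i hp =>
    simp only [map_mul, Derivation.leibniz, hp, smul_eq_mul, map_add]
    have h1 : affineSubst x₀ ρ (MvPolynomial.X i) =
      MvPolynomial.C (x₀ i) + MvPolynomial.C ρ * MvPolynomial.X i := by simp [affineSubst]
    rw [h1]
    by_cases hij : i = j
    · subst hij
      simp
      ring
    · simp [MvPolynomial.pderiv_X, Ne.symm hij]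
      ring

theorem totalDegree_affineSubst_le (x₀ : Pt d) (ρ : ℝ) (q : MvPolynomial (Fin d) ℝ) :
    (affineSubst x₀ ρ q).totalDegree ≤ q.totalDegree := by
  conv_lhs => rw [q.as_sum, map_sum]
  refine MvPolynomial.totalDegree_finsetSum_le fun m hm => ?_
  rw [affineSubst, MvPolynomial.bind₁_monomial]
  refine (MvPolynomial.totalDegree_mul _ _).trans ?_
  rw [MvPolynomial.totalDegree_C, zero_add]
  refine (MvPolynomial.totalDegree_finsetProd _ _).trans ?_
  refine le_trans (Finset.sum_le_sum fun i _ => ?_) (MvPolynomial.le_totalDegree hm)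
  refine (MvPolynomial.totalDegree_pow _ _).trans ?_
  have : (MvPolynomial.C (x₀ i) + MvPolynomial.C ρ * MvPolynomial.X i :
      MvPolynomial (Fin d) ℝ).totalDegree ≤ 1 := by
    refine (MvPolynomial.totalDegree_add _ _).trans (max_le (by simp) ?_)
    refine (MvPolynomial.totalDegree_mul _ _).trans ?_
    simp
  exact (Nat.mul_le_mul_left _ this).trans (by simp)

theorem setIntegral_closedBall_affine (f : Pt d → ℝ) (x₀ : Pt d) {ρ : ℝ} (hρ : 0 < ρ) :
    ∫ x in Metric.closedBall x₀ ρ, f x =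
      ρ ^ d * ∫ z in Metric.closedBall (0 : Pt d) 1, f (x₀ + ρ • z) := by
  rw [Measure.setIntegral_comp_smul_of_pos volume (fun z => f (x₀ + z)) _ hρ,
    finrank_euclideanSpace,
    Fintype.card_fin, smul_eq_mul, ← mul_assoc, mul_inv_cancel₀ (by positivity), one_mul,
    smul_closedBall _ _ zero_le_one, smul_zero, Real.norm_of_nonneg hρ.le, mul_one,
    ← (measurePreserving_add_left volume x₀).setIntegral_preimage_emb
      (measurableEmbedding_addLeft x₀) f]
  simp

/-- On a ball and for a bounded degree, the `L²` inner product of polynomials. -/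
@[reducible]
def polyCore (d p : ℕ) :
    InnerProductSpace.Core ℝ (MvPolynomial.restrictTotalDegree (Fin d) ℝ p) where
  inner q r := ∫ z in Metric.closedBall (0 : Pt d) 1, evalPt z q * evalPt z r
  conj_inner_symm q r := by
    simp only [conj_trivial]
    exact integral_congr_ae (Filter.Eventually.of_forall fun z => mul_comm _ _)
  re_inner_nonneg q := integral_nonneg fun z => mul_self_nonneg _
  add_left q r t := by
    rw [← integral_add]
    · refine integral_congr_ae (Filter.Eventually.of_forall fun z => ?_)
      simp [evalPt, add_mul]
    all_goals
      exact ContinuousOn.integrableOn_compact (isCompact_closedBall _ _) (by fun_prop)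
  smul_left q r t := by
    rw [conj_trivial, ← integral_const_mul]
    refine integral_congr_ae (Filter.Eventually.of_forall fun z => ?_)
    simp [evalPt, mul_assoc]
  definite q h := by
    have hint : interior (Metric.closedBall (0 : Pt d) 1) |>.Nonempty :=
      ⟨0, Metric.ball_subset_interior_closedBall (by simp)⟩
    have := eq_zero_of_setIntegral_sq hint (isCompact_closedBall _ _)
      (q := q) (by simpa [pow_two] using h)
    exact Subtype.ext this

/-- A linear map out of a finite-dimensional space is continuous for any norm. The inner product is
passed as a core because `W` carries no norm of its own. -/
theorem exists_bound_of_core {W K : Type*} [AddCommGroup W] [Module ℝ W] [FiniteDimensional ℝ W]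
    [TopologicalSpace K] [CompactSpace K] (cd : InnerProductSpace.Core ℝ W) (S : W →ₗ[ℝ] C(K, ℝ)) :
    ∃ C : ℝ, 0 ≤ C ∧ ∀ q z, S q z ^ 2 ≤ C * cd.inner q q := by
  let _ : NormedAddCommGroup W := cd.toNormedAddCommGroup
  let _ : InnerProductSpace ℝ W := InnerProductSpace.ofCore cd.toCore
  let S' := LinearMap.toContinuousLinearMap S
  refine ⟨‖S'‖ ^ 2, by positivity, fun q z => ?_⟩
  have h4 : |S q z| ≤ ‖S'‖ * ‖q‖ := ((S q).norm_coe_le_norm z).trans (S'.le_opNorm q)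
  have h3 : ‖q‖ ^ 2 = cd.inner q q := (real_inner_self_eq_norm_sq q).symm
  rw [← h3, ← sq_abs, ← mul_pow]
  gcongr

/-- Reference estimate: the `L²` norm on the unit ball controls `T q` even on the larger ball of
radius `κ`, by finite dimension. Such a ball contains the rescaled element. -/
theorem exists_functional_bound (d p : ℕ) (κ : ℝ)
    (T : MvPolynomial (Fin d) ℝ →ₗ[ℝ] MvPolynomial (Fin d) ℝ) :
    ∃ C : ℝ, 0 ≤ C ∧ ∀ q ∈ MvPolynomial.restrictTotalDegree (Fin d) ℝ p, ∀ z : Pt d, ‖z‖ ≤ κ →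
      evalPt z (T q) ^ 2 ≤ C * ∫ z in Metric.closedBall (0 : Pt d) 1, evalPt z q ^ 2 := by
  have hK : CompactSpace (Metric.closedBall (0 : Pt d) κ) :=
    isCompact_iff_compactSpace.1 (isCompact_closedBall _ _)
  let S : MvPolynomial.restrictTotalDegree (Fin d) ℝ p →ₗ[ℝ] C(Metric.closedBall (0 : Pt d) κ, ℝ) :=
    { toFun := fun q => ⟨fun z => evalPt z.1 (T q),
        (continuous_evalPt _).comp continuous_subtype_val⟩
      map_add' := fun q r => by ext; simp [evalPt]
      map_smul' := fun c q => by ext; simp [evalPt] }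
  obtain ⟨C, hC, h⟩ := exists_bound_of_core (polyCore d p) S
  refine ⟨C, hC, fun q hq z hz => (h ⟨q, hq⟩ ⟨z, by simpa using hz⟩).trans (le_of_eq ?_)⟩
  simp only [pow_two]
  rfl

/-- Inverse estimates: bounds for the values and the derivatives of a polynomial by its `L²` norm
on a ball. -/
theorem exists_inverse_estimate (d p : ℕ) (κ : ℝ) :
    ∃ C : ℝ, 0 ≤ C ∧ ∀ q ∈ MvPolynomial.restrictTotalDegree (Fin d) ℝ p, ∀ (x₀ : Pt d) (ρ : ℝ),
      0 < ρ → ∀ y : Pt d, ‖y - x₀‖ ≤ κ * ρ →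
        ρ ^ d * evalPt y q ^ 2 ≤ C * ∫ x in Metric.closedBall x₀ ρ, evalPt x q ^ 2 ∧
        ∀ j, ρ ^ d * (ρ * evalPt y (MvPolynomial.pderiv j q)) ^ 2 ≤
          C * ∫ x in Metric.closedBall x₀ ρ, evalPt x q ^ 2 := by
  obtain ⟨C₀, hC₀, h₀⟩ := exists_functional_bound d p κ LinearMap.id
  choose C₁ hC₁ h₁ using fun j : Fin d =>
    exists_functional_bound d p κ (MvPolynomial.pderiv j).toLinearMap
  have hS : 0 ≤ ∑ j, C₁ j := Finset.sum_nonneg fun j _ => hC₁ j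
  refine ⟨C₀ + ∑ j, C₁ j, by positivity, fun q hq x₀ ρ hρ y hy => ?_⟩
  -- Rescaling to the unit ball: the volume contributes `ρ ^ d`, and each derivative contributes one
  -- factor `ρ` by the chain rule.
  set z : Pt d := ρ⁻¹ • (y - x₀) with hz
  have hyz : y = x₀ + ρ • z := by
    rw [hz, smul_smul, mul_inv_cancel₀ hρ.ne', one_smul, add_sub_cancel]
  have hzn : ‖z‖ ≤ κ := by
    rw [hz, norm_smul, norm_inv, Real.norm_of_nonneg hρ.le, inv_mul_le_iff₀ hρ, mul_comm]
    exact hy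
  have hq' : affineSubst x₀ ρ q ∈ MvPolynomial.restrictTotalDegree (Fin d) ℝ p := by
    rw [MvPolynomial.mem_restrictTotalDegree] at hq ⊢
    exact (totalDegree_affineSubst_le x₀ ρ q).trans hq
  have hI : 0 ≤ ∫ z in Metric.closedBall (0 : Pt d) 1, evalPt z (affineSubst x₀ ρ q) ^ 2 :=
    integral_nonneg fun z => sq_nonneg _
  have hint : ∫ x in Metric.closedBall x₀ ρ, evalPt x q ^ 2 =
      ρ ^ d * ∫ z in Metric.closedBall (0 : Pt d) 1, evalPt z (affineSubst x₀ ρ q) ^ 2 := by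
    rw [setIntegral_closedBall_affine _ _ hρ]
    simp only [evalPt_affineSubst]
  set I := ∫ z in Metric.closedBall (0 : Pt d) 1, evalPt z (affineSubst x₀ ρ q) ^ 2
  rw [hint, mul_left_comm]
  refine ⟨?_, fun j => ?_⟩
  · have := h₀ _ hq' z hzn
    rw [LinearMap.id_apply, evalPt_affineSubst, ← hyz] at this
    gcongr
    exact this.trans (mul_le_mul_of_nonneg_right (by linarith) hI)
  · have := h₁ j _ hq' z hzn
    rw [Derivation.coeFn_coe, pderiv_affineSubst] at this
    simp only [evalPt, map_mul, MvPolynomial.eval_C] at this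
    rw [← evalPt, evalPt_affineSubst, ← hyz] at this
    gcongr
    refine this.trans (mul_le_mul_of_nonneg_right ?_ hI)
    have := Finset.single_le_sum (f := C₁) (fun j _ => hC₁ j) (Finset.mem_univ j)
    linarith

end Polynomials

/-! ### Hausdorff measure of pieces of hyperplanes -/

/-- The area of a piece of a hyperplane that lies in a ball. -/
theorem exists_area_bound (d : ℕ) (hd : 1 ≤ d) :
    ∃ C : ℝ, 0 ≤ C ∧ ∀ (n : Pt d) (c : ℝ) (x₀ : Pt d) (ρ : ℝ) (s : Set (Pt d)), n ≠ 0 → 0 ≤ ρ →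
      s ⊆ Metric.closedBall x₀ ρ → (∀ x ∈ s, inner ℝ n x = c) →
        μHE[d - 1] s ≤ ENNReal.ofReal (C * ρ ^ (d - 1)) := by
  set c₀ := volume (Metric.closedBall (0 : Pt (d - 1)) 1)
  have hc₀ : c₀ ≠ ⊤ := (isCompact_closedBall _ _).measure_lt_top.ne
  refine ⟨2 ^ (d - 1) * c₀.toReal, by positivity, fun n c x₀ ρ s hn hρ hs hc => ?_⟩
  rcases s.eq_empty_or_nonempty with rfl | ⟨x₁, hx₁⟩
  · simp
  have : Fact (Module.finrank ℝ (Pt d) = (d - 1) + 1) := ⟨by simp; omega⟩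
  have hfr : Module.finrank ℝ (ℝ ∙ n)ᗮ = d - 1 :=
    Submodule.finrank_orthogonal_span_singleton hn
  -- An isometric parametrization of the hyperplane by `ℝ^(d-1)`, based at a point `x₁` of `s`,
  -- since `x₀` need not lie on the hyperplane. This recentring is the origin of the radius `2 ρ`.
  let f : Pt (d - 1) → Pt d := fun v =>
    (((stdOrthonormalBasis ℝ (ℝ ∙ n)ᗮ).reindex (finCongr hfr)).repr.symm v : Pt d) + x₁
  have hf : Isometry f := by
    refine Isometry.of_dist_eq fun v w => ?_
    simp only [f, dist_add_right]
    rw [← Subtype.dist_eq, LinearIsometryEquiv.dist_map]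
  have hsub : s ⊆ f '' Metric.closedBall 0 (2 * ρ) := by
    intro x hx
    have hmem : x - x₁ ∈ (ℝ ∙ n)ᗮ := by
      rw [Submodule.mem_orthogonal_singleton_iff_inner_right, inner_sub_right, hc x hx, hc x₁ hx₁,
        sub_self]
    refine ⟨((stdOrthonormalBasis ℝ (ℝ ∙ n)ᗮ).reindex (finCongr hfr)).repr ⟨x - x₁, hmem⟩, ?_, ?_⟩
    · rw [mem_closedBall_zero_iff, LinearIsometryEquiv.norm_map, Submodule.coe_norm]
      have h1 := hs hx
      have h2 := hs hx₁
      rw [mem_closedBall_iff_norm] at h1 h2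
      calc ‖x - x₁‖ = ‖(x - x₀) - (x₁ - x₀)‖ := by rw [sub_sub_sub_cancel_right]
        _ ≤ _ := (norm_sub_le _ _).trans (by linarith)
    · simp [f]
  refine (measure_mono hsub).trans ?_
  rw [hf.euclideanHausdorffMeasure_image, EuclideanSpace.euclideanHausdorffMeasure_eq_volume,
    Measure.addHaar_closedBall' _ _ (by positivity), finrank_euclideanSpace, Fintype.card_fin,
    show volume (Metric.closedBall (0 : Pt (d - 1)) 1) = ENNReal.ofReal c₀.toReal from
      (ENNReal.ofReal_toReal hc₀).symm, ← ENNReal.ofReal_mul (by positivity)]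
  refine ENNReal.ofReal_le_ofReal (le_of_eq ?_)
  rw [mul_pow]
  ring

/-! ### Simplices: barycentric coordinates, normals and neighbours across facets -/

section SimplexGeometry

variable {d : ℕ}

/-- The gradient of an affine function. -/
def affGrad (g : Pt d →ᵃ[ℝ] ℝ) : Pt d :=
  (InnerProductSpace.toDual ℝ (Pt d)).symm (LinearMap.toContinuousLinearMap g.linear)

theorem inner_affGrad (g : Pt d →ᵃ[ℝ] ℝ) (x y : Pt d) :
    inner ℝ (affGrad g) (y - x) = g y - g x := by
  rw [affGrad, InnerProductSpace.toDual_symm_apply, LinearMap.coe_toContinuousLinearMap',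
    ← vsub_eq_sub, AffineMap.linearMap_vsub, vsub_eq_sub]

theorem affine_eq_inner (g : Pt d →ᵃ[ℝ] ℝ) (x : Pt d) : g x = inner ℝ (affGrad g) x + g 0 := by
  have := inner_affGrad g 0 x
  rw [sub_zero] at this
  linarith

/-- The affine function with gradient `n` that vanishes at `x₀`. -/
def innerAffine (n x₀ : Pt d) : Pt d →ᵃ[ℝ] ℝ :=
  (innerₛₗ ℝ n).toAffineMap - AffineMap.const ℝ (Pt d) (inner ℝ n x₀)

theorem innerAffine_apply (n x₀ x : Pt d) : innerAffine n x₀ x = inner ℝ n (x - x₀) := by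
  simp [innerAffine, inner_sub_right]

theorem eq_affGrad_of_inner {n : Pt d} {g : Pt d →ᵃ[ℝ] ℝ}
    (h : ∀ x y, inner ℝ n (y - x) = g y - g x) : n = affGrad g := by
  refine ext_inner_right ℝ fun y => ?_
  have h1 := h 0 y
  rw [← inner_affGrad] at h1
  simpa using h1

theorem affine_smul_apply (c : ℝ) (g : Pt d →ᵃ[ℝ] ℝ) (x : Pt d) : (c • g) x = c * g x := rfl

theorem continuous_affine (g : Pt d →ᵃ[ℝ] ℝ) : Continuous g :=
  AffineMap.continuous_of_finiteDimensional g

theorem affine_eq_zero_of_mem_hull (g : Pt d →ᵃ[ℝ] ℝ) {T : Finset (Pt d)} (h : ∀ x ∈ T, g x = 0)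
    {x : Pt d} (hx : x ∈ hull T) : g x = 0 :=
  convexHull_min (t := g ⁻¹' {0}) (fun x hx => h x hx)
    ((convex_singleton (0 : ℝ)).affine_preimage g) hx

theorem affine_nonneg_of_mem_hull (g : Pt d →ᵃ[ℝ] ℝ) {T : Finset (Pt d)} (h : ∀ x ∈ T, 0 ≤ g x)
    {x : Pt d} (hx : x ∈ hull T) : 0 ≤ g x :=
  convexHull_min (t := g ⁻¹' Set.Ici 0) (fun x hx => h x hx)
    ((convex_Ici (0 : ℝ)).affine_preimage g) hx

theorem isCompact_hull (K : Finset (Pt d)) : IsCompact (hull K) :=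
  K.finite_toSet.isCompact_convexHull ℝ

/-- `K` is the vertex set of a nondegenerate `d`-simplex. -/
structure IsSimplex (K : Finset (Pt d)) : Prop where
  indep : AffineIndependent ℝ ((↑) : K → Pt d)
  card : K.card = d + 1

namespace IsSimplex

variable {K K' K'' : Finset (Pt d)}

theorem span (hK : IsSimplex K) : affineSpan ℝ (Set.range ((↑) : K → Pt d)) = ⊤ := by
  rw [hK.indep.affineSpan_eq_top_iff_card_eq_finrank_add_one]
  simp [hK.card]

/-- The vertices of a simplex as an affine basis. -/
def basis (hK : IsSimplex K) : AffineBasis K ℝ (Pt d) := ⟨(↑), hK.indep, hK.span⟩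

theorem range_basis (hK : IsSimplex K) : Set.range hK.basis = (K : Set (Pt d)) := Subtype.range_coe

open Classical in
/-- The barycentric coordinate of the vertex `a`. -/
def bary (hK : IsSimplex K) (a : Pt d) : Pt d →ᵃ[ℝ] ℝ :=
  if h : a ∈ K then hK.basis.coord ⟨a, h⟩ else 0

theorem bary_self (hK : IsSimplex K) {a : Pt d} (ha : a ∈ K) : hK.bary a a = 1 := by
  rw [bary, dif_pos ha]
  exact hK.basis.coord_apply_eq ⟨a, ha⟩

theorem bary_of_ne (hK : IsSimplex K) {a b : Pt d} (ha : a ∈ K) (hb : b ∈ K) (h : b ≠ a) :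
    hK.bary a b = 0 := by
  rw [bary, dif_pos ha]
  exact hK.basis.coord_apply_ne (j := ⟨b, hb⟩) fun e => h (congrArg Subtype.val e).symm

theorem mem_hull_iff (hK : IsSimplex K) {x : Pt d} :
    x ∈ hull K ↔ ∀ a ∈ K, 0 ≤ hK.bary a x := by
  rw [hull, ← hK.range_basis, hK.basis.convexHull_eq_nonneg_coord]
  refine ⟨fun h a ha => ?_, fun h a => ?_⟩
  · rw [bary, dif_pos ha]
    exact h ⟨a, ha⟩
  · have := h a.1 a.2
    rwa [bary, dif_pos a.2] at this

theorem interior_nonempty (hK : IsSimplex K) : (interior (hull K)).Nonempty := by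
  rw [interior_convexHull_nonempty_iff_affineSpan_eq_top, ← hK.range_basis]
  exact hK.span

theorem affine_ext (hK : IsSimplex K) {f g : Pt d →ᵃ[ℝ] ℝ} (h : ∀ x ∈ K, f x = g x) : f = g := by
  refine AffineMap.ext_on (s := Set.range ((↑) : K → Pt d)) hK.span ?_
  rintro _ ⟨x, rfl⟩
  exact h x x.2

open Classical in
-- The barycentre of the facet, at which every remaining coordinate equals `1 / d`.
theorem exists_relint (hK : IsSimplex K) (hd : 1 ≤ d) {a : Pt d} (ha : a ∈ K) :
    ∃ m ∈ hull (K.erase a), hK.bary a m = 0 ∧ ∀ b ∈ K, b ≠ a → 0 < hK.bary b m := by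
  have hcard : (K.erase a).card = d := by rw [Finset.card_erase_of_mem ha, hK.card]; simp
  have hd0 : (0 : ℝ) < d := by exact_mod_cast hd
  have hm : ∑ b ∈ K.erase a, (d : ℝ)⁻¹ • b ∈ hull (K.erase a) := by
    refine (convex_convexHull ℝ _).sum_mem (fun _ _ => by positivity) ?_
      fun b hb => subset_convexHull ℝ _ hb
    rw [Finset.sum_const, hcard, nsmul_eq_mul, mul_inv_cancel₀ hd0.ne']
  refine ⟨_, hm, ?_, fun b hb hba => ?_⟩
  · refine affine_eq_zero_of_mem_hull _ (fun x hx => ?_) hm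
    exact hK.bary_of_ne ha (Finset.mem_of_mem_erase hx) (Finset.ne_of_mem_erase hx)
  · have h1 : hK.bary b (∑ b ∈ K.erase a, (d : ℝ)⁻¹ • b) =
        ∑ c ∈ K.erase a, (d : ℝ)⁻¹ * hK.bary b c := by
      rw [affine_eq_inner, inner_sum]
      have : ∀ c ∈ K.erase a, (d : ℝ)⁻¹ * hK.bary b c =
          inner ℝ (affGrad (hK.bary b)) ((d : ℝ)⁻¹ • c) + (d : ℝ)⁻¹ * hK.bary b 0 := fun c _ => by
        rw [affine_eq_inner, inner_smul_right, mul_add]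
      rw [Finset.sum_congr rfl this, Finset.sum_add_distrib, Finset.sum_const, hcard, nsmul_eq_mul,
        ← mul_assoc, mul_inv_cancel₀ hd0.ne', one_mul]
    rw [h1]
    refine Finset.sum_pos' (fun c hc => ?_) ⟨b, Finset.mem_erase.2 ⟨hba, hb⟩, ?_⟩
    · exact mul_nonneg (by positivity) (hK.mem_hull_iff.1
        (subset_convexHull ℝ _ (Finset.mem_of_mem_erase hc)) b hb)
    · rw [hK.bary_self hb]
      positivity

open Classical in
theorem affGrad_bary_ne_zero (hK : IsSimplex K) (hd : 1 ≤ d) {a : Pt d} (ha : a ∈ K) :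
    affGrad (hK.bary a) ≠ 0 := by
  intro h
  obtain ⟨m, -, hm, -⟩ := hK.exists_relint hd ha
  have := inner_affGrad (hK.bary a) m a
  rw [h, inner_zero_left, hm, hK.bary_self ha] at this
  norm_num at this

open Classical in
-- The conditions under the choice operator determine the normal: exchanging two vertices of the
-- facet shows that `n` is constant on it, so `⟨n, · - x₀⟩` is a multiple of the barycentric
-- coordinate of `a`. The sign condition and the unit length fix the multiple.
theorem outwardNormal_eq (hK : IsSimplex K) (hd : 1 ≤ d) {a : Pt d} (ha : a ∈ K) :
    outwardNormal K (K.erase a) = -(‖affGrad (hK.bary a)‖⁻¹ • affGrad (hK.bary a)) := by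
  set g := affGrad (hK.bary a) with hg
  have hg0 : 0 < ‖g‖ := norm_pos_iff.2 (hK.affGrad_bary_ne_zero hd ha)
  have hex : ∃ n : Pt d, ‖n‖ = 1 ∧ ∀ x ∈ K.erase a, ∀ y ∈ K, inner ℝ n (y - x) ≤ 0 := by
    refine ⟨-(‖g‖⁻¹ • g), ?_, fun x hx y hy => ?_⟩
    · rw [norm_neg, norm_smul, norm_inv, norm_norm, inv_mul_cancel₀ hg0.ne']
    · rw [inner_neg_left, real_inner_smul_left, inner_affGrad,
        hK.bary_of_ne ha (Finset.mem_of_mem_erase hx) (Finset.ne_of_mem_erase hx), sub_zero]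
      have : 0 ≤ hK.bary a y := hK.mem_hull_iff.1 (subset_convexHull ℝ _ hy) a ha
      exact neg_nonpos.2 (by positivity)
  obtain ⟨hn1, hn⟩ := Classical.epsilon_spec hex
  rw [← outwardNormal] at hn1 hn
  set n := outwardNormal K (K.erase a)
  have hcard : (K.erase a).card = d := by rw [Finset.card_erase_of_mem ha, hK.card]; simp
  obtain ⟨x₀, hx₀⟩ : (K.erase a).Nonempty := Finset.card_pos.1 (by omega)
  set c := inner ℝ n (a - x₀) with hc
  have hc0 : c ≤ 0 := hn x₀ hx₀ a ha
  have hfun : innerAffine n x₀ = c • hK.bary a := by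
    refine hK.affine_ext fun x hx => ?_
    rw [innerAffine_apply, affine_smul_apply]
    by_cases hxa : x = a
    · rw [hxa, hK.bary_self ha, mul_one]
    · rw [hK.bary_of_ne ha hx hxa, mul_zero]
      refine le_antisymm (hn x₀ hx₀ x hx) ?_
      have := hn x (Finset.mem_erase.2 ⟨hxa, hx⟩) x₀ (Finset.mem_of_mem_erase hx₀)
      rw [← neg_sub, inner_neg_right] at this
      linarith
  have hnc : n = c • g := by
    have h1 : n = affGrad (innerAffine n x₀) := eq_affGrad_of_inner fun x y => by
      rw [innerAffine_apply, innerAffine_apply, ← inner_sub_right, sub_sub_sub_cancel_right]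
    have h2 : c • g = affGrad (innerAffine n x₀) := eq_affGrad_of_inner fun x y => by
      rw [hfun, real_inner_smul_left, hg, inner_affGrad, affine_smul_apply,
        affine_smul_apply]
      ring
    rw [h1, h2]
  have hcg : -c * ‖g‖ = 1 := by
    rw [hnc, norm_smul, Real.norm_of_nonpos hc0] at hn1
    exact hn1
  have : c = -‖g‖⁻¹ := by
    rw [eq_neg_iff_add_eq_zero, ← neg_eq_iff_add_eq_zero]
    exact eq_inv_of_mul_eq_one_left hcg
  rw [hnc, this, neg_smul]

open Classical in
theorem norm_outwardNormal (hK : IsSimplex K) (hd : 1 ≤ d) {a : Pt d} (ha : a ∈ K) :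
    ‖outwardNormal K (K.erase a)‖ = 1 := by
  have := norm_pos_iff.2 (hK.affGrad_bary_ne_zero hd ha)
  rw [hK.outwardNormal_eq hd ha, norm_neg, norm_smul, norm_inv, norm_norm,
    inv_mul_cancel₀ this.ne']

open Classical in
theorem inner_outwardNormal (hK : IsSimplex K) (hd : 1 ≤ d) {a : Pt d} (ha : a ∈ K) :
    ∃ c, ∀ x ∈ hull (K.erase a), inner ℝ (outwardNormal K (K.erase a)) x = c := by
  refine ⟨‖affGrad (hK.bary a)‖⁻¹ * hK.bary a 0, fun x hx => ?_⟩
  have h0 : hK.bary a x = 0 := affine_eq_zero_of_mem_hull _ (fun y hy =>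
    hK.bary_of_ne ha (Finset.mem_of_mem_erase hy) (Finset.ne_of_mem_erase hy)) hx
  rw [affine_eq_inner] at h0
  rw [hK.outwardNormal_eq hd ha, inner_neg_left, real_inner_smul_left]
  linear_combination (-‖affGrad (hK.bary a)‖⁻¹) * h0

open Classical in
/-- Two simplices that share exactly a facet lie on different sides of it. -/
theorem bary_neg (hK : IsSimplex K) (hK' : IsSimplex K') (hd : 1 ≤ d) {a a' : Pt d} (ha : a ∈ K)
    (ha' : a' ∈ K') (hF : K ∩ K' = K.erase a) (hF' : K ∩ K' = K'.erase a')
    (hint : hull K ∩ hull K' ⊆ hull (K ∩ K')) : hK.bary a a' < 0 := by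
  -- If `a'` were not strictly beyond the facet, a short move from the barycentre `m` of the facet
  -- towards `a'` would stay in both simplices, hence in the common facet; but the coordinate of
  -- `a'` becomes `ε > 0` there.
  by_contra! hneg
  obtain ⟨m, hm, hma, hmb⟩ := hK.exists_relint hd ha
  have hmK' : m ∈ hull K' := by
    refine convexHull_mono ?_ hm
    rw [← hF, hF']
    exact_mod_cast Finset.erase_subset _ _
  have hm0 : hK'.bary a' m = 0 := by
    rw [← hF, hF'] at hm
    exact affine_eq_zero_of_mem_hull _ (fun y hy =>
      hK'.bary_of_ne ha' (Finset.mem_of_mem_erase hy) (Finset.ne_of_mem_erase hy)) hm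
  have hev : ∀ᶠ ε : ℝ in nhdsWithin 0 (Set.Ioi 0),
      ∀ b ∈ K.erase a, 0 < hK.bary b (AffineMap.lineMap m a' ε) := by
    rw [Filter.eventually_all_finset]
    intro b hb
    have hcont : Continuous fun ε : ℝ => hK.bary b (AffineMap.lineMap m a' ε) :=
      (continuous_affine _).comp AffineMap.lineMap_continuous
    have h0 : 0 < hK.bary b (AffineMap.lineMap m a' (0 : ℝ)) := by
      rw [AffineMap.lineMap_apply_zero]
      exact hmb b (Finset.mem_of_mem_erase hb) (Finset.ne_of_mem_erase hb)
    exact nhdsWithin_le_nhds (hcont.continuousAt.eventually (lt_mem_nhds h0))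
  obtain ⟨ε, ⟨hb, hε1⟩, hε0⟩ := ((hev.and (nhdsWithin_le_nhds (gt_mem_nhds one_pos))).and
    self_mem_nhdsWithin).exists
  replace hε0 : 0 < ε := hε0
  set y : Pt d := AffineMap.lineMap m a' ε
  have hline : ∀ g : Pt d →ᵃ[ℝ] ℝ, g y = (1 - ε) * g m + ε * g a' := fun g => by
    rw [AffineMap.apply_lineMap, AffineMap.lineMap_apply_ring]
  have hyK : y ∈ hull K := by
    rw [hK.mem_hull_iff]
    intro b hbK
    by_cases hba : b = a
    · rw [hba, hline, hma, mul_zero, zero_add]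
      positivity
    · exact (hb b (Finset.mem_erase.2 ⟨hba, hbK⟩)).le
  have hyK' : y ∈ hull K' := by
    rw [hK'.mem_hull_iff] at hmK' ⊢
    intro b hbK
    rw [hline]
    have h1 := hmK' b hbK
    have h2 := hK'.mem_hull_iff.1 (subset_convexHull ℝ _ ha') b hbK
    have h3 : 0 ≤ 1 - ε := by linarith
    positivity
  have hy0 : hK'.bary a' y = 0 := by
    have := hint ⟨hyK, hyK'⟩
    rw [hF'] at this
    exact affine_eq_zero_of_mem_hull _ (fun y hy =>
      hK'.bary_of_ne ha' (Finset.mem_of_mem_erase hy) (Finset.ne_of_mem_erase hy)) this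
  rw [hline, hm0, hK'.bary_self ha'] at hy0
  linarith

open Classical in
theorem bary_eq_smul (hK : IsSimplex K) (hK' : IsSimplex K') {a a' : Pt d} (ha : a ∈ K)
    (ha' : a' ∈ K') (hF : K.erase a = K'.erase a') :
    hK'.bary a' = hK'.bary a' a • hK.bary a := by
  refine hK.affine_ext fun x hx => ?_
  rw [affine_smul_apply]
  by_cases hxa : x = a
  · rw [hxa, hK.bary_self ha, mul_one]
  · rw [hK.bary_of_ne ha hx hxa, mul_zero]
    have : x ∈ K'.erase a' := hF ▸ Finset.mem_erase.2 ⟨hxa, hx⟩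
    exact hK'.bary_of_ne ha' (Finset.mem_of_mem_erase this) (Finset.ne_of_mem_erase this)

open Classical in
theorem exists_erase (hK : IsSimplex K) (hcard : (K ∩ K').card = d) :
    ∃ a ∈ K, a ∉ K' ∧ K ∩ K' = K.erase a := by
  have h1 : (K \ K').card = 1 := by
    have := Finset.card_sdiff_add_card_inter K K'
    have := hK.card
    omega
  obtain ⟨a, ha⟩ := Finset.card_eq_one.1 h1
  have ha' : a ∈ K \ K' := ha ▸ Finset.mem_singleton_self a
  rw [Finset.mem_sdiff] at ha'
  refine ⟨a, ha'.1, ha'.2, ?_⟩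
  ext x
  rw [Finset.mem_inter, Finset.mem_erase]
  refine ⟨fun h => ⟨fun e => ha'.2 (e ▸ h.2), h.1⟩, fun h => ⟨h.2, ?_⟩⟩
  by_contra hx
  have : x ∈ K \ K' := Finset.mem_sdiff.2 ⟨h.2, hx⟩
  rw [ha, Finset.mem_singleton] at this
  exact h.1 this

open Classical in
-- The coordinates of the two opposite vertices both vanish on the common facet, hence are
-- proportional, and the factor is negative as the simplices lie on different sides. Normalizing
-- leaves only the sign.
theorem outwardNormal_neg (hK : IsSimplex K) (hK' : IsSimplex K') (hd : 1 ≤ d)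
    (hcard : (K ∩ K').card = d) (hint : hull K ∩ hull K' ⊆ hull (K ∩ K')) :
    outwardNormal K' (K ∩ K') = -outwardNormal K (K ∩ K') := by
  obtain ⟨a, ha, haK', hF⟩ := hK.exists_erase hcard
  obtain ⟨a', ha', ha'K, hF'⟩ := hK'.exists_erase (K' := K) (by rwa [Finset.inter_comm])
  rw [Finset.inter_comm] at hF'
  have hneg : hK'.bary a' a < 0 := hK'.bary_neg hK hd ha' ha (by rw [Finset.inter_comm, hF'])
    (by rw [Finset.inter_comm, hF]) (by rwa [Set.inter_comm, Finset.inter_comm])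
  have hs := bary_eq_smul hK hK' ha ha' (hF.symm.trans hF')
  set c := hK'.bary a' a
  have hg : affGrad (hK'.bary a') = c • affGrad (hK.bary a) := by
    refine (eq_affGrad_of_inner fun x y => ?_).symm
    rw [real_inner_smul_left, inner_affGrad, hs, affine_smul_apply, affine_smul_apply]
    ring
  conv_lhs => rw [hF']
  rw [hF, hK.outwardNormal_eq hd ha, hK'.outwardNormal_eq hd ha', hg, norm_smul,
    Real.norm_of_nonpos hneg.le, neg_neg, smul_smul, mul_inv, mul_right_comm, ← neg_smul]
  congr 1
  have : c ≠ 0 := hneg.ne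
  field_simp

open Classical in
/-- A facet is shared by at most two simplices. -/
theorem eq_of_inter_eq (hK : IsSimplex K) (hK' : IsSimplex K') (hK'' : IsSimplex K'') (hd : 1 ≤ d)
    (hcard : (K ∩ K').card = d) (hcard' : (K ∩ K'').card = d) (h : K ∩ K' = K ∩ K'')
    (h1 : hull K ∩ hull K' ⊆ hull (K ∩ K')) (h2 : hull K ∩ hull K'' ⊆ hull (K ∩ K''))
    (h3 : hull K' ∩ hull K'' ⊆ hull (K' ∩ K'')) : K' = K'' := by
  by_contra hne
  obtain ⟨a, ha, haK', hF⟩ := hK.exists_erase hcard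
  obtain ⟨a', ha', ha'K, hF'⟩ := hK'.exists_erase (K' := K) (by rwa [Finset.inter_comm])
  obtain ⟨a'', ha'', ha''K, hF''⟩ := hK''.exists_erase (K' := K) (by rwa [Finset.inter_comm])
  rw [Finset.inter_comm] at hF' hF''
  have hsub : K ∩ K' ⊆ K' ∩ K'' := by
    refine Finset.subset_inter Finset.inter_subset_right ?_
    rw [h]
    exact Finset.inter_subset_right
  -- Any larger intersection would have `d + 1` vertices and force `K' = K''`.
  have heq : K ∩ K' = K' ∩ K'' := by
    refine Finset.eq_of_subset_of_card_le hsub ?_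
    rw [hcard]
    by_contra! hlt
    have h5 := Finset.card_le_card (Finset.inter_subset_left (s₁ := K') (s₂ := K''))
    have h6 : K' ∩ K'' = K' := Finset.eq_of_subset_of_card_le Finset.inter_subset_left
      (by rw [hK'.card]; omega)
    refine hne (Finset.eq_of_subset_of_card_le ?_ (by rw [hK'.card, hK''.card]))
    rw [← h6]
    exact Finset.inter_subset_right
  -- Three vertices cannot lie pairwise on opposite sides of one hyperplane: the value at `a''` is a
  -- product of two negative numbers and yet would have to be negative.
  have n1 : hK'.bary a' a < 0 := hK'.bary_neg hK hd ha' ha (by rw [Finset.inter_comm, hF'])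
    (by rw [Finset.inter_comm, hF]) (by rwa [Set.inter_comm, Finset.inter_comm])
  have n2 : hK.bary a a'' < 0 := hK.bary_neg hK'' hd ha ha'' (by rw [← h, hF]) hF'' h2
  have n3 : hK'.bary a' a'' < 0 := hK'.bary_neg hK'' hd ha' ha'' (by rw [← heq, hF'])
    (by rw [← heq, h, hF'']) h3
  rw [bary_eq_smul hK hK' ha ha' (hF.symm.trans hF'), affine_smul_apply] at n3
  nlinarith

end IsSimplex

namespace Mesh

variable {Ω : Set (Pt d)} (𝒯 : Mesh d Ω)

theorem mem_patch {v : Pt d} {K : Finset (Pt d)} :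
    K ∈ 𝒯.patch v ↔ K ∈ 𝒯.elements ∧ v ∈ K := by
  rw [patch, Set.Finite.mem_toFinset]
  rfl

variable {𝒯}

theorem isSimplex {K : Finset (Pt d)} (hK : K ∈ 𝒯.elements) : IsSimplex K :=
  ⟨𝒯.complex.indep hK.1, hK.2⟩

theorem hull_subset {K : Finset (Pt d)} (hK : K ∈ 𝒯.elements) : hull K ⊆ closure Ω := by
  rw [← 𝒯.covers]
  exact 𝒯.complex.convexHull_subset_space hK.1

open Classical in
theorem hull_inter_subset {K K' : Finset (Pt d)} (hK : K ∈ 𝒯.elements) (hK' : K' ∈ 𝒯.elements) :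
    hull K ∩ hull K' ⊆ hull (K ∩ K') := by
  have := 𝒯.complex.inter_subset_convexHull hK.1 hK'.1
  rwa [← Finset.coe_inter] at this

open Classical in
/-- A facet that contains an interior vertex is shared with another element. -/
theorem exists_neighbour (hΩ : IsOpen Ω) (hd : 1 ≤ d) {v : Pt d} (hv : v ∈ Ω) {K : Finset (Pt d)}
    (hK : K ∈ 𝒯.patch v) {a : Pt d} (ha : a ∈ K) (hav : a ≠ v) :
    ∃ K' ∈ 𝒯.patch v, K ∩ K' = K.erase a := by
  rw [mem_patch] at hK
  have hS := isSimplex hK.1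
  obtain ⟨m, hm, hma, hmb⟩ := hS.exists_relint hd ha
  have hvK : v ∈ hull K := subset_convexHull ℝ _ hK.2
  -- Starting at the interior vertex `v`, a short move towards the barycentre of the facet gives a
  -- relative interior point of the facet that is still in `Ω`.
  obtain ⟨x, hxΩ, hxa, hxb⟩ : ∃ x ∈ Ω, hS.bary a x = 0 ∧ ∀ b ∈ K, b ≠ a → 0 < hS.bary b x := by
    have hcont : Continuous fun ε : ℝ => (AffineMap.lineMap v m ε : Pt d) :=
      AffineMap.lineMap_continuous
    have h1 : ∀ᶠ ε : ℝ in nhdsWithin 0 (Set.Ioi 0), (AffineMap.lineMap v m ε : Pt d) ∈ Ω := by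
      refine nhdsWithin_le_nhds (hcont.continuousAt.eventually (hΩ.mem_nhds ?_))
      simpa only [AffineMap.lineMap_apply_zero] using hv
    obtain ⟨ε, ⟨hεΩ, hε1⟩, hε0⟩ := ((h1.and (nhdsWithin_le_nhds (gt_mem_nhds one_pos))).and
      self_mem_nhdsWithin).exists
    replace hε0 : 0 < ε := hε0
    have hline : ∀ g : Pt d →ᵃ[ℝ] ℝ,
        g (AffineMap.lineMap v m ε) = (1 - ε) * g v + ε * g m := fun g => by
      rw [AffineMap.apply_lineMap, AffineMap.lineMap_apply_ring]
    refine ⟨_, hεΩ, ?_, fun b hb hba => ?_⟩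
    · rw [hline, hma, hS.bary_of_ne ha hK.2 hav.symm]
      ring
    · rw [hline]
      have h2 := hS.mem_hull_iff.1 hvK b hb
      have h3 := hmb b hb hba
      have h4 : 0 ≤ 1 - ε := by linarith
      positivity
  have hcl : ∀ F : {F : Finset (Pt d) // F ∈ 𝒯.complex.faces},
      IsClosed (convexHull ℝ (F.1 : Set (Pt d))) := fun F => (isCompact_hull F.1).isClosed
  -- By local finiteness, `x` has a neighbourhood that meets only those faces that contain `x`.
  have hnhds := Filter.inter_mem (𝒯.locallyFinite.iInter_compl_mem_nhds hcl x) (hΩ.mem_nhds hxΩ)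
  have hcont : Continuous fun ε : ℝ => (AffineMap.lineMap x a (-ε) : Pt d) :=
    AffineMap.lineMap_continuous.comp continuous_neg
  have hnear : ∀ᶠ ε : ℝ in nhdsWithin 0 (Set.Ioi 0), (AffineMap.lineMap x a (-ε) : Pt d) ∈
      (⋂ (i : {F : Finset (Pt d) // F ∈ 𝒯.complex.faces})
        (_ : x ∉ convexHull ℝ (i.1 : Set (Pt d))), (convexHull ℝ (i.1 : Set (Pt d)))ᶜ) ∩ Ω := by
    refine nhdsWithin_le_nhds (hcont.continuousAt.eventually ?_)
    simp only [neg_zero, AffineMap.lineMap_apply_zero]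
    exact hnhds
  obtain ⟨ε, ⟨hyn, hyΩ⟩, hε⟩ := (hnear.and self_mem_nhdsWithin).exists
  replace hε : 0 < ε := hε
  -- The negative parameter crosses the facet away from `a`, so `y` leaves `K` but remains in `Ω`.
  -- An element that contains `y` contains `x` as well and is the desired neighbour.
  set y : Pt d := AffineMap.lineMap x a (-ε)
  have hyc : y ∈ 𝒯.complex.space := by
    rw [𝒯.covers]
    exact subset_closure hyΩ
  obtain ⟨T, hT, hyT⟩ := Geometry.SimplicialComplex.mem_space_iff.1 hyc
  obtain ⟨K', hK', hTK', hcard'⟩ := 𝒯.pure T hT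
  have hyK' : y ∈ hull K' := convexHull_mono (by exact_mod_cast hTK') hyT
  have hxK' : x ∈ hull K' := by
    by_contra hx
    exact (Set.mem_iInter₂.1 hyn ⟨K', hK'⟩ hx) hyK'
  have hK'e : K' ∈ 𝒯.elements := ⟨hK', hcard'⟩
  have hyK : y ∉ hull K := by
    intro h
    have := hS.mem_hull_iff.1 h a ha
    rw [AffineMap.apply_lineMap, AffineMap.lineMap_apply_ring, hxa, hS.bary_self ha] at this
    linarith
  have hxK : x ∈ hull K := by
    rw [hS.mem_hull_iff]
    intro b hb
    by_cases hba : b = a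
    · rw [hba, hxa]
    · exact (hxb b hb hba).le
  have hxI := hull_inter_subset hK.1 hK'e ⟨hxK, hxK'⟩
  -- `x` lies in the hull of `K ∩ K'`; a vertex absent from it would have coordinate zero at `x`.
  have hsub : K.erase a ⊆ K ∩ K' := by
    intro b hb
    obtain ⟨hba, hbK⟩ := Finset.mem_erase.1 hb
    refine Finset.mem_inter.2 ⟨hbK, ?_⟩
    by_contra hbK'
    refine (hxb b hbK hba).ne' (affine_eq_zero_of_mem_hull _ (fun c hc => ?_) hxI)
    obtain ⟨hc1, hc2⟩ := Finset.mem_inter.1 hc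
    exact hS.bary_of_ne hbK hc1 fun e => hbK' (e ▸ hc2)
  have haK' : a ∉ K' := by
    intro haK'
    have hKK' : K ⊆ K' := by
      intro b hb
      by_cases hba : b = a
      · rwa [hba]
      · exact (Finset.mem_inter.1 (hsub (Finset.mem_erase.2 ⟨hba, hb⟩))).2
    have : K = K' := Finset.eq_of_subset_of_card_le hKK' (by rw [hS.card, hcard'])
    exact hyK (this ▸ hyK')
  refine ⟨K', (mem_patch _).2 ⟨hK'e, ?_⟩, (Finset.Subset.antisymm hsub fun b hb => ?_).symm⟩
  · exact (Finset.mem_inter.1 (hsub (Finset.mem_erase.2 ⟨hav.symm, hK.2⟩))).2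
  · obtain ⟨hb1, hb2⟩ := Finset.mem_inter.1 hb
    exact Finset.mem_erase.2 ⟨fun e => haK' (e ▸ hb2), hb1⟩

end Mesh

end SimplexGeometry

/-! ### Quadratic forms and the generalized eigenvalue problem -/

section LinearAlgebra

variable {n : Type*} [Fintype n]

theorem dotProduct_mulVec_comm {Q : Matrix n n ℝ} (hQ : Q.IsSymm) (ξ η : n → ℝ) :
    (Q *ᵥ ξ) ⬝ᵥ η = (Q *ᵥ η) ⬝ᵥ ξ := by
  rw [dotProduct_comm, Matrix.dotProduct_mulVec, ← Matrix.mulVec_transpose, hQ.eq]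

theorem mulVec_dotProduct_eq_sum (Q : Matrix n n ℝ) (ξ η : n → ℝ) :
    (Q *ᵥ ξ) ⬝ᵥ η = ∑ k, ∑ l, Q k l * (ξ l * η k) := by
  simp only [dotProduct, Matrix.mulVec, Finset.sum_mul, mul_assoc]

theorem abs_mulVec_dotProduct_le {Q : Matrix n n ℝ} {Λ : ℝ} (hQ : ∀ k l, |Q k l| ≤ Λ)
    (ξ η : n → ℝ) : |(Q *ᵥ ξ) ⬝ᵥ η| ≤ Λ * Fintype.card n * (ξ ⬝ᵥ ξ + η ⬝ᵥ η) := by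
  have h1 : ∀ k l, |Q k l * (ξ l * η k)| ≤ Λ * (ξ l * ξ l + η k * η k) := fun k l => by
    rw [abs_mul]
    have h2 : |ξ l * η k| ≤ ξ l * ξ l + η k * η k :=
      abs_le.2 ⟨by nlinarith [sq_nonneg (ξ l + η k), mul_self_nonneg (ξ l), mul_self_nonneg (η k)],
        by nlinarith [sq_nonneg (ξ l - η k), mul_self_nonneg (ξ l), mul_self_nonneg (η k)]⟩
    exact mul_le_mul (hQ k l) h2 (abs_nonneg _) ((abs_nonneg _).trans (hQ k l))
  rw [mulVec_dotProduct_eq_sum]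
  refine (Finset.abs_sum_le_sum_abs _ _).trans ((Finset.sum_le_sum fun k _ =>
    (Finset.abs_sum_le_sum_abs _ _).trans (Finset.sum_le_sum fun l _ => h1 k l)).trans
    (le_of_eq ?_))
  simp only [← Finset.mul_sum, Finset.sum_add_distrib, Finset.sum_const, Finset.card_univ,
    nsmul_eq_mul, dotProduct]
  ring_nf
  rw [← Finset.mul_sum]
  ring

/-- If all eigenvalues of the pencil `D ξ = c G ξ` are at most `c̄`, then `D ≤ c̄ G`. -/
theorem dotProduct_le_of_pencil {D G : Matrix n n ℝ} (hD : D.IsSymm) (hG : G.IsSymm)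
    (hpos : ∀ ξ : n → ℝ, ξ ≠ 0 → 0 < (G *ᵥ ξ) ⬝ᵥ ξ) {cbar : ℝ}
    (h : ∀ (c : ℝ) (ξ : n → ℝ), ξ ≠ 0 → D *ᵥ ξ = c • (G *ᵥ ξ) → |c| ≤ cbar) (ξ : n → ℝ) :
    (D *ᵥ ξ) ⬝ᵥ ξ ≤ cbar * ((G *ᵥ ξ) ⬝ᵥ ξ) := by
  rcases eq_or_ne ξ 0 with rfl | hξ
  · simp
  have hcont : ∀ Q : Matrix n n ℝ, Continuous fun ξ : n → ℝ => (Q *ᵥ ξ) ⬝ᵥ ξ := fun Q =>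
    (Continuous.matrix_mulVec continuous_const continuous_id).dotProduct continuous_id
  have hs0 : ∀ η ∈ Metric.sphere (0 : n → ℝ) 1, η ≠ 0 := fun η hη h0 => by
    rw [h0] at hη
    simp at hη
  have hne : (Metric.sphere (0 : n → ℝ) 1).Nonempty := by
    refine ⟨‖ξ‖⁻¹ • ξ, ?_⟩
    have := norm_pos_iff.2 hξ
    rw [mem_sphere_zero_iff_norm, norm_smul, norm_inv, norm_norm, inv_mul_cancel₀ this.ne']
  -- The Rayleigh quotient attains its maximum `c`. The sphere is that of the sup norm, which is
  -- harmless because the quotient is homogeneous of degree zero.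
  obtain ⟨η, hη, hmax⟩ := (isCompact_sphere (0 : n → ℝ) 1).exists_isMaxOn hne
    (f := fun η => (D *ᵥ η) ⬝ᵥ η / ((G *ᵥ η) ⬝ᵥ η))
    ((hcont D).continuousOn.div (hcont G).continuousOn fun η hη => (hpos η (hs0 η hη)).ne')
  set c := (D *ᵥ η) ⬝ᵥ η / ((G *ᵥ η) ⬝ᵥ η) with hc
  have hGη := hpos η (hs0 η hη)
  have hle : ∀ ζ : n → ℝ, (D *ᵥ ζ) ⬝ᵥ ζ ≤ c * ((G *ᵥ ζ) ⬝ᵥ ζ) := by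
    intro ζ
    rcases eq_or_ne ζ 0 with rfl | hζ
    · simp
    have hn := norm_pos_iff.2 hζ
    have hmem : ‖ζ‖⁻¹ • ζ ∈ Metric.sphere (0 : n → ℝ) 1 := by
      rw [mem_sphere_zero_iff_norm, norm_smul, norm_inv, norm_norm, inv_mul_cancel₀ hn.ne']
    have := hmax hmem
    simp only [Set.mem_ofPred_eq, Matrix.mulVec_smul, smul_dotProduct, dotProduct_smul,
      smul_eq_mul] at this
    rw [mul_div_mul_left _ _ (inv_ne_zero hn.ne'), mul_div_mul_left _ _ (inv_ne_zero hn.ne'),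
      div_le_iff₀ (hpos ζ hζ)] at this
    exact this
  have hpsd : (c • G - D).PosSemidef := by
    refine Matrix.PosSemidef.of_dotProduct_mulVec_nonneg ?_ fun ζ => ?_
    · rw [Matrix.IsHermitian, Matrix.conjTranspose_eq_transpose_of_trivial, Matrix.transpose_sub,
        Matrix.transpose_smul, hD.eq, hG.eq]
    · rw [star_trivial, dotProduct_comm, Matrix.sub_mulVec, Matrix.smul_mulVec, sub_dotProduct,
        smul_dotProduct, smul_eq_mul]
      exact sub_nonneg.2 (hle ζ)
  -- The form of `c G - D` is nonnegative and vanishes at `η`, so `η` is in its kernel: `c` is an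
  -- eigenvalue of the pencil and the hypothesis applies to it.
  have hzero : (c • G - D) *ᵥ η = 0 := by
    rw [← hpsd.dotProduct_mulVec_zero_iff, star_trivial, dotProduct_comm, Matrix.sub_mulVec,
      Matrix.smul_mulVec, sub_dotProduct, smul_dotProduct, smul_eq_mul, hc,
      div_mul_cancel₀ _ hGη.ne', sub_self]
  rw [Matrix.sub_mulVec, Matrix.smul_mulVec, sub_eq_zero] at hzero
  have hcb := (le_abs_self c).trans (h c η (hs0 η hη) hzero.symm)
  exact (hle ξ).trans (mul_le_mul_of_nonneg_right hcb (hpos ξ hξ).le)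

end LinearAlgebra

/-! ### Bilinear forms and the operators that represent them -/

section Bilinear

variable {V W : Type*} [AddCommGroup V] [Module ℝ V] [AddCommGroup W] [Module ℝ W]

theorem _root_.IsBilinearMap.fun_add {B B' : V → V → ℝ} (h : IsBilinearMap ℝ B)
    (h' : IsBilinearMap ℝ B') : IsBilinearMap ℝ fun u w => B u w + B' u w where
  add_left u u' w := by rw [h.add_left, h'.add_left]; ring
  smul_left c u w := by rw [h.smul_left, h'.smul_left, smul_add]
  add_right u w w' := by rw [h.add_right, h'.add_right]; ring
  smul_right c u w := by rw [h.smul_right, h'.smul_right, smul_add]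

theorem _root_.IsBilinearMap.const_mul {B : V → V → ℝ} (h : IsBilinearMap ℝ B) (c : ℝ) :
    IsBilinearMap ℝ fun u w => c * B u w where
  add_left u u' w := by rw [h.add_left]; ring
  smul_left a u w := by rw [h.smul_left, smul_eq_mul, smul_eq_mul]; ring
  add_right u w w' := by rw [h.add_right]; ring
  smul_right a u w := by rw [h.smul_right, smul_eq_mul, smul_eq_mul]; ring

theorem isBilinearMap_zero : IsBilinearMap ℝ fun _ _ : V => (0 : ℝ) := by
  constructor <;> simp

theorem isBilinearMap_sum {ι : Type*} (s : Finset ι) {B : ι → V → V → ℝ}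
    (h : ∀ i, IsBilinearMap ℝ (B i)) : IsBilinearMap ℝ fun u w => ∑ i ∈ s, B i u w where
  add_left u u' w := by simp only [(h _).add_left, Finset.sum_add_distrib]
  smul_left c u w := by simp only [(h _).smul_left, Finset.smul_sum]
  add_right u w w' := by simp only [(h _).add_right, Finset.sum_add_distrib]
  smul_right c u w := by simp only [(h _).smul_right, Finset.smul_sum]

theorem isBilinearMap_integral {α : Type*} [MeasurableSpace α] {μ : Measure α}
    {F : V → V → α → ℝ} (h : ∀ x, IsBilinearMap ℝ fun u w => F u w x)
    (hi : ∀ u w, Integrable (F u w) μ) : IsBilinearMap ℝ fun u w => ∫ x, F u w x ∂μ where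
  add_left u u' w := by simp only [(h _).add_left, integral_add (hi _ _) (hi _ _)]
  smul_left c u w := by simp only [(h _).smul_left, integral_smul]
  add_right u w w' := by simp only [(h _).add_right, integral_add (hi _ _) (hi _ _)]
  smul_right c u w := by simp only [(h _).smul_right, integral_smul]

theorem isBilinearMap_mulVec {n : Type*} [Fintype n] (Q : Matrix n n ℝ) (f g : V →ₗ[ℝ] n → ℝ) :
    IsBilinearMap ℝ fun u w => (Q *ᵥ f u) ⬝ᵥ g w := by
  constructor <;> intros <;>
    simp [Matrix.mulVec_add, Matrix.mulVec_smul, add_dotProduct, dotProduct_add]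

/-- Riesz representation in finite dimension. It justifies the choice in `opOf`, which is why
bilinearity of every form is needed. -/
theorem exists_operator_of_core [FiniteDimensional ℝ V] (cd : InnerProductSpace.Core ℝ V)
    {B : V → V → ℝ} (hB : IsBilinearMap ℝ B) :
    ∃ T : Module.End ℝ V, ∀ u w, cd.inner (T u) w = B u w := by
  let _ : NormedAddCommGroup V := cd.toNormedAddCommGroup
  let _ : InnerProductSpace ℝ V := InnerProductSpace.ofCore cd.toCore
  have : CompleteSpace V := FiniteDimensional.complete ℝ V
  let T : V → V := fun u =>
    (InnerProductSpace.toDual ℝ V).symm (LinearMap.toContinuousLinearMap (hB.toLinearMap u))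
  have hT : ∀ u w, inner ℝ (T u) w = B u w := fun u w => by
    simp only [T, InnerProductSpace.toDual_symm_apply]
    rfl
  refine ⟨⟨⟨T, fun u u' => ext_inner_right ℝ fun w => ?_⟩,
    fun c u => ext_inner_right ℝ fun w => ?_⟩, hT⟩
  · rw [inner_add_left, hT, hT, hT, hB.add_left]
  · rw [RingHom.id_apply, real_inner_smul_left, hT, hT, hB.smul_left, smul_eq_mul]

end Bilinear

/-- `TentOperators.stable` for an inner product given by a core, with bounds for the forms. -/
theorem stable_of_core {V : Type} [AddCommGroup V] [Module ℝ V] [FiniteDimensional ℝ V]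
    (cd : InnerProductSpace.Core ℝ V) {M0 M1 A : Module.End ℝ V} {m C : ℝ} (hm : 0 < m)
    (hC : 0 ≤ C) (symm₀ : ∀ u w, cd.inner (M0 u) w = cd.inner (M0 w) u)
    (symm₁ : ∀ u w, cd.inner (M1 u) w = cd.inner (M1 w) u)
    (coercive : ∀ t : ℝ, 0 ≤ t → t ≤ 1 → ∀ u,
      m * cd.inner u u ≤ cd.inner (M0 u) u - t * cd.inner (M1 u) u)
    (bound₀ : ∀ u w, |cd.inner (M0 u) w| ≤ C * (cd.inner u u + cd.inner w w))
    (bound₁ : ∀ u w, |cd.inner (M1 u) w| ≤ C * (cd.inner u u + cd.inner w w))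
    (boundA : ∀ u w, |cd.inner (A u) w| ≤ C * (cd.inner u u + cd.inner w w))
    (dissipative : ∀ u, 2 * cd.inner (A u) u + cd.inner (M1 u) u ≤ 0) {r : ℕ} (hr : 1 ≤ r) (s : ℕ)
    (u : V) :
    √(cd.inner ((M0 - M1) (composedR s (1 / r : ℝ) M0 M1 A r u))
        (composedR s (1 / r : ℝ) M0 M1 A r u)) ≤
      (1 + stepConst m (2 * (2 * C)) s * Real.exp (stepConst m (2 * (2 * C)) s) * (1 / r : ℝ) ^ s) *
        √(cd.inner (M0 u) u) := by
  let _ : NormedAddCommGroup V := cd.toNormedAddCommGroup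
  let _ : InnerProductSpace ℝ V := InnerProductSpace.ofCore cd.toCore
  -- Testing with the multiple of `T u` that has the norm of `u` turns the bound for the form into
  -- an operator norm bound, with a factor `2`.
  have hb : ∀ T : Module.End ℝ V,
      (∀ u w, |inner ℝ (T u) w| ≤ C * (inner ℝ u u + inner ℝ w w)) →
        ∀ u, ‖T u‖ ≤ 2 * C * ‖u‖ := by
    intro T hT u
    rcases eq_or_ne (T u) 0 with h0 | h0
    · rw [h0, norm_zero]
      positivity
    have hn := norm_pos_iff.2 h0
    have h := hT u ((‖u‖ / ‖T u‖) • T u)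
    rw [inner_smul_right, real_inner_self_eq_norm_sq, real_inner_self_eq_norm_sq,
      real_inner_self_eq_norm_sq, norm_smul, norm_div, norm_norm, norm_norm,
      div_mul_cancel₀ _ hn.ne', show ‖u‖ / ‖T u‖ * ‖T u‖ ^ 2 = ‖u‖ * ‖T u‖ by field_simp,
      abs_of_nonneg (by positivity)] at h
    rcases (norm_nonneg u).eq_or_lt with hu | hu
    · rw [eq_comm, norm_eq_zero] at hu
      rw [hu, map_zero] at h0
      exact absurd rfl h0
    · refine le_of_mul_le_mul_left ?_ hu
      linarith
  have H : TentOperators m (2 * C) 1 M0 M1 A :=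
    { symm₀ := fun u w => (symm₀ u w).trans (real_inner_comm u (M0 w))
      symm₁ := fun u w => (symm₁ u w).trans (real_inner_comm u (M1 w))
      coercive := fun t h0 h1 u => by
        rw [LinearMap.sub_apply, LinearMap.smul_apply, inner_sub_left, real_inner_smul_left,
          ← real_inner_self_eq_norm_sq]
        exact coercive t h0 h1 u
      bound₀ := hb M0 bound₀
      bound₁ := hb M1 bound₁
      boundA := hb A boundA
      dissipative := dissipative }
  exact H.stable hr hm (by positivity) s u

/-! ### Integrability and gradients of piecewise affine functions -/

section Integrals

variable {d : ℕ}

theorem integrableOn_bounded_mul {μ : Measure (Pt d)} {s : Set (Pt d)} (hs : IsCompact s)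
    (hμ : μ s ≠ ⊤) {m f : Pt d → ℝ} {Λ : ℝ} (hm : Measurable m) (hΛ : ∀ x ∈ s, |m x| ≤ Λ)
    (hf : ContinuousOn f s) : IntegrableOn (fun x => m x * f x) s μ := by
  obtain ⟨c, hc⟩ := hs.exists_bound_of_continuousOn hf
  have : IsFiniteMeasure (μ.restrict s) := ⟨by simpa [lt_top_iff_ne_top] using hμ⟩
  refine Integrable.of_bound
    (hm.aestronglyMeasurable.mul (hf.aestronglyMeasurable hs.measurableSet)) (Λ * c)
    ((ae_restrict_iff' hs.measurableSet).2 (Filter.Eventually.of_forall fun x hx => ?_))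
  rw [norm_mul]
  exact mul_le_mul (hΛ x hx) (hc x hx) (norm_nonneg _) ((abs_nonneg _).trans (hΛ x hx))

theorem gradient_apply (f : Pt d → ℝ) (x : Pt d) (j : Fin d) :
    gradient f x j = fderiv ℝ f x (EuclideanSpace.single j 1) := by
  have h := InnerProductSpace.toDual_symm_apply (𝕜 := ℝ) (x := EuclideanSpace.single j (1 : ℝ))
    (y := fderiv ℝ f x)
  rw [← h, EuclideanSpace.inner_single_right]
  simp [gradient]

theorem hasGradientAt_affine (g : Pt d →ᵃ[ℝ] ℝ) (x : Pt d) : HasGradientAt g (affGrad g) x := by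
  have h : (g : Pt d → ℝ) = fun x => inner ℝ (affGrad g) x + g 0 := funext (affine_eq_inner g)
  rw [hasGradientAt_iff_hasFDerivAt, h]
  exact ((innerSL ℝ (affGrad g)).hasFDerivAt).add_const _

theorem gradient_eq_of_eqOn {f : Pt d → ℝ} {g : Pt d →ᵃ[ℝ] ℝ} {s : Set (Pt d)}
    (h : Set.EqOn f g s) {x : Pt d} (hx : x ∈ interior s) : gradient f x = affGrad g := by
  have he : f =ᶠ[nhds x] g := Filter.mem_of_superset (mem_interior_iff_mem_nhds.1 hx) h
  exact ((hasGradientAt_affine g x).congr_of_eventuallyEq he).gradient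

theorem contDiff_affine (g : Pt d →ᵃ[ℝ] ℝ) : ContDiff ℝ ∞ g := by
  have h : (g : Pt d → ℝ) = fun x => inner ℝ (affGrad g) x + g 0 := funext (affine_eq_inner g)
  rw [h]
  exact (innerSL ℝ (affGrad g)).contDiff.add contDiff_const

/-- The boundary of a convex set is null. Gradients of the fronts are known only inside the
elements, and this suffices under integrals. -/
theorem ae_mem_interior_hull (K : Finset (Pt d)) :
    ∀ᵐ x ∂(volume.restrict (hull K)), x ∈ interior (hull K) := by
  have h1 : volume (frontier (hull K)) = 0 := (convex_convexHull ℝ _).addHaar_frontier volume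
  have h2 : ∀ᵐ x ∂(volume : Measure (Pt d)), x ∉ frontier (hull K) :=
    measure_eq_zero_iff_ae_notMem.1 h1
  refine (ae_restrict_iff' (isCompact_hull K).measurableSet).2 (h2.mono fun x hx hxK => ?_)
  by_contra hxi
  exact hx ⟨subset_closure hxK, hxi⟩

end Integrals

/-! ### Affine description of a tent on one element -/

/-- The affine functions that represent the bottom and the height of a tent on an element. -/
structure TentAffine {d : ℕ} (v : Pt d) (cmax : ℝ) (φbot φtop : Pt d → ℝ) (K : Finset (Pt d))
    (gb gδ : Pt d →ᵃ[ℝ] ℝ) : Prop where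
  eqOn : ∀ x ∈ hull K, φtop x - φbot x = gδ x
  gradient_bot : ∀ x ∈ interior (hull K), gradient φbot x = affGrad gb
  gradient_height : ∀ x ∈ interior (hull K),
    gradient (fun y => φtop y - φbot y) x = affGrad gδ
  causal : ∀ t : ℝ, 0 ≤ t → t ≤ 1 → ‖affGrad gb + t • affGrad gδ‖ ≤ 1 / cmax
  norm_le : ‖affGrad gδ‖ ≤ 2 / cmax
  nonneg : ∀ x ∈ hull K, 0 ≤ gδ x
  le_diam : ∀ x ∈ hull K, gδ x ≤ 2 / cmax * Metric.diam (hull K)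
  eq_zero : ∀ x ∈ K, x ≠ v → gδ x = 0

theorem IsTent.exists_affine {d : ℕ} (hd : 1 ≤ d) {Ω : Set (Pt d)} {𝒯 : Mesh d Ω} {v : Pt d}
    {cmax : ℝ} {φbot φtop : Pt d → ℝ} (H : IsTent 𝒯 v cmax φbot φtop)
    {K : Finset (Pt d)} (hK : K ∈ 𝒯.patch v) :
    ∃ gb gδ, TentAffine v cmax φbot φtop K gb gδ := by
  obtain ⟨gb, hb⟩ := H.affine_bot K hK
  obtain ⟨gt, ht⟩ := H.affine_top K hK
  have hKe := (𝒯.mem_patch.1 hK)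
  have hS := Mesh.isSimplex hKe.1
  have hδ : Set.EqOn (fun y => φtop y - φbot y) (gt - gb : Pt d →ᵃ[ℝ] ℝ) (hull K) := fun x hx => by
    simp only [hb hx, ht hx]
    rfl
  have hgδ : affGrad (gt - gb) = affGrad gt - affGrad gb := by
    refine (eq_affGrad_of_inner fun x y => ?_).symm
    rw [inner_sub_left, inner_affGrad, inner_affGrad]
    show _ = (gt y - gb y) - (gt x - gb x)
    ring
  obtain ⟨z, hz⟩ := hS.interior_nonempty
  have hcb : ‖affGrad gb‖ ≤ 1 / cmax := by
    rw [← gradient_eq_of_eqOn hb hz]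
    exact (H.causal_bot K hK z hz).le
  have hct : ‖affGrad gt‖ ≤ 1 / cmax := by
    rw [← gradient_eq_of_eqOn ht hz]
    exact (H.causal_top K hK z hz).le
  have hnorm : ‖affGrad (gt - gb)‖ ≤ 2 / cmax := by
    rw [hgδ]
    refine (norm_sub_le _ _).trans ((add_le_add hct hcb).trans (le_of_eq ?_))
    ring
  have hzero : ∀ x ∈ K, x ≠ v → (gt - gb) x = 0 := fun x hx hxv => by
    rw [← hδ (subset_convexHull ℝ _ hx)]
    simp only [H.eq_of_ne K hK x hx hxv, sub_self]
  refine ⟨gb, gt - gb, ⟨fun x hx => hδ hx, fun x hx => gradient_eq_of_eqOn hb hx,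
    fun x hx => gradient_eq_of_eqOn hδ hx, fun t h0 h1 => ?_, hnorm, ?_, ?_, hzero⟩⟩
  -- Every intermediate front inherits causality, its gradient being a convex combination of those
  -- of the bottom and the top.
  · have h2 : affGrad gb + t • affGrad (gt - gb) = (1 - t) • affGrad gb + t • affGrad gt := by
      rw [hgδ]
      module
    rw [h2]
    refine (norm_add_le _ _).trans ?_
    rw [norm_smul, norm_smul, Real.norm_of_nonneg h0, Real.norm_of_nonneg (by linarith)]
    nlinarith
  · intro x hx
    refine affine_nonneg_of_mem_hull _ (fun y hy => ?_) hx
    by_cases hyv : y = v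
    · rw [hyv, ← hδ (subset_convexHull ℝ _ hKe.2)]
      exact sub_nonneg.2 H.pole
    · rw [hzero y hy hyv]
  · intro x hx
    -- The height vanishes at any vertex other than the pole, and one exists as `d ≥ 1`; hence the
    -- height is at most its slope times the diameter.
    obtain ⟨w, hw, hwv⟩ : ∃ w ∈ K, w ≠ v :=
      Finset.exists_mem_ne (by rw [hS.card]; omega) v
    have h1 := inner_affGrad (gt - gb) w x
    rw [hzero w hw hwv, sub_zero] at h1
    rw [← h1]
    refine (real_inner_le_norm _ _).trans (mul_le_mul hnorm ?_ (norm_nonneg _)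
      ((norm_nonneg _).trans hnorm))
    rw [← dist_eq_norm]
    exact Metric.dist_le_diam_of_mem (isCompact_hull K).isBounded hx (subset_convexHull ℝ _ hw)

section Integrability

variable {d : ℕ} {n : Type*} [Fintype n]

theorem integrableOn_mulVec {μ : Measure (Pt d)} {s : Set (Pt d)} (hs : IsCompact s)
    (hμ : μ s ≠ ⊤) {Q : Pt d → Matrix n n ℝ} {Λ : ℝ} (hQ : ∀ k l, Measurable fun x => Q x k l)
    (hΛ : ∀ x ∈ s, ∀ k l, |Q x k l| ≤ Λ) {c : Pt d → ℝ} {f g : Pt d → n → ℝ}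
    (hc : ContinuousOn c s) (hf : ContinuousOn f s) (hg : ContinuousOn g s) :
    IntegrableOn (fun x => c x * ((Q x *ᵥ f x) ⬝ᵥ g x)) s μ := by
  have h : (fun x => c x * ((Q x *ᵥ f x) ⬝ᵥ g x)) =
      fun x => ∑ k, ∑ l, Q x k l * (c x * (f x l * g x k)) := by
    ext x
    rw [mulVec_dotProduct_eq_sum]
    simp only [Finset.mul_sum]
    exact Finset.sum_congr rfl fun k _ => Finset.sum_congr rfl fun l _ => by ring
  rw [h]
  refine integrable_finsetSum _ fun k _ => integrable_finsetSum _ fun l _ => ?_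
  exact integrableOn_bounded_mul hs hμ (hQ k l) (fun x hx => hΛ x hx k l)
    (hc.mul (((continuous_apply l).comp_continuousOn hf).mul
      ((continuous_apply k).comp_continuousOn hg)))

end Integrability

/-! ### The DG space as an inner product space and its mass forms -/

section Val

variable {d b p : ℕ} {P : Finset (Finset (Pt d))}

/-- `val` as a linear map. -/
def valL (K : P) (x : Pt d) : DG P b p →ₗ[ℝ] Fin b → ℝ where
  toFun u := val u K x
  map_add' u w := by ext l; simp [val]
  map_smul' c u := by ext l; simp [val]

/-- `pderivVal` as a linear map. -/
def pderivL (K : P) (j : Fin d) (x : Pt d) : DG P b p →ₗ[ℝ] Fin b → ℝ where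
  toFun u := pderivVal u K j x
  map_add' u w := by ext l; simp [pderivVal]
  map_smul' c u := by ext l; simp [pderivVal]

theorem continuous_val (u : DG P b p) (K : P) : Continuous (val u K) :=
  continuous_pi fun l => continuous_evalPt (u K l : MvPolynomial (Fin d) ℝ)

theorem continuous_pderivVal (u : DG P b p) (K : P) (j : Fin d) : Continuous (pderivVal u K j) :=
  continuous_pi fun l => continuous_evalPt (MvPolynomial.pderiv j (u K l : MvPolynomial (Fin d) ℝ))

theorem integrableOn_val_dotProduct (u w : DG P b p) (K K' : P) (F : Finset (Pt d)) :
    IntegrableOn (fun x => val u K x ⬝ᵥ val w K' x) (hull F) :=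
  ContinuousOn.integrableOn_compact (isCompact_hull F)
    ((continuous_val u K).dotProduct (continuous_val w K')).continuousOn

/-- The squared `L²` norm on an element. -/
def sqNorm (u : DG P b p) (K : P) : ℝ := ∫ x in hull K.1, val u K x ⬝ᵥ val u K x

theorem dotProduct_self_nonneg' {n : Type*} [Fintype n] (ξ : n → ℝ) : 0 ≤ ξ ⬝ᵥ ξ :=
  Finset.sum_nonneg fun i _ => mul_self_nonneg (ξ i)

theorem sqNorm_nonneg (u : DG P b p) (K : P) : 0 ≤ sqNorm u K :=
  integral_nonneg fun _ => dotProduct_self_nonneg' _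

theorem ip_self (u : DG P b p) : ip u u = ∑ K, sqNorm u K := rfl

theorem sqNorm_eq_sum (u : DG P b p) (K : P) :
    sqNorm u K = ∑ l, ∫ x in hull K.1, evalPt x (u K l : MvPolynomial (Fin d) ℝ) ^ 2 := by
  rw [← integral_finsetSum]
  · refine integral_congr_ae (Filter.Eventually.of_forall fun x => ?_)
    simp only [dotProduct, val, pow_two]
  · exact fun l _ => ContinuousOn.integrableOn_compact (isCompact_hull K.1)
      ((continuous_evalPt _).pow 2).continuousOn

variable (b p) in
/-- The `L²` inner product on the DG space. -/
@[reducible]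
def dgCore (hP : ∀ K ∈ P, IsSimplex K) : InnerProductSpace.Core ℝ (DG P b p) where
  inner u w := ip u w
  conj_inner_symm u w := by
    simp only [conj_trivial, ip]
    exact Finset.sum_congr rfl fun K _ => integral_congr_ae
      (Filter.Eventually.of_forall fun x => dotProduct_comm _ _)
  re_inner_nonneg u := Finset.sum_nonneg fun K _ => sqNorm_nonneg u K
  add_left u u' w := by
    simp only [ip, ← Finset.sum_add_distrib]
    refine Finset.sum_congr rfl fun K _ => ?_
    rw [← integral_add (integrableOn_val_dotProduct _ _ _ _ _)
      (integrableOn_val_dotProduct _ _ _ _ _)]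
    refine integral_congr_ae (Filter.Eventually.of_forall fun x => ?_)
    have : val (u + u') K x = val u K x + val u' K x := (valL K x).map_add u u'
    simp only [this, add_dotProduct]
  smul_left u w c := by
    simp only [ip, conj_trivial, Finset.mul_sum, ← integral_const_mul]
    refine Finset.sum_congr rfl fun K _ => ?_
    refine integral_congr_ae (Filter.Eventually.of_forall fun x => ?_)
    have : val (c • u) K x = c • val u K x := (valL K x).map_smul c u
    simp only [this, smul_dotProduct, smul_eq_mul]
  definite u hu := by
    have h1 : ∀ K : P, sqNorm u K = 0 := fun K =>
      (Finset.sum_eq_zero_iff_of_nonneg fun K _ => sqNorm_nonneg u K).1 hu K (Finset.mem_univ K)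
    ext K l : 2
    have h2 := h1 K
    rw [sqNorm_eq_sum, Finset.sum_eq_zero_iff_of_nonneg fun l _ =>
      integral_nonneg fun x => sq_nonneg _] at h2
    exact Subtype.ext (eq_zero_of_setIntegral_sq (hP K.1 K.2).interior_nonempty
      (isCompact_hull K.1) (h2 l (Finset.mem_univ l)))

/-- Nondegeneracy of the elements is what makes the `L²` form definite on tuples of polynomials, so
that Riesz representation is available. -/
theorem ip_opOf (hP : ∀ K ∈ P, IsSimplex K) {B : DG P b p → DG P b p → ℝ}
    (hB : IsBilinearMap ℝ B) (u w : DG P b p) : ip (opOf B u) w = B u w :=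
  Classical.epsilon_spec (exists_operator_of_core (dgCore b p hP) hB) u w

/-- A mass form with an element-wise coefficient matrix. -/
def matForm (Q : P → Pt d → Matrix (Fin b) (Fin b) ℝ) (u w : DG P b p) : ℝ :=
  ∑ K : P, ∫ x in hull K.1, (Q K x *ᵥ val u K x) ⬝ᵥ val w K x

/-- Measurable coefficients that are bounded on each element. -/
structure BoundedCoeff (Q : P → Pt d → Matrix (Fin b) (Fin b) ℝ) (q : ℝ) : Prop where
  meas : ∀ K k l, Measurable fun x => Q K x k l
  bound : ∀ K : P, ∀ x ∈ hull K.1, ∀ k l, |Q K x k l| ≤ q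

namespace BoundedCoeff

variable {Q : P → Pt d → Matrix (Fin b) (Fin b) ℝ} {q : ℝ}

theorem integrableOn (h : BoundedCoeff Q q) (u w : DG P b p) (K : P) :
    IntegrableOn (fun x => (Q K x *ᵥ val u K x) ⬝ᵥ val w K x) (hull K.1) := by
  have := integrableOn_mulVec (μ := volume) (isCompact_hull K.1)
    (isCompact_hull K.1).measure_lt_top.ne (h.meas K) (h.bound K) (c := fun _ => 1)
    continuousOn_const (continuous_val u K).continuousOn (continuous_val w K).continuousOn
  simpa only [one_mul] using this

theorem isBilinearMap (h : BoundedCoeff Q q) :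
    IsBilinearMap ℝ (matForm Q : DG P b p → DG P b p → ℝ) :=
  isBilinearMap_sum _ fun K => isBilinearMap_integral
    (fun x => isBilinearMap_mulVec (Q K x) (valL K x) (valL K x)) fun u w => h.integrableOn u w K

theorem abs_matForm_le (h : BoundedCoeff Q q) (u w : DG P b p) :
    |matForm Q u w| ≤ q * b * (ip u u + ip w w) := by
  rw [ip_self, ip_self, ← Finset.sum_add_distrib, Finset.mul_sum]
  refine (Finset.abs_sum_le_sum_abs _ _).trans (Finset.sum_le_sum fun K _ => ?_)
  rw [sqNorm, sqNorm, ← integral_add (integrableOn_val_dotProduct _ _ _ _ _)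
    (integrableOn_val_dotProduct _ _ _ _ _), ← integral_const_mul, ← Real.norm_eq_abs]
  refine norm_integral_le_of_norm_le (((integrableOn_val_dotProduct _ _ _ _ _).add
    (integrableOn_val_dotProduct _ _ _ _ _)).const_mul _) ?_
  refine (ae_restrict_iff' (isCompact_hull K.1).measurableSet).2
    (Filter.Eventually.of_forall fun x hx => ?_)
  simpa using abs_mulVec_dotProduct_le (h.bound K x hx) (val u K x) (val w K x)

end BoundedCoeff

end Val

/-! ### Scaling estimates on shape-regular elements -/

section Regular

variable {d : ℕ}

/-- The ball of radius `ρ` about `x₀` witnesses the shape regularity of `K`. -/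
structure Regular (κ : ℝ) (K : Finset (Pt d)) (x₀ : Pt d) (ρ : ℝ) : Prop where
  pos : 0 < ρ
  sub : Metric.closedBall x₀ ρ ⊆ hull K
  diam : Metric.diam (hull K) ≤ κ * ρ

theorem Regular.norm_sub_le {κ : ℝ} {K : Finset (Pt d)} {x₀ : Pt d} {ρ : ℝ} (h : Regular κ K x₀ ρ)
    {x : Pt d} (hx : x ∈ hull K) : ‖x - x₀‖ ≤ κ * ρ := by
  rw [← dist_eq_norm]
  exact (Metric.dist_le_diam_of_mem (isCompact_hull K).isBounded hx
    (h.sub (Metric.mem_closedBall_self h.pos.le))).trans h.diam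

theorem Regular.nonneg {κ : ℝ} {K : Finset (Pt d)} {x₀ : Pt d} {ρ : ℝ} (h : Regular κ K x₀ ρ) :
    0 ≤ κ * ρ :=
  Metric.diam_nonneg.trans h.diam

theorem exists_volume_bound (d : ℕ) (κ : ℝ) :
    ∃ C : ℝ, 0 ≤ C ∧ ∀ (K : Finset (Pt d)) (x₀ : Pt d) (ρ : ℝ), Regular κ K x₀ ρ →
      volume.real (hull K) ≤ C * ρ ^ d := by
  set c₀ := volume (Metric.closedBall (0 : Pt d) 1)
  have hc₀ : c₀ ≠ ⊤ := (isCompact_closedBall _ _).measure_lt_top.ne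
  -- An element lies in the ball of radius `κ ρ` about `x₀`. The absolute value keeps the constant
  -- nonnegative; that `κ ≥ 0` is known only once an element is given.
  refine ⟨|κ| ^ d * c₀.toReal, by positivity, fun K x₀ ρ h => ?_⟩
  have hsub : hull K ⊆ Metric.closedBall x₀ (κ * ρ) := fun x hx => by
    rw [mem_closedBall_iff_norm]
    exact h.norm_sub_le hx
  have h1 := measureReal_mono hsub (isCompact_closedBall _ _).measure_lt_top.ne (μ := volume)
  have hκ : 0 ≤ κ := nonneg_of_mul_nonneg_left h.nonneg h.pos
  refine h1.trans (le_of_eq ?_)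
  rw [Measure.real, Measure.addHaar_closedBall' _ _ h.nonneg, finrank_euclideanSpace,
    Fintype.card_fin, ENNReal.toReal_mul, ENNReal.toReal_ofReal (pow_nonneg h.nonneg _), mul_pow,
    abs_of_nonneg hκ]
  ring

open Classical in
theorem exists_facet_area_bound (hd : 1 ≤ d) (κ : ℝ) :
    ∃ C : ℝ, 0 ≤ C ∧ ∀ (K : Finset (Pt d)) (x₀ : Pt d) (ρ : ℝ), IsSimplex K → Regular κ K x₀ ρ →
      ∀ a ∈ K, μHE[d - 1] (hull (K.erase a)) ≤ ENNReal.ofReal (C * ρ ^ (d - 1)) := by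
  obtain ⟨C, hC, h⟩ := exists_area_bound d hd
  refine ⟨C * |κ| ^ (d - 1), by positivity, fun K x₀ ρ hK hR a ha => ?_⟩
  obtain ⟨c, hc⟩ := hK.inner_outwardNormal hd ha
  have hκ : 0 ≤ κ := nonneg_of_mul_nonneg_left hR.nonneg hR.pos
  have hn : outwardNormal K (K.erase a) ≠ 0 := by
    rw [← norm_pos_iff, hK.norm_outwardNormal hd ha]
    exact one_pos
  refine (h _ c x₀ (κ * ρ) _ hn hR.nonneg (fun x hx => ?_) hc).trans (le_of_eq ?_)
  · rw [mem_closedBall_iff_norm]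
    exact hR.norm_sub_le (convexHull_mono (by exact_mod_cast Finset.erase_subset a K) hx)
  · rw [mul_pow, abs_of_nonneg hκ, mul_assoc]

/-- The inverse estimate on the inscribed ball reaches all of `K` by shape regularity, and its
right-hand side only grows when the integral is extended from the ball to `K`. -/
theorem exists_val_bound (d b p : ℕ) (κ : ℝ) :
    ∃ C : ℝ, 0 ≤ C ∧ ∀ (P : Finset (Finset (Pt d))) (K : P) (x₀ : Pt d) (ρ : ℝ),
      Regular κ K.1 x₀ ρ → ∀ u : DG P b p, ∀ x ∈ hull K.1,
        ρ ^ d * (val u K x ⬝ᵥ val u K x) ≤ C * sqNorm u K ∧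
        ∀ j, ρ ^ d * (ρ ^ 2 * (pderivVal u K j x ⬝ᵥ pderivVal u K j x)) ≤ C * sqNorm u K := by
  obtain ⟨C, hC, h⟩ := exists_inverse_estimate d p κ
  refine ⟨C, hC, fun P K x₀ ρ hR u x hx => ?_⟩
  have hmono : ∀ l, ∫ x in Metric.closedBall x₀ ρ, evalPt x (u K l : MvPolynomial (Fin d) ℝ) ^ 2 ≤
      ∫ x in hull K.1, evalPt x (u K l : MvPolynomial (Fin d) ℝ) ^ 2 := fun l =>
    setIntegral_mono_set (ContinuousOn.integrableOn_compact (isCompact_hull K.1)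
      ((continuous_evalPt _).pow 2).continuousOn)
      (Filter.Eventually.of_forall fun x => sq_nonneg _) (Filter.Eventually.of_forall hR.sub)
  have hl := fun l => h _ (u K l).2 x₀ ρ hR.pos x (hR.norm_sub_le hx)
  rw [sqNorm_eq_sum, Finset.mul_sum]
  refine ⟨?_, fun j => ?_⟩
  · rw [dotProduct, Finset.mul_sum]
    refine Finset.sum_le_sum fun l _ => ?_
    have := (hl l).1.trans (mul_le_mul_of_nonneg_left (hmono l) hC)
    rwa [pow_two (evalPt x _)] at this
  · rw [dotProduct, Finset.mul_sum, Finset.mul_sum]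
    refine Finset.sum_le_sum fun l _ => ?_
    have := ((hl l).2 j).trans (mul_le_mul_of_nonneg_left (hmono l) hC)
    rw [mul_pow, pow_two (evalPt x _)] at this
    exact this

end Regular

/-! ### Coefficient bounds and coercivity from causality -/

section Coefficients

variable {d b : ℕ} {sys : System d b} {Ω : Set (Pt d)} {Λ γ cbar : ℝ}

theorem System.normalMatrix_apply (sys : System d b) (ν x : Pt d) (k l : Fin b) :
    sys.normalMatrix ν x k l = ∑ j, ν j * sys.ℒ j x k l := by
  rw [System.normalMatrix, Matrix.sum_apply]
  rfl

theorem System.normalMatrix_add (sys : System d b) (ν ν' x : Pt d) :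
    sys.normalMatrix (ν + ν') x = sys.normalMatrix ν x + sys.normalMatrix ν' x := by
  simp [System.normalMatrix, add_smul, Finset.sum_add_distrib]

theorem System.normalMatrix_smul (sys : System d b) (c : ℝ) (ν x : Pt d) :
    sys.normalMatrix (c • ν) x = c • sys.normalMatrix ν x := by
  simp [System.normalMatrix, Finset.smul_sum, smul_smul]

theorem System.normalMatrix_neg (sys : System d b) (ν x : Pt d) :
    sys.normalMatrix (-ν) x = -sys.normalMatrix ν x := by
  simp [System.normalMatrix]

namespace System.IsAdmissible

theorem measurable_normalMatrix (H : sys.IsAdmissible Ω Λ γ cbar) (ν : Pt d) (k l : Fin b) :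
    Measurable fun x => sys.normalMatrix ν x k l := by
  simp only [System.normalMatrix_apply]
  exact Finset.measurable_sum _ fun j _ => (H.measurable_ℒ j k l).const_mul _

theorem abs_normalMatrix_le (H : sys.IsAdmissible Ω Λ γ cbar) (ν : Pt d) {x : Pt d}
    (hx : x ∈ closure Ω) (k l : Fin b) :
    |sys.normalMatrix ν x k l| ≤ d * |Λ| * ‖ν‖ := by
  rw [System.normalMatrix_apply]
  refine (Finset.abs_sum_le_sum_abs _ _).trans ?_
  have h1 : ∀ j ∈ Finset.univ, |ν j * sys.ℒ j x k l| ≤ ‖ν‖ * |Λ| := fun j _ => by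
    rw [abs_mul]
    exact mul_le_mul (PiLp.norm_apply_le ν j) ((H.bound_ℒ j x hx k l).trans (le_abs_self Λ))
      (abs_nonneg _) (norm_nonneg _)
  refine (Finset.sum_le_card_nsmul _ _ _ h1).trans (le_of_eq ?_)
  rw [Finset.card_univ, Fintype.card_fin, nsmul_eq_mul]
  ring

theorem isSymm_normalMatrix (H : sys.IsAdmissible Ω Λ γ cbar) (ν : Pt d) {x : Pt d}
    (hx : x ∈ closure Ω) :
    (sys.normalMatrix ν x).IsSymm := by
  rw [Matrix.IsSymm, System.normalMatrix, Matrix.transpose_sum]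
  exact Finset.sum_congr rfl fun j _ => by rw [Matrix.transpose_smul, (H.symm_ℒ j x hx).eq]

/-- Causality makes the mass matrix uniformly positive definite. -/
theorem ae_coercive (H : sys.IsAdmissible Ω Λ γ cbar) (hγ : 0 < γ) {cmax : ℝ}
    (hcmax : 0 < cmax) (hc : cbar < cmax) :
    ∀ᵐ x ∂(volume.restrict (closure Ω)), ∀ ν : Pt d, ‖ν‖ ≤ 1 / cmax → ∀ ξ : Fin b → ℝ,
      (1 - max cbar 0 / cmax) * γ * (ξ ⬝ᵥ ξ) ≤
        ((sys.𝒢 x - sys.normalMatrix ν x) *ᵥ ξ) ⬝ᵥ ξ := by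
  filter_upwards [H.wave_speed, ae_restrict_mem isClosed_closure.measurableSet] with x hw hx ν hν ξ
  have hG : γ * (ξ ⬝ᵥ ξ) ≤ (sys.𝒢 x *ᵥ ξ) ⬝ᵥ ξ := by
    rw [dotProduct_comm (sys.𝒢 x *ᵥ ξ)]
    exact H.pos_𝒢 x hx ξ
  have hpos : ∀ ξ : Fin b → ℝ, ξ ≠ 0 → 0 < (sys.𝒢 x *ᵥ ξ) ⬝ᵥ ξ := fun ξ hξ => by
    rw [dotProduct_comm]
    refine lt_of_lt_of_le (mul_pos hγ ?_) (H.pos_𝒢 x hx ξ)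
    exact lt_of_le_of_ne (dotProduct_self_nonneg' ξ)
      fun h => hξ (dotProduct_self_eq_zero.1 h.symm)
  have hG0 : 0 ≤ (sys.𝒢 x *ᵥ ξ) ⬝ᵥ ξ :=
    (mul_nonneg hγ.le (dotProduct_self_nonneg' ξ)).trans hG
  have hN : (sys.normalMatrix ν x *ᵥ ξ) ⬝ᵥ ξ ≤
      max cbar 0 / cmax * ((sys.𝒢 x *ᵥ ξ) ⬝ᵥ ξ) := by
    -- The pencil bound concerns unit vectors, so `ν` is normalized. `max cbar 0` allows the
    -- replacement of `‖ν‖` by `1 / cmax` without a sign assumption on `cbar`.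
    rcases eq_or_ne ν 0 with rfl | hν0
    · have : sys.normalMatrix 0 x = 0 := by simp [System.normalMatrix]
      rw [this, Matrix.zero_mulVec, zero_dotProduct]
      positivity
    · have hn := norm_pos_iff.2 hν0
      have h1 := dotProduct_le_of_pencil (H.isSymm_normalMatrix (‖ν‖⁻¹ • ν) hx) (H.symm_𝒢 x hx) hpos
        (hw (‖ν‖⁻¹ • ν) (by rw [norm_smul, norm_inv, norm_norm, inv_mul_cancel₀ hn.ne'])) ξ
      rw [System.normalMatrix_smul, Matrix.smul_mulVec, smul_dotProduct, smul_eq_mul,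
        inv_mul_le_iff₀ hn] at h1
      refine h1.trans ?_
      calc ‖ν‖ * (cbar * ((sys.𝒢 x *ᵥ ξ) ⬝ᵥ ξ))
          ≤ ‖ν‖ * (max cbar 0 * ((sys.𝒢 x *ᵥ ξ) ⬝ᵥ ξ)) := by gcongr; exact le_max_left _ _
        _ ≤ 1 / cmax * (max cbar 0 * ((sys.𝒢 x *ᵥ ξ) ⬝ᵥ ξ)) := by
            gcongr
        _ = _ := by ring
  have hθ : 0 ≤ 1 - max cbar 0 / cmax := by
    rw [sub_nonneg, div_le_one hcmax]
    exact max_le hc.le hcmax.le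
  rw [Matrix.sub_mulVec, sub_dotProduct, mul_assoc]
  have := mul_le_mul_of_nonneg_left hG hθ
  linarith

end System.IsAdmissible

end Coefficients

/-! ### The numerical flux on a shared facet -/

section Facets

variable {d b p : ℕ} {P : Finset (Finset (Pt d))} {sys : System d b} {Ω : Set (Pt d)}
  {Λ γ cbar : ℝ}

theorem System.IsAdmissible.integrableOn_facet (H : sys.IsAdmissible Ω Λ γ cbar)
    {F : Finset (Pt d)} (hF : hull F ⊆ closure Ω) (hμ : μHE[d - 1] (hull F) ≠ ⊤) (ν : Pt d)
    {c : Pt d → ℝ} (hc : ContinuousOn c (hull F)) {f g : Pt d → Fin b → ℝ} (hf : Continuous f)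
    (hg : Continuous g) :
    IntegrableOn (fun x => c x * ((sys.normalMatrix ν x *ᵥ f x) ⬝ᵥ g x)) (hull F) μHE[d - 1] :=
  integrableOn_mulVec (isCompact_hull F) hμ (H.measurable_normalMatrix ν)
    (fun _ hx => H.abs_normalMatrix_le ν (hF hx)) hc hf.continuousOn hg.continuousOn

theorem System.IsAdmissible.integrableOn_facet_S (H : sys.IsAdmissible Ω Λ γ cbar)
    {F : Finset (Pt d)} (hμ : μHE[d - 1] (hull F) ≠ ⊤)
    {c : Pt d → ℝ} (hc : ContinuousOn c (hull F)) {f g : Pt d → Fin b → ℝ} (hf : Continuous f)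
    (hg : Continuous g) :
    IntegrableOn (fun x => c x * ((sys.S *ᵥ f x) ⬝ᵥ g x)) (hull F) μHE[d - 1] :=
  integrableOn_mulVec (Q := fun _ => sys.S) (isCompact_hull F) hμ (fun _ _ => measurable_const)
    (fun _ _ => H.bound_S) hc hf.continuousOn hg.continuousOn

theorem isBilinearMap_facetFlux (H : sys.IsAdmissible Ω Λ γ cbar) {F : Finset (Pt d)}
    (hF : hull F ⊆ closure Ω) (hμ : μHE[d - 1] (hull F) ≠ ⊤) {δ : Pt d → ℝ}
    (hδ : ContinuousOn δ (hull F)) (K K' : P) :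
    IsBilinearMap ℝ fun u w : DG P b p => facetFlux sys δ u w K K' F := by
  refine isBilinearMap_integral (fun x => ?_) fun u w => ?_
  · have h := ((isBilinearMap_mulVec (sys.normalMatrix (outwardNormal K.1 F) x)
      ((1 / 2 : ℝ) • (valL (b := b) (p := p) K' x + valL K x)) (valL K' x - valL K x)).fun_add
      ((isBilinearMap_mulVec sys.S (valL (b := b) (p := p) K' x - valL K x)
        (valL K' x - valL K x)).const_mul (-1))).const_mul (δ x)
    convert h using 3 with u w
    rw [sub_dotProduct, neg_one_mul, ← sub_eq_add_neg]
    rfl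
  · have h0 : Continuous fun x => (1 / 2 : ℝ) • (val u K' x + val u K x) :=
      Continuous.const_smul ((continuous_val u K').add (continuous_val u K)) (1 / 2 : ℝ)
    have h1 := H.integrableOn_facet hF hμ (outwardNormal K.1 F) hδ
      (g := fun x => val w K' x - val w K x) h0
      ((continuous_val w K').sub (continuous_val w K))
    have h2 := H.integrableOn_facet_S hμ hδ
      (f := fun x => val u K' x - val u K x) (g := fun x => val w K' x - val w K x)
      ((continuous_val u K').sub (continuous_val u K))
      ((continuous_val w K').sub (continuous_val w K))
    refine (h1.sub h2).congr (Filter.Eventually.of_forall fun x => ?_)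
    simp only [Pi.sub_apply]
    rw [sub_dotProduct, mul_sub]

/-- The flux through a facet of the element `K`, with respect to its outward normal. -/
def outFlux (sys : System d b) (δ : Pt d → ℝ) (u : DG P b p) (K : P) (F : Finset (Pt d)) : ℝ :=
  ∫ x in hull F, δ x * ((sys.normalMatrix (outwardNormal K.1 F) x *ᵥ val u K x) ⬝ᵥ val u K x)
    ∂μHE[d - 1]

/-- By symmetry of `𝒟`, the central flux satisfies `𝒟{u} · ⟦u⟧ = (𝒟u' · u' - 𝒟u · u) / 2`. Since the
two outward normals are opposite, this is minus half the sum of the outward fluxes; the term with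
`S` only decreases it. -/
theorem facetFlux_self_le (H : sys.IsAdmissible Ω Λ γ cbar) {F : Finset (Pt d)}
    (hF : hull F ⊆ closure Ω) (hμ : μHE[d - 1] (hull F) ≠ ⊤) {δ : Pt d → ℝ}
    (hδ : ContinuousOn δ (hull F)) (hδ0 : ∀ x ∈ hull F, 0 ≤ δ x) (K K' : P)
    (hn : outwardNormal K'.1 F = -outwardNormal K.1 F) (u : DG P b p) :
    facetFlux sys δ u u K K' F ≤ -(1 / 2) * (outFlux sys δ u K F + outFlux sys δ u K' F) := by
  have h1 := H.integrableOn_facet hF hμ (outwardNormal K.1 F) hδ (continuous_val u K)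
    (continuous_val u K)
  have h2 := H.integrableOn_facet hF hμ (outwardNormal K'.1 F) hδ (continuous_val u K')
    (continuous_val u K')
  have h3 := H.integrableOn_facet_S hμ hδ
    (f := fun x => val u K' x - val u K x) (g := fun x => val u K' x - val u K x)
    ((continuous_val u K').sub (continuous_val u K))
    ((continuous_val u K').sub (continuous_val u K))
  have hS : 0 ≤ ∫ x in hull F, δ x * ((sys.S *ᵥ (val u K' x - val u K x)) ⬝ᵥ
      (val u K' x - val u K x)) ∂μHE[d - 1] := by
    refine setIntegral_nonneg (isCompact_hull F).measurableSet fun x hx => ?_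
    have := H.posSemidef_S.dotProduct_mulVec_nonneg (val u K' x - val u K x)
    rw [star_trivial, dotProduct_comm] at this
    exact mul_nonneg (hδ0 x hx) this
  have heq : facetFlux sys δ u u K K' F =
      -(1 / 2) * (outFlux sys δ u K F + outFlux sys δ u K' F) -
        ∫ x in hull F, δ x * ((sys.S *ᵥ (val u K' x - val u K x)) ⬝ᵥ
          (val u K' x - val u K x)) ∂μHE[d - 1] := by
    have h12 : IntegrableOn (fun x => -(1 / 2) *
        (δ x * ((sys.normalMatrix (outwardNormal K.1 F) x *ᵥ val u K x) ⬝ᵥ val u K x) +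
          δ x * ((sys.normalMatrix (outwardNormal K'.1 F) x *ᵥ val u K' x) ⬝ᵥ val u K' x)))
        (hull F) μHE[d - 1] := (h1.add h2).const_mul _
    rw [facetFlux, outFlux, outFlux, ← integral_add h1 h2, ← integral_const_mul,
      ← integral_sub h12 h3]
    refine setIntegral_congr_fun (isCompact_hull F).measurableSet fun x hx => ?_
    have hsym := dotProduct_mulVec_comm (H.isSymm_normalMatrix (outwardNormal K.1 F) (hF hx))
      (val u K' x) (val u K x)
    simp only [hn, System.normalMatrix_neg, Matrix.neg_mulVec, neg_dotProduct, sub_dotProduct,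
      Matrix.mulVec_smul, Matrix.mulVec_add, smul_dotProduct, add_dotProduct, dotProduct_sub,
      smul_eq_mul, hsym]
    ring
  rw [heq]
  linarith

theorem dotProduct_self_add_le {n : Type*} [Fintype n] (ξ η : n → ℝ) :
    (ξ + η) ⬝ᵥ (ξ + η) ≤ 2 * (ξ ⬝ᵥ ξ + η ⬝ᵥ η) := by
  have h := dotProduct_self_nonneg' (ξ - η)
  simp only [add_dotProduct, dotProduct_add, sub_dotProduct, dotProduct_sub] at *
  linarith

theorem dotProduct_self_sub_le {n : Type*} [Fintype n] (ξ η : n → ℝ) :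
    (ξ - η) ⬝ᵥ (ξ - η) ≤ 2 * (ξ ⬝ᵥ ξ + η ⬝ᵥ η) := by
  have h := dotProduct_self_nonneg' (ξ + η)
  simp only [add_dotProduct, dotProduct_add, sub_dotProduct, dotProduct_sub] at *
  linarith

/-- The height is `O(ρ)`, pointwise squares are `O(ρ^(-d))` times squared `L²` norms, and the area
is `O(ρ^(d-1))`, so all powers cancel. Each side is estimated with its own radius, and the sizes of
neighbours are never compared. -/
theorem abs_facetFlux_le (H : sys.IsAdmissible Ω Λ γ cbar) {F : Finset (Pt d)}
    (hF : hull F ⊆ closure Ω) {δ : Pt d → ℝ} (hδ0 : ∀ x ∈ hull F, 0 ≤ δ x) (K K' : P)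
    (hnorm : ‖outwardNormal K.1 F‖ = 1) {C₁ C₂ c ρ ρ' : ℝ} {x₀ x₀' : Pt d} {κ : ℝ} (hd : 1 ≤ d)
    (hC₁ : 0 ≤ C₁) (hc : 0 ≤ c)
    (hR : Regular κ K.1 x₀ ρ) (hR' : Regular κ K'.1 x₀' ρ')
    (hv : ∀ u : DG P b p, ∀ x ∈ hull F, ρ ^ d * (val u K x ⬝ᵥ val u K x) ≤ C₁ * sqNorm u K)
    (hv' : ∀ u : DG P b p, ∀ x ∈ hull F, ρ' ^ d * (val u K' x ⬝ᵥ val u K' x) ≤ C₁ * sqNorm u K')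
    (hδ : ∀ x ∈ hull F, δ x ≤ c * ρ) (hδ' : ∀ x ∈ hull F, δ x ≤ c * ρ')
    (hC₂ : 0 ≤ C₂)
    (hA : μHE[d - 1] (hull F) ≤ ENNReal.ofReal (C₂ * ρ ^ (d - 1)))
    (hA' : μHE[d - 1] (hull F) ≤ ENNReal.ofReal (C₂ * ρ' ^ (d - 1))) (u w : DG P b p) :
    |facetFlux sys δ u w K K' F| ≤ 4 * (d + 1) * |Λ| * b * c * C₁ * C₂ *
      ((sqNorm u K + sqNorm w K) + (sqNorm u K' + sqNorm w K')) := by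
  have hρ := hR.pos
  have hρ' := hR'.pos
  set k : ℝ := 4 * (d + 1) * |Λ| * b with hk
  have hk0 : 0 ≤ k := by positivity
  have hpt : ∀ x ∈ hull F, ‖δ x * ((sys.normalMatrix (outwardNormal K.1 F) x *ᵥ
      ((1 / 2 : ℝ) • (val u K' x + val u K x)) - sys.S *ᵥ (val u K' x - val u K x)) ⬝ᵥ
        (val w K' x - val w K x))‖ ≤
      k * (c * ρ) * (C₁ * (sqNorm u K + sqNorm w K) / ρ ^ d) +
      k * (c * ρ') * (C₁ * (sqNorm u K' + sqNorm w K') / ρ' ^ d) := by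
    intro x hx
    have e1 : val u K x ⬝ᵥ val u K x + val w K x ⬝ᵥ val w K x ≤
        C₁ * (sqNorm u K + sqNorm w K) / ρ ^ d := by
      rw [le_div_iff₀ (by positivity)]
      linarith [hv u x hx, hv w x hx]
    have e2 : val u K' x ⬝ᵥ val u K' x + val w K' x ⬝ᵥ val w K' x ≤
        C₁ * (sqNorm u K' + sqNorm w K') / ρ' ^ d := by
      rw [le_div_iff₀ (by positivity)]
      linarith [hv' u x hx, hv' w x hx]
    have n1 := dotProduct_self_nonneg' (val u K x)
    have n2 := dotProduct_self_nonneg' (val w K x)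
    have n3 := dotProduct_self_nonneg' (val u K' x)
    have n4 := dotProduct_self_nonneg' (val w K' x)
    have a1 := abs_mulVec_dotProduct_le
      (H.abs_normalMatrix_le (outwardNormal K.1 F) (hF hx))
      ((1 / 2 : ℝ) • (val u K' x + val u K x)) (val w K' x - val w K x)
    have a2 := abs_mulVec_dotProduct_le (fun k l => (H.bound_S k l).trans (le_abs_self Λ))
      (val u K' x - val u K x) (val w K' x - val w K x)
    rw [hnorm, Fintype.card_fin, mul_one] at a1
    rw [Fintype.card_fin] at a2
    rw [smul_dotProduct, dotProduct_smul, smul_eq_mul, smul_eq_mul] at a1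
    have b1 := dotProduct_self_add_le (val u K' x) (val u K x)
    have b2 := dotProduct_self_sub_le (val u K' x) (val u K x)
    have b3 := dotProduct_self_sub_le (val w K' x) (val w K x)
    set uu := val u K x ⬝ᵥ val u K x
    set ww := val w K x ⬝ᵥ val w K x
    set uu' := val u K' x ⬝ᵥ val u K' x
    set ww' := val w K' x ⬝ᵥ val w K' x
    have hsum : |(sys.normalMatrix (outwardNormal K.1 F) x *ᵥ
        ((1 / 2 : ℝ) • (val u K' x + val u K x)) - sys.S *ᵥ (val u K' x - val u K x)) ⬝ᵥ
          (val w K' x - val w K x)| ≤ k * (uu + ww) + k * (uu' + ww') := by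
      rw [sub_dotProduct]
      refine (abs_sub _ _).trans ((add_le_add a1 a2).trans ?_)
      have t1 : (d * |Λ| * b : ℝ) * (1 / 2 * (1 / 2 * ((val u K' x + val u K x) ⬝ᵥ
          (val u K' x + val u K x))) + (val w K' x - val w K x) ⬝ᵥ (val w K' x - val w K x)) ≤
          d * |Λ| * b * (4 * (uu + ww + uu' + ww')) := by
        gcongr
        linarith
      have t2 : (|Λ| * b : ℝ) * ((val u K' x - val u K x) ⬝ᵥ (val u K' x - val u K x) +
          (val w K' x - val w K x) ⬝ᵥ (val w K' x - val w K x)) ≤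
          |Λ| * b * (4 * (uu + ww + uu' + ww')) := by
        gcongr
        linarith
      refine (add_le_add t1 t2).trans (le_of_eq ?_)
      rw [hk]
      ring
    rw [norm_mul, Real.norm_of_nonneg (hδ0 x hx), Real.norm_eq_abs]
    refine (mul_le_mul_of_nonneg_left hsum (hδ0 x hx)).trans ?_
    rw [mul_add]
    refine add_le_add ?_ ?_
    · calc _ = k * δ x * (uu + ww) := by ring
        _ ≤ _ := by
          have := hδ x hx
          gcongr
    · calc _ = k * δ x * (uu' + ww') := by ring
        _ ≤ _ := by
          have := hδ' x hx
          gcongr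
  have hfin : μHE[d - 1] (hull F) < ⊤ := hA.trans_lt ENNReal.ofReal_lt_top
  have hint := norm_setIntegral_le_of_norm_le_const hfin hpt
  rw [Real.norm_eq_abs] at hint
  refine hint.trans ?_
  have hr1 : (μHE[d - 1] : Measure (Pt d)).real (hull F) ≤ C₂ * ρ ^ (d - 1) :=
    ENNReal.toReal_le_of_le_ofReal (by positivity) hA
  have hr2 : (μHE[d - 1] : Measure (Pt d)).real (hull F) ≤ C₂ * ρ' ^ (d - 1) :=
    ENNReal.toReal_le_of_le_ofReal (by positivity) hA'
  have q1 := add_nonneg (sqNorm_nonneg u K) (sqNorm_nonneg w K)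
  have q2 := add_nonneg (sqNorm_nonneg u K') (sqNorm_nonneg w K')
  have hpow : ∀ r : ℝ, r ^ d = r * r ^ (d - 1) := fun r => by
    rw [← pow_succ', Nat.sub_add_cancel hd]
  have g1 : k * (c * ρ) * (C₁ * (sqNorm u K + sqNorm w K) / ρ ^ d) *
      (μHE[d - 1] : Measure (Pt d)).real (hull F) ≤
        k * c * C₁ * C₂ * (sqNorm u K + sqNorm w K) := by
    calc _ ≤ k * (c * ρ) * (C₁ * (sqNorm u K + sqNorm w K) / ρ ^ d) * (C₂ * ρ ^ (d - 1)) := by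
          gcongr
      _ = _ := by
          rw [hpow]
          field_simp
  have g2 : k * (c * ρ') * (C₁ * (sqNorm u K' + sqNorm w K') / ρ' ^ d) *
      (μHE[d - 1] : Measure (Pt d)).real (hull F) ≤
        k * c * C₁ * C₂ * (sqNorm u K' + sqNorm w K') := by
    calc _ ≤ k * (c * ρ') * (C₁ * (sqNorm u K' + sqNorm w K') / ρ' ^ d) *
            (C₂ * ρ' ^ (d - 1)) := by
          gcongr
      _ = _ := by
          rw [hpow]
          field_simp
  calc _ = _ := add_mul _ _ _
    _ ≤ _ := add_le_add g1 g2
    _ = _ := by ring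

end Facets

/-! ### Element contributions and Green's formula -/

section Elements

variable {d b p : ℕ} {P : Finset (Finset (Pt d))} {sys : System d b} {Ω : Set (Pt d)}
  {Λ γ cbar : ℝ}

/-- The contribution `(δ f(u), grad w)_K` of an element to the operator `A`. -/
def elemForm (sys : System d b) (δ : Pt d → ℝ) (u w : DG P b p) (K : P) : ℝ :=
  ∫ x in hull K.1, δ x * ∑ j, (sys.ℒ j x *ᵥ val u K x) ⬝ᵥ pderivVal w K j x

theorem integrableOn_elemForm (H : sys.IsAdmissible Ω Λ γ cbar) {K : P}
    (hK : hull K.1 ⊆ closure Ω) {δ : Pt d → ℝ} (hδ : ContinuousOn δ (hull K.1)) (u w : DG P b p) :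
    IntegrableOn (fun x => δ x * ∑ j, (sys.ℒ j x *ᵥ val u K x) ⬝ᵥ pderivVal w K j x)
      (hull K.1) := by
  simp only [Finset.mul_sum]
  exact integrable_finsetSum _ fun j _ => integrableOn_mulVec (isCompact_hull K.1)
    (isCompact_hull K.1).measure_lt_top.ne (H.measurable_ℒ j) (fun x hx => H.bound_ℒ j x (hK hx))
    hδ (continuous_val u K).continuousOn (continuous_pderivVal w K j).continuousOn

theorem isBilinearMap_elemForm (H : sys.IsAdmissible Ω Λ γ cbar) {K : P}
    (hK : hull K.1 ⊆ closure Ω) {δ : Pt d → ℝ} (hδ : ContinuousOn δ (hull K.1)) :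
    IsBilinearMap ℝ fun u w : DG P b p => elemForm sys δ u w K :=
  isBilinearMap_integral (fun x => (isBilinearMap_sum _ fun j =>
    isBilinearMap_mulVec (sys.ℒ j x) (valL K x) (pderivL K j x)).const_mul (δ x))
    fun u w => integrableOn_elemForm H hK hδ u w

/-- The factor `ρ` from the height pays for the one derivative in the inverse estimate. -/
theorem abs_elemForm_le (H : sys.IsAdmissible Ω Λ γ cbar) {K : P}
    (hK : hull K.1 ⊆ closure Ω) {δ : Pt d → ℝ} (hδ0 : ∀ x ∈ hull K.1, 0 ≤ δ x)
    {C₁ C₂ c ρ κ : ℝ} {x₀ : Pt d} (hR : Regular κ K.1 x₀ ρ) (hC₁ : 0 ≤ C₁) (hc : 0 ≤ c)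
    (hv : ∀ u : DG P b p, ∀ x ∈ hull K.1, ρ ^ d * (val u K x ⬝ᵥ val u K x) ≤ C₁ * sqNorm u K ∧
        ∀ j, ρ ^ d * (ρ ^ 2 * (pderivVal u K j x ⬝ᵥ pderivVal u K j x)) ≤ C₁ * sqNorm u K)
    (hδ : ∀ x ∈ hull K.1, δ x ≤ c * ρ) (hV : volume.real (hull K.1) ≤ C₂ * ρ ^ d)
    (u w : DG P b p) :
    |elemForm sys δ u w K| ≤ d * |Λ| * b * c * C₁ * C₂ * (sqNorm u K + sqNorm w K) := by
  have hρ := hR.pos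
  have q := add_nonneg (sqNorm_nonneg u K) (sqNorm_nonneg w K)
  have hpt : ∀ x ∈ hull K.1,
      ‖δ x * ∑ j, (sys.ℒ j x *ᵥ val u K x) ⬝ᵥ pderivVal w K j x‖ ≤
        d * (|Λ| * b * c * (C₁ * (sqNorm u K + sqNorm w K) / ρ ^ d)) := by
    intro x hx
    have hj : ∀ j ∈ Finset.univ, δ x * |(sys.ℒ j x *ᵥ val u K x) ⬝ᵥ pderivVal w K j x| ≤
        |Λ| * b * c * (C₁ * (sqNorm u K + sqNorm w K) / ρ ^ d) := by
      intro j _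
      -- The derivative is scaled by `ρ` beforehand so that both squares on the right have the same
      -- scaling.
      have h1 := abs_mulVec_dotProduct_le
        (fun k l => (H.bound_ℒ j x (hK hx) k l).trans (le_abs_self Λ)) (val u K x)
        (ρ • pderivVal w K j x)
      rw [dotProduct_smul, dotProduct_smul, smul_dotProduct, smul_eq_mul, smul_eq_mul, smul_eq_mul,
        abs_mul, abs_of_pos hρ, Fintype.card_fin, ← mul_assoc ρ ρ, ← pow_two] at h1
      have h2 : val u K x ⬝ᵥ val u K x + ρ ^ 2 * (pderivVal w K j x ⬝ᵥ pderivVal w K j x) ≤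
          C₁ * (sqNorm u K + sqNorm w K) / ρ ^ d := by
        rw [le_div_iff₀ (by positivity)]
        linarith [(hv u x hx).1, (hv w x hx).2 j]
      calc _ ≤ c * ρ * |(sys.ℒ j x *ᵥ val u K x) ⬝ᵥ pderivVal w K j x| := by
            have := hδ x hx
            gcongr
        _ = c * (ρ * |(sys.ℒ j x *ᵥ val u K x) ⬝ᵥ pderivVal w K j x|) := by ring
        _ ≤ c * (|Λ| * b * (C₁ * (sqNorm u K + sqNorm w K) / ρ ^ d)) := by
            refine mul_le_mul_of_nonneg_left (h1.trans ?_) hc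
            gcongr
        _ = _ := by ring
    rw [norm_mul, Real.norm_of_nonneg (hδ0 x hx), Real.norm_eq_abs]
    refine (mul_le_mul_of_nonneg_left (Finset.abs_sum_le_sum_abs _ _) (hδ0 x hx)).trans ?_
    rw [Finset.mul_sum]
    refine (Finset.sum_le_card_nsmul _ _ _ hj).trans (le_of_eq ?_)
    rw [Finset.card_univ, Fintype.card_fin, nsmul_eq_mul]
  have hint := norm_setIntegral_le_of_norm_le_const (μ := volume)
    (isCompact_hull K.1).measure_lt_top hpt
  rw [Real.norm_eq_abs] at hint
  refine hint.trans ?_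
  calc _ ≤ d * (|Λ| * b * c * (C₁ * (sqNorm u K + sqNorm w K) / ρ ^ d)) * (C₂ * ρ ^ d) := by
        gcongr
    _ = _ := by field_simp

theorem fderiv_affine (g : Pt d →ᵃ[ℝ] ℝ) (x : Pt d) (j : Fin d) :
    fderiv ℝ g x (EuclideanSpace.single j 1) = affGrad g j := by
  rw [← gradient_apply, (hasGradientAt_affine g x).gradient]

/-- Integration by parts on an element. -/
theorem green (H : sys.IsAdmissible Ω Λ γ cbar) {𝒯 : Mesh d Ω} (hN : sys.HasNormalTraces 𝒯) {K : P}
    (hK : K.1 ∈ 𝒯.elements) (hμ : ∀ a ∈ K.1, μHE[d - 1] (hull (facet K.1 a)) ≠ ⊤)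
    {δ : Pt d → ℝ} {gδ : Pt d →ᵃ[ℝ] ℝ} (hδ : ∀ x ∈ hull K.1, δ x = gδ x) (u : DG P b p) :
    2 * elemForm sys δ u u K +
        ∫ x in hull K.1, (sys.normalMatrix (affGrad gδ) x *ᵥ val u K x) ⬝ᵥ val u K x =
      ∑ a ∈ K.1, outFlux sys δ u K (facet K.1 a) := by
  have hsub := Mesh.hull_subset hK
  have hfac : ∀ a, hull (facet K.1 a) ⊆ hull K.1 := fun a =>
    convexHull_mono (by exact_mod_cast Finset.erase_subset a K.1)
  have hδc : ContinuousOn δ (hull K.1) := (continuous_affine gδ).continuousOn.congr hδ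
  let q : Fin b → MvPolynomial (Fin d) ℝ := fun l => (u K l : MvPolynomial (Fin d) ℝ)
  -- Testing the trace identity of the entry `(k, l)` with `δ u_l u_k` and summing over `k` and `l`
  -- produces the quadratic forms. The affine `gδ` replaces `δ` because the test function has to be
  -- smooth on all of `ℝ^d`.
  let ψ : Fin b → Fin b → Pt d → ℝ := fun k l x => gδ x * (evalPt x (q l) * evalPt x (q k))
  have hψ : ∀ k l, ContDiff ℝ ∞ (ψ k l) := fun k l =>
    (contDiff_affine gδ).mul ((contDiff_evalPt _).mul (contDiff_evalPt _))
  have hgrad : ∀ k l x j, gradient (ψ k l) x j = affGrad gδ j * (val u K x l * val u K x k) +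
      gδ x * (pderivVal u K j x l * val u K x k + val u K x l * pderivVal u K j x k) := by
    intro k l x j
    have d1 : DifferentiableAt ℝ gδ x := (contDiff_affine gδ).differentiable (by simp) x
    have d2 : ∀ q, DifferentiableAt ℝ (fun x : Pt d => evalPt x q) x := fun q =>
      (contDiff_evalPt q).differentiable (by simp) x
    have d3 : DifferentiableAt ℝ (fun x : Pt d => evalPt x (q l) * evalPt x (q k)) x :=
      (d2 _).mul (d2 _)
    rw [gradient_apply]
    simp only [ψ]
    rw [fderiv_fun_mul d1 d3, fderiv_fun_mul (d2 _) (d2 _)]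
    simp only [add_apply, smul_apply, smul_eq_mul, fderiv_evalPt, fderiv_affine]
    simp only [val, pderivVal, q]
    ring
  have key := Finset.sum_congr rfl fun (k : Fin b) (_ : k ∈ Finset.univ) =>
    Finset.sum_congr rfl fun (l : Fin b) (_ : l ∈ Finset.univ) => hN K.1 hK (ψ k l) (hψ k l) k l
  have hgc : ∀ k l j, Continuous fun x => gradient (ψ k l) x j := fun k l j => by
    simp only [hgrad]
    have c1 := fun l => (continuous_apply l).comp (continuous_val u K)
    have c2 := fun l => (continuous_apply l).comp (continuous_pderivVal u K j)
    exact (continuous_const.mul ((c1 l).mul (c1 k))).add ((continuous_affine gδ).mul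
      (((c2 l).mul (c1 k)).add ((c1 l).mul (c2 k))))
  have hleft : ∑ k, ∑ l, ∫ x in hull K.1, ∑ j, sys.ℒ j x k l * gradient (ψ k l) x j =
      2 * elemForm sys δ u u K +
        ∫ x in hull K.1, (sys.normalMatrix (affGrad gδ) x *ᵥ val u K x) ⬝ᵥ val u K x := by
    have hi : ∀ k l, IntegrableOn (fun x => ∑ j, sys.ℒ j x k l * gradient (ψ k l) x j)
        (hull K.1) := fun k l => integrable_finsetSum _ fun j _ =>
      integrableOn_bounded_mul (isCompact_hull K.1) (isCompact_hull K.1).measure_lt_top.ne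
        (H.measurable_ℒ j k l) (fun x hx => H.bound_ℒ j x (hsub hx) k l) (hgc k l j).continuousOn
    have hi2 : IntegrableOn (fun x => (sys.normalMatrix (affGrad gδ) x *ᵥ val u K x) ⬝ᵥ val u K x)
        (hull K.1) := by
      have := integrableOn_mulVec (μ := volume) (isCompact_hull K.1)
        (isCompact_hull K.1).measure_lt_top.ne (H.measurable_normalMatrix (affGrad gδ))
        (fun x hx => H.abs_normalMatrix_le _ (hsub hx)) (c := fun _ => 1)
        continuousOn_const (continuous_val u K).continuousOn (continuous_val u K).continuousOn
      simpa only [one_mul] using this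
    rw [elemForm, ← integral_const_mul,
      ← integral_add ((integrableOn_elemForm H hsub hδc u u).const_mul 2) hi2]
    simp_rw [← integral_finsetSum _ fun l _ => hi _ l]
    rw [← integral_finsetSum _ fun k _ => integrable_finsetSum _ fun l _ => hi k l]
    refine setIntegral_congr_fun (isCompact_hull K.1).measurableSet fun x hx => ?_
    simp only [hgrad, hδ x hx]
    have e1 : (sys.normalMatrix (affGrad gδ) x *ᵥ val u K x) ⬝ᵥ val u K x =
        ∑ j, ∑ k, ∑ l, sys.ℒ j x k l * (affGrad gδ j * (val u K x l * val u K x k)) := by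
      rw [mulVec_dotProduct_eq_sum]
      simp only [System.normalMatrix_apply, Finset.sum_mul]
      rw [Finset.sum_congr rfl fun k _ => Finset.sum_comm, Finset.sum_comm]
      exact Finset.sum_congr rfl fun j _ => Finset.sum_congr rfl fun k _ =>
        Finset.sum_congr rfl fun l _ => by ring
    -- Symmetry of `ℒ⁽ʲ⁾` identifies the two terms of the product rule, hence the factor `2`.
    have e2 : ∀ j, 2 * ((sys.ℒ j x *ᵥ val u K x) ⬝ᵥ pderivVal u K j x) =
        ∑ k, ∑ l, sys.ℒ j x k l *
          (pderivVal u K j x l * val u K x k + val u K x l * pderivVal u K j x k) := by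
      intro j
      have : 2 * ((sys.ℒ j x *ᵥ val u K x) ⬝ᵥ pderivVal u K j x) =
          (sys.ℒ j x *ᵥ pderivVal u K j x) ⬝ᵥ val u K x +
            (sys.ℒ j x *ᵥ val u K x) ⬝ᵥ pderivVal u K j x := by
        rw [dotProduct_mulVec_comm (H.symm_ℒ j x (hsub hx)) (pderivVal u K j x)]
        ring
      rw [this, mulVec_dotProduct_eq_sum, mulVec_dotProduct_eq_sum]
      simp only [mul_add, Finset.sum_add_distrib]
    rw [e1, mul_left_comm, Finset.mul_sum, Finset.sum_congr rfl fun j _ => e2 j, Finset.mul_sum,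
      ← Finset.sum_add_distrib, Finset.sum_congr rfl fun k _ => Finset.sum_comm, Finset.sum_comm]
    refine Finset.sum_congr rfl fun j _ => ?_
    rw [Finset.mul_sum, ← Finset.sum_add_distrib]
    refine Finset.sum_congr rfl fun k _ => ?_
    rw [Finset.mul_sum, ← Finset.sum_add_distrib]
    exact Finset.sum_congr rfl fun l _ => by ring
  have hright : ∑ k, ∑ l, ∑ a ∈ K.1, ∫ x in hull (facet K.1 a),
      sys.normalMatrix (outwardNormal K.1 (facet K.1 a)) x k l * ψ k l x ∂μHE[d - 1] =
      ∑ a ∈ K.1, outFlux sys δ u K (facet K.1 a) := by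
    rw [Finset.sum_congr rfl fun k _ => Finset.sum_comm, Finset.sum_comm]
    refine Finset.sum_congr rfl fun a ha => ?_
    have hi : ∀ k l, IntegrableOn (fun x =>
        sys.normalMatrix (outwardNormal K.1 (facet K.1 a)) x k l * ψ k l x)
        (hull (facet K.1 a)) μHE[d - 1] := fun k l =>
      integrableOn_bounded_mul (isCompact_hull _) (hμ a ha) (H.measurable_normalMatrix _ k l)
        (fun x hx => H.abs_normalMatrix_le _ (hsub (hfac a hx)) k l)
        (hψ k l).continuous.continuousOn
    simp_rw [← integral_finsetSum _ fun l _ => hi _ l]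
    rw [← integral_finsetSum _ fun k _ => integrable_finsetSum _ fun l _ => hi k l, outFlux]
    refine setIntegral_congr_fun (isCompact_hull _).measurableSet fun x hx => ?_
    simp only [mulVec_dotProduct_eq_sum, Finset.mul_sum, hδ x (hfac a hx)]
    refine Finset.sum_congr rfl fun k _ => Finset.sum_congr rfl fun l _ => ?_
    simp only [ψ, val, q]
    ring
  rw [← hleft, ← hright]
  exact key

end Elements

/-! ### Combinatorics of facets and neighbours in a vertex patch -/

section Neighbours

variable {d : ℕ} {Ω : Set (Pt d)} {𝒯 : Mesh d Ω} {v : Pt d}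

theorem Mesh.isSimplex_of_mem_patch : ∀ K ∈ 𝒯.patch v, IsSimplex K := fun _ hK =>
  Mesh.isSimplex (𝒯.mem_patch.1 hK).1

open Classical in
theorem Mesh.eq_of_inter_eq (hd : 1 ≤ d) {K K' K'' : Finset (Pt d)} (hK : K ∈ 𝒯.patch v)
    (hK' : K' ∈ 𝒯.patch v) (hK'' : K'' ∈ 𝒯.patch v) (hcard : (K ∩ K').card = d)
    (h : K ∩ K' = K ∩ K'') : K' = K'' := by
  have e := (𝒯.mem_patch.1 hK).1
  have e' := (𝒯.mem_patch.1 hK').1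
  have e'' := (𝒯.mem_patch.1 hK'').1
  exact (Mesh.isSimplex e).eq_of_inter_eq (Mesh.isSimplex e') (Mesh.isSimplex e'') hd hcard
    (h ▸ hcard) h (Mesh.hull_inter_subset e e') (Mesh.hull_inter_subset e e'')
    (Mesh.hull_inter_subset e' e'')

open Classical in
-- Distinct neighbours share distinct facets, and a simplex has `d + 1` of these. The bound does not
-- depend on the number of elements in the patch.
theorem Mesh.card_neighbours_le (hd : 1 ≤ d) (K : 𝒯.patch v) :
    (Finset.univ.filter fun K' : 𝒯.patch v => (K.1 ∩ K'.1).card = d).card ≤ d + 1 := by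
  have hcard : (K.1.powersetCard d).card = d + 1 := by
    rw [Finset.card_powersetCard, (Mesh.isSimplex_of_mem_patch K.1 K.2).card]
    exact Nat.choose_succ_self_right d
  rw [← hcard]
  refine Finset.card_le_card_of_injOn (fun K' => K.1 ∩ K'.1) (fun K' hK' => ?_)
    fun K' hK' K'' _ h => ?_
  · exact Finset.mem_powersetCard.2 ⟨Finset.inter_subset_left, (Finset.mem_filter.1 hK').2⟩
  · exact Subtype.ext (Mesh.eq_of_inter_eq hd K.2 K'.2 K''.2 (Finset.mem_filter.1 hK').2 h)

open Classical in
/-- A sum over the facets of an element of the patch as a sum over its neighbours. -/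
theorem Mesh.sum_facets (hΩ : IsOpen Ω) (hd : 1 ≤ d) (hv : v ∈ Ω) (K : 𝒯.patch v)
    (J : Finset (Pt d) → ℝ) (hJ : J (facet K.1 v) = 0) :
    ∑ a ∈ K.1, J (facet K.1 a) =
      ∑ K' : 𝒯.patch v, if (K.1 ∩ K'.1).card = d then J (K.1 ∩ K'.1) else 0 := by
  have hS := Mesh.isSimplex_of_mem_patch K.1 K.2
  rw [← Finset.sum_filter, ← Finset.sum_erase (f := fun a => J (facet K.1 a)) K.1 hJ]
  -- `N a` is the neighbour across the facet opposite to `a`. Every neighbour arises in this way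
  -- with `a ≠ v`, since all elements of the patch contain `v`.
  choose! N hN hNe using fun (a : Pt d) (ha : a ∈ K.1.erase v) =>
    Mesh.exists_neighbour hΩ hd hv K.2 (Finset.mem_of_mem_erase ha) (Finset.ne_of_mem_erase ha)
  refine Finset.sum_bij (fun a ha => ⟨N a, hN a ha⟩) (fun a ha => ?_) (fun a ha a' ha' h => ?_)
    (fun K' hK' => ?_) fun a ha => ?_
  · rw [Finset.mem_filter]
    refine ⟨Finset.mem_univ _, ?_⟩
    rw [hNe a ha, Finset.card_erase_of_mem (Finset.mem_of_mem_erase ha), hS.card]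
    simp
  · have h1 : K.1.erase a = K.1.erase a' := by
      rw [← hNe a ha, ← hNe a' ha', show N a = N a' from congrArg Subtype.val h]
    by_contra hne
    have : a ∈ K.1.erase a' := Finset.mem_erase.2 ⟨hne, Finset.mem_of_mem_erase ha⟩
    rw [← h1] at this
    exact Finset.notMem_erase a _ this
  · have hcard := (Finset.mem_filter.1 hK').2
    obtain ⟨a, ha, haK', hae⟩ := hS.exists_erase hcard
    have hav : a ∈ K.1.erase v :=
      Finset.mem_erase.2 ⟨fun e => haK' (e ▸ (𝒯.mem_patch.1 K'.2).2), ha⟩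
    refine ⟨a, hav, Subtype.ext ?_⟩
    refine Mesh.eq_of_inter_eq hd K.2 (hN a hav) K'.2 ?_ ?_
    · rw [hNe a hav, ← hae, hcard]
    · rw [hNe a hav, ← hae]
  · show J (K.1.erase a) = J (K.1 ∩ N a)
    rw [hNe a ha]

open Classical in
theorem Mesh.sum_neighbours_swap (f : 𝒯.patch v → Finset (Pt d) → ℝ) :
    (∑ K : 𝒯.patch v, ∑ K' : 𝒯.patch v,
        if (K.1 ∩ K'.1).card = d then f K' (K.1 ∩ K'.1) else 0) =
      ∑ K : 𝒯.patch v, ∑ K' : 𝒯.patch v,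
        if (K.1 ∩ K'.1).card = d then f K (K.1 ∩ K'.1) else 0 := by
  rw [Finset.sum_comm]
  refine Finset.sum_congr rfl fun K _ => Finset.sum_congr rfl fun K' _ => ?_
  rw [Finset.inter_comm]

end Neighbours

/-! ### Boundedness and dissipativity of the form of `A` -/

section AForm

variable {d b p : ℕ} {Ω : Set (Pt d)} {𝒯 : Mesh d Ω} {v : Pt d} {sys : System d b}
  {Λ γ cbar cmax κ : ℝ} {φbot φtop : Pt d → ℝ}

open Classical in
/-- The bilinear form that defines the operator `A`. -/
def aForm {P : Finset (Finset (Pt d))} (sys : System d b) (φbot φtop : Pt d → ℝ)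
    (u w : DG P b p) : ℝ :=
  (∑ K : P, elemForm sys (fun x => φtop x - φbot x) u w K) +
    (1 / 2) * ∑ K : P, ∑ K' : P, if (K.1 ∩ K'.1).card = d then
      facetFlux sys (fun x => φtop x - φbot x) u w K K' (K.1 ∩ K'.1) else 0

theorem A_eq_opOf {P : Finset (Finset (Pt d))} :
    (A sys φbot φtop : Module.End ℝ (DG P b p)) = opOf (aForm sys φbot φtop) := rfl

theorem Mesh.hull_subset_of_mem_patch (K : 𝒯.patch v) : hull K.1 ⊆ closure Ω :=
  Mesh.hull_subset (𝒯.mem_patch.1 K.2).1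

theorem Mesh.ShapeRegular.exists_regular (h : 𝒯.ShapeRegular κ) (K : 𝒯.patch v) :
    ∃ x₀ ρ, Regular κ K.1 x₀ ρ := by
  obtain ⟨x, r, h1, h2, h3⟩ := h K.1 (𝒯.mem_patch.1 K.2).1
  exact ⟨x, r, h1, h2, h3⟩

open Classical in
theorem Mesh.ShapeRegular.facet_area_ne_top (h : 𝒯.ShapeRegular κ) (hd : 1 ≤ d) (K : 𝒯.patch v)
    {a : Pt d} (ha : a ∈ K.1) : μHE[d - 1] (hull (K.1.erase a)) ≠ ⊤ := by
  obtain ⟨C, -, hC⟩ := exists_facet_area_bound hd κ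
  obtain ⟨x₀, ρ, hR⟩ := h.exists_regular K
  exact ((hC K.1 x₀ ρ (Mesh.isSimplex_of_mem_patch K.1 K.2) hR a ha).trans_lt
    ENNReal.ofReal_lt_top).ne

theorem IsTent.continuousOn (hT : IsTent 𝒯 v cmax φbot φtop) (hd : 1 ≤ d) (K : 𝒯.patch v) :
    ContinuousOn (fun x => φtop x - φbot x) (hull K.1) := by
  obtain ⟨gb, gδ, h⟩ := hT.exists_affine hd K.2
  exact (continuous_affine gδ).continuousOn.congr h.eqOn

theorem IsTent.height_nonneg (hT : IsTent 𝒯 v cmax φbot φtop) (hd : 1 ≤ d) (K : 𝒯.patch v)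
    {x : Pt d} (hx : x ∈ hull K.1) : 0 ≤ φtop x - φbot x := by
  obtain ⟨gb, gδ, h⟩ := hT.exists_affine hd K.2
  rw [h.eqOn x hx]
  exact h.nonneg x hx

theorem IsTent.height_le (hT : IsTent 𝒯 v cmax φbot φtop) (hd : 1 ≤ d) (hcmax : 0 < cmax)
    (K : 𝒯.patch v) {x₀ : Pt d} {ρ : ℝ} (hR : Regular κ K.1 x₀ ρ) {x : Pt d} (hx : x ∈ hull K.1) :
    φtop x - φbot x ≤ 2 / cmax * |κ| * ρ := by
  obtain ⟨gb, gδ, h⟩ := hT.exists_affine hd K.2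
  rw [h.eqOn x hx, mul_assoc]
  refine (h.le_diam x hx).trans ?_
  have := hR.pos
  gcongr
  exact hR.diam.trans (by gcongr; exact le_abs_self κ)

open Classical in
theorem hull_inter_subset_left (K K' : Finset (Pt d)) : hull (K ∩ K') ⊆ hull K :=
  convexHull_mono (by exact_mod_cast Finset.inter_subset_left)

open Classical in
theorem hull_inter_subset_right (K K' : Finset (Pt d)) : hull (K ∩ K') ⊆ hull K' :=
  convexHull_mono (by exact_mod_cast Finset.inter_subset_right)

theorem isBilinearMap_aForm (H : sys.IsAdmissible Ω Λ γ cbar) (hκ : 𝒯.ShapeRegular κ) (hd : 1 ≤ d)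
    (hT : IsTent 𝒯 v cmax φbot φtop) :
    IsBilinearMap ℝ (aForm sys φbot φtop : DG (𝒯.patch v) b p → DG (𝒯.patch v) b p → ℝ) := by
  classical
  refine (isBilinearMap_sum _ fun K => isBilinearMap_elemForm H (Mesh.hull_subset_of_mem_patch K)
    (hT.continuousOn hd K)).fun_add (IsBilinearMap.const_mul (isBilinearMap_sum _ fun K =>
      isBilinearMap_sum _ fun K' => ?_) _)
  split_ifs with hadj
  · obtain ⟨a, ha, -, hae⟩ := (Mesh.isSimplex_of_mem_patch K.1 K.2).exists_erase hadj
    exact isBilinearMap_facetFlux H ((hull_inter_subset_left _ _).trans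
      (Mesh.hull_subset_of_mem_patch K)) (hae ▸ hκ.facet_area_ne_top hd K ha)
      ((hT.continuousOn hd K).mono (hull_inter_subset_left _ _)) K K'
  · exact isBilinearMap_zero

/-- The form `A` is bounded in `L²`, uniformly in the mesh size. -/
theorem exists_aForm_bound (hd : 1 ≤ d) (b p : ℕ) (κ Λ : ℝ) {cmax : ℝ} (hcmax : 0 < cmax) :
    ∃ C : ℝ, 0 ≤ C ∧ ∀ (Ω : Set (Pt d)) (sys : System d b) (γ cbar : ℝ)
      (_ : sys.IsAdmissible Ω Λ γ cbar) (𝒯 : Mesh d Ω) (_ : 𝒯.ShapeRegular κ) (v : Pt d)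
      (φbot φtop : Pt d → ℝ) (_ : IsTent 𝒯 v cmax φbot φtop) (u w : DG (𝒯.patch v) b p),
      |aForm sys φbot φtop u w| ≤ C * (ip u u + ip w w) := by
  classical
  obtain ⟨C₁, hC₁, hval⟩ := exists_val_bound d b p κ
  obtain ⟨C₂, hC₂, hvol⟩ := exists_volume_bound d κ
  obtain ⟨C₃, hC₃, harea⟩ := exists_facet_area_bound hd κ
  set c : ℝ := 2 / cmax * |κ| with hc
  have hc0 : 0 ≤ c := by positivity
  set k₁ : ℝ := d * |Λ| * b * c * C₁ * C₂ with hk₁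
  set k₂ : ℝ := 4 * (d + 1) * |Λ| * b * c * C₁ * C₃ with hk₂
  have hk₂0 : 0 ≤ k₂ := by positivity
  refine ⟨k₁ + k₂ * (d + 1), by positivity, ?_⟩
  intro Ω sys γ cbar H 𝒯 hκ v φbot φtop hT u w
  choose x₀ ρ hR using fun K : 𝒯.patch v => hκ.exists_regular K
  have hS : ∀ K : 𝒯.patch v, IsSimplex K.1 := fun K => Mesh.isSimplex_of_mem_patch K.1 K.2
  set e : 𝒯.patch v → ℝ := fun K => sqNorm u K + sqNorm w K with he
  have he0 : ∀ K, 0 ≤ e K := fun K => add_nonneg (sqNorm_nonneg u K) (sqNorm_nonneg w K)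
  have hsum : ip u u + ip w w = ∑ K, e K := by
    rw [ip_self, ip_self, ← Finset.sum_add_distrib]
  have h1 : |∑ K : 𝒯.patch v, elemForm sys (fun x => φtop x - φbot x) u w K| ≤ k₁ * ∑ K, e K := by
    rw [Finset.mul_sum]
    refine (Finset.abs_sum_le_sum_abs _ _).trans (Finset.sum_le_sum fun K _ => ?_)
    exact abs_elemForm_le H (Mesh.hull_subset_of_mem_patch K) (fun x hx => hT.height_nonneg hd K hx)
      (hR K) hC₁ hc0 (fun u x hx => hval _ K (x₀ K) (ρ K) (hR K) u x hx)
      (fun x hx => hT.height_le hd hcmax K (hR K) hx) (hvol K.1 (x₀ K) (ρ K) (hR K)) u w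
  have h2 : ∀ K K' : 𝒯.patch v, (K.1 ∩ K'.1).card = d →
      |facetFlux sys (fun x => φtop x - φbot x) u w K K' (K.1 ∩ K'.1)| ≤ k₂ * (e K + e K') := by
    intro K K' hadj
    obtain ⟨a, ha, -, hae⟩ := (hS K).exists_erase hadj
    obtain ⟨a', ha', -, hae'⟩ := (hS K').exists_erase (K' := K.1) (by rwa [Finset.inter_comm])
    rw [Finset.inter_comm] at hae'
    have hsub := hull_inter_subset_left K.1 K'.1
    have hsub' := hull_inter_subset_right K.1 K'.1
    refine abs_facetFlux_le H (hsub.trans (Mesh.hull_subset_of_mem_patch K))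
      (fun x hx => hT.height_nonneg hd K (hsub hx)) K K' ?_ hd hC₁ hc0 (hR K) (hR K')
      (fun u x hx => (hval _ K (x₀ K) (ρ K) (hR K) u x (hsub hx)).1)
      (fun u x hx => (hval _ K' (x₀ K') (ρ K') (hR K') u x (hsub' hx)).1)
      (fun x hx => hT.height_le hd hcmax K (hR K) (hsub hx))
      (fun x hx => hT.height_le hd hcmax K' (hR K') (hsub' hx)) hC₃ ?_ ?_ u w
    · rw [hae]
      exact (hS K).norm_outwardNormal hd ha
    · rw [hae]
      exact harea K.1 (x₀ K) (ρ K) (hS K) (hR K) a ha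
    · rw [hae']
      exact harea K'.1 (x₀ K') (ρ K') (hS K') (hR K') a' ha'
  have h3 : |∑ K : 𝒯.patch v, ∑ K' : 𝒯.patch v, if (K.1 ∩ K'.1).card = d then
      facetFlux sys (fun x => φtop x - φbot x) u w K K' (K.1 ∩ K'.1) else 0| ≤
      2 * (k₂ * (d + 1) * ∑ K, e K) := by
    calc _ ≤ ∑ K : 𝒯.patch v, ∑ K' : 𝒯.patch v,
          if (K.1 ∩ K'.1).card = d then k₂ * (e K + e K') else 0 := by
          refine (Finset.abs_sum_le_sum_abs _ _).trans (Finset.sum_le_sum fun K _ =>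
            (Finset.abs_sum_le_sum_abs _ _).trans (Finset.sum_le_sum fun K' _ => ?_))
          split_ifs with hadj
          · exact h2 K K' hadj
          · rw [abs_zero]
      -- Adjacency is symmetric, so the terms of `K'` contribute as much as those of `K`; the
      -- resulting factor `2` cancels the `1 / 2` in the form.
      _ = (∑ K : 𝒯.patch v, ∑ K' : 𝒯.patch v,
            if (K.1 ∩ K'.1).card = d then k₂ * e K else 0) +
          ∑ K : 𝒯.patch v, ∑ K' : 𝒯.patch v,
            if (K.1 ∩ K'.1).card = d then k₂ * e K' else 0 := by
          simp only [← Finset.sum_add_distrib]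
          refine Finset.sum_congr rfl fun K _ => Finset.sum_congr rfl fun K' _ => ?_
          split_ifs <;> ring
      _ = 2 * ∑ K : 𝒯.patch v, ∑ K' : 𝒯.patch v,
            if (K.1 ∩ K'.1).card = d then k₂ * e K else 0 := by
          rw [Mesh.sum_neighbours_swap fun K _ => k₂ * e K]
          ring
      _ ≤ 2 * ∑ K : 𝒯.patch v, (d + 1) * (k₂ * e K) := by
          refine mul_le_mul_of_nonneg_left (Finset.sum_le_sum fun K _ => ?_) zero_le_two
          rw [← Finset.sum_filter, Finset.sum_const, nsmul_eq_mul]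
          refine mul_le_mul_of_nonneg_right ?_ (mul_nonneg hk₂0 (he0 K))
          exact_mod_cast Mesh.card_neighbours_le hd K
      _ = _ := by
          rw [← Finset.mul_sum, ← Finset.mul_sum]
          ring
  rw [hsum, aForm]
  refine (abs_add_le _ _).trans ?_
  rw [abs_mul, abs_of_pos (by norm_num : (0 : ℝ) < 1 / 2)]
  linarith

/-- The discrete dissipation inequality. -/
theorem aForm_dissipative (hΩ : IsOpen Ω) (H : sys.IsAdmissible Ω Λ γ cbar)
    (hκ : 𝒯.ShapeRegular κ) (hN : sys.HasNormalTraces 𝒯) (hd : 1 ≤ d) (hv : v ∈ Ω)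
    {gb gδ : 𝒯.patch v → Pt d →ᵃ[ℝ] ℝ}
    (hg : ∀ K : 𝒯.patch v, TentAffine v cmax φbot φtop K.1 (gb K) (gδ K))
    (u : DG (𝒯.patch v) b p) :
    2 * aForm sys φbot φtop u u +
      matForm (fun K x => sys.normalMatrix (affGrad (gδ K)) x) u u ≤ 0 := by
  classical
  set δ : Pt d → ℝ := fun x => φtop x - φbot x with hδ
  have hS : ∀ K : 𝒯.patch v, IsSimplex K.1 := fun K => Mesh.isSimplex_of_mem_patch K.1 K.2
  have hδc : ∀ K : 𝒯.patch v, ContinuousOn δ (hull K.1) := fun K =>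
    (continuous_affine (gδ K)).continuousOn.congr (hg K).eqOn
  -- Green's formula on `K`. The facet opposite to the pole drops out because `δ` vanishes on it,
  -- and the others are indexed by the neighbours.
  have h1 : ∀ K : 𝒯.patch v, 2 * elemForm sys δ u u K +
      ∫ x in hull K.1, (sys.normalMatrix (affGrad (gδ K)) x *ᵥ val u K x) ⬝ᵥ val u K x =
        ∑ K' : 𝒯.patch v, if (K.1 ∩ K'.1).card = d then outFlux sys δ u K (K.1 ∩ K'.1) else 0 := by
    intro K
    rw [green H hN (𝒯.mem_patch.1 K.2).1 (fun a ha => hκ.facet_area_ne_top hd K ha) (hg K).eqOn,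
      Mesh.sum_facets hΩ hd hv]
    rw [outFlux, ← integral_zero (Pt d) ℝ (μ := μHE[d - 1].restrict (hull (facet K.1 v)))]
    refine setIntegral_congr_fun (isCompact_hull _).measurableSet fun x hx => ?_
    have h0 : gδ K x = 0 := affine_eq_zero_of_mem_hull _ (fun y hy =>
      (hg K).eq_zero y (Finset.mem_of_mem_erase hy) (Finset.ne_of_mem_erase hy)) hx
    have h2 : δ x = gδ K x := (hg K).eqOn x
      (convexHull_mono (by exact_mod_cast Finset.erase_subset v K.1) hx)
    have h3 : δ x = 0 := h2.trans h0
    exact mul_eq_zero_of_left h3 _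
  have h2 : ∀ K K' : 𝒯.patch v, (if (K.1 ∩ K'.1).card = d then
      facetFlux sys δ u u K K' (K.1 ∩ K'.1) else 0) ≤
        -(1 / 2) * ((if (K.1 ∩ K'.1).card = d then outFlux sys δ u K (K.1 ∩ K'.1) else 0) +
          if (K.1 ∩ K'.1).card = d then outFlux sys δ u K' (K.1 ∩ K'.1) else 0) := by
    intro K K'
    split_ifs with hadj
    · obtain ⟨a, ha, -, hae⟩ := (hS K).exists_erase hadj
      have hsub := hull_inter_subset_left K.1 K'.1
      exact facetFlux_self_le H (hsub.trans (Mesh.hull_subset_of_mem_patch K))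
        (hae ▸ hκ.facet_area_ne_top hd K ha) ((hδc K).mono hsub)
        (fun x hx => le_of_le_of_eq ((hg K).nonneg x (hsub hx)) ((hg K).eqOn x (hsub hx)).symm) K K'
        ((hS K).outwardNormal_neg (hS K') hd hadj (Mesh.hull_inter_subset
          (𝒯.mem_patch.1 K.2).1 (𝒯.mem_patch.1 K'.2).1)) u
    · simp
  have h3 := Finset.sum_le_sum fun (K : 𝒯.patch v) (_ : K ∈ Finset.univ) =>
    Finset.sum_le_sum fun (K' : 𝒯.patch v) (_ : K' ∈ Finset.univ) => h2 K K'
  simp only [← Finset.mul_sum, Finset.sum_add_distrib] at h3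
  -- After the swap both halves coincide, so the facet terms of all ordered pairs add up to at most
  -- minus the total outward flux, which is precisely the boundary term of Green's formula.
  rw [Mesh.sum_neighbours_swap fun K F => outFlux sys δ u K F] at h3
  have h4 := Finset.sum_congr rfl fun (K : 𝒯.patch v) (_ : K ∈ Finset.univ) => h1 K
  rw [Finset.sum_add_distrib, ← Finset.mul_sum] at h4
  rw [aForm, matForm]
  linarith

end AForm

/-! ### Mass forms of the tent -/

section Mass

variable {d b p : ℕ} {Ω : Set (Pt d)} {𝒯 : Mesh d Ω} {v : Pt d} {sys : System d b}
  {Λ γ cbar cmax : ℝ} {φbot φtop : Pt d → ℝ} {gb gδ : 𝒯.patch v → Pt d →ᵃ[ℝ] ℝ}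

/-- Almost everywhere the gradient of the front is a constant vector on each element; with it the
coefficient is measurable and bounded on the closed element. -/
theorem M₀_eq_opOf (hg : ∀ K : 𝒯.patch v, TentAffine v cmax φbot φtop K.1 (gb K) (gδ K)) :
    (M₀ sys φbot : Module.End ℝ (DG (𝒯.patch v) b p)) =
      opOf (matForm fun K x => sys.𝒢 x - sys.normalMatrix (affGrad (gb K)) x) := by
  rw [M₀]
  congr 1
  funext u w
  refine Finset.sum_congr rfl fun K _ => integral_congr_ae ?_
  filter_upwards [ae_mem_interior_hull K.1] with x hx
  rw [(hg K).gradient_bot x hx, Matrix.sub_mulVec]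

theorem M₁_eq_opOf (hg : ∀ K : 𝒯.patch v, TentAffine v cmax φbot φtop K.1 (gb K) (gδ K)) :
    (M₁ sys φbot φtop : Module.End ℝ (DG (𝒯.patch v) b p)) =
      opOf (matForm fun K x => sys.normalMatrix (affGrad (gδ K)) x) := by
  rw [M₁]
  congr 1
  funext u w
  refine Finset.sum_congr rfl fun K _ => integral_congr_ae ?_
  filter_upwards [ae_mem_interior_hull K.1] with x hx
  rw [(hg K).gradient_height x hx]

theorem boundedCoeff_bot (H : sys.IsAdmissible Ω Λ γ cbar)
    (hg : ∀ K : 𝒯.patch v, TentAffine v cmax φbot φtop K.1 (gb K) (gδ K)) :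
    BoundedCoeff (fun (K : 𝒯.patch v) x => sys.𝒢 x - sys.normalMatrix (affGrad (gb K)) x)
      (|Λ| + d * |Λ| * (1 / cmax)) where
  meas K k l := (H.measurable_𝒢 k l).sub (H.measurable_normalMatrix _ k l)
  bound K x hx k l := by
    have hx' := Mesh.hull_subset_of_mem_patch K hx
    have h := (hg K).causal 0 le_rfl zero_le_one
    rw [zero_smul, add_zero] at h
    refine (abs_sub _ _).trans (add_le_add ((H.bound_𝒢 x hx' k l).trans (le_abs_self Λ)) ?_)
    refine (H.abs_normalMatrix_le _ hx' k l).trans ?_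
    gcongr

theorem boundedCoeff_height (H : sys.IsAdmissible Ω Λ γ cbar)
    (hg : ∀ K : 𝒯.patch v, TentAffine v cmax φbot φtop K.1 (gb K) (gδ K)) :
    BoundedCoeff (fun (K : 𝒯.patch v) x => sys.normalMatrix (affGrad (gδ K)) x)
      (d * |Λ| * (2 / cmax)) where
  meas K k l := H.measurable_normalMatrix _ k l
  bound K x hx k l := by
    refine (H.abs_normalMatrix_le _ (Mesh.hull_subset_of_mem_patch K hx) k l).trans ?_
    have := (hg K).norm_le
    gcongr

theorem matForm_comm {P : Finset (Finset (Pt d))} {Q : P → Pt d → Matrix (Fin b) (Fin b) ℝ}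
    (hQ : ∀ K : P, ∀ x ∈ hull K.1, (Q K x).IsSymm) (u w : DG P b p) :
    matForm Q u w = matForm Q w u :=
  Finset.sum_congr rfl fun K _ => setIntegral_congr_fun (isCompact_hull K.1).measurableSet
    fun x hx => dotProduct_mulVec_comm (hQ K x hx) _ _

/-- The left side is a pointwise lower bound for the mass form of the front with gradient `affGrad
gb + t • affGrad gδ`, which is causal for each `t` in `[0, 1]`. -/
theorem mass_coercive (H : sys.IsAdmissible Ω Λ γ cbar) (hγ : 0 < γ) (hcmax : 0 < cmax)
    (hc : cbar < cmax)
    (hg : ∀ K : 𝒯.patch v, TentAffine v cmax φbot φtop K.1 (gb K) (gδ K)) {t : ℝ} (h0 : 0 ≤ t)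
    (h1 : t ≤ 1) (u : DG (𝒯.patch v) b p) :
    (1 - max cbar 0 / cmax) * γ * ip u u ≤
      matForm (fun K x => sys.𝒢 x - sys.normalMatrix (affGrad (gb K)) x) u u -
        t * matForm (fun K x => sys.normalMatrix (affGrad (gδ K)) x) u u := by
  rw [ip_self, matForm, matForm, Finset.mul_sum, Finset.mul_sum, ← Finset.sum_sub_distrib]
  refine Finset.sum_le_sum fun K _ => ?_
  have i0 := (boundedCoeff_bot H hg).integrableOn u u K
  have i1 := (boundedCoeff_height H hg).integrableOn u u K
  rw [sqNorm, ← integral_const_mul, ← integral_const_mul, ← integral_sub i0 (i1.const_mul t)]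
  refine integral_mono_ae ((integrableOn_val_dotProduct _ _ _ _ _).const_mul _)
    (i0.sub (i1.const_mul t)) ?_
  filter_upwards [ae_restrict_of_ae_restrict_of_subset (Mesh.hull_subset_of_mem_patch K)
    (H.ae_coercive hγ hcmax hc)] with x hx
  refine (hx _ ((hg K).causal t h0 h1) (val u K x)).trans (le_of_eq ?_)
  rw [System.normalMatrix_add, System.normalMatrix_smul, ← sub_sub, Matrix.sub_mulVec,
    Matrix.smul_mulVec, sub_dotProduct, smul_dotProduct, smul_eq_mul]

end Mass

end TentSAT

end

/-! ### Assembly -/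

theorem mainTheorem3 (d b p s : ℕ) (hd : 1 ≤ d) (hs : 1 ≤ s)
    (κ Λ γ cbar cmax : ℝ) (hγ : 0 < γ) (hcmax : 0 < cmax) (hc : cbar < cmax) :
    ∃ c₀ : ℝ, 0 < c₀ ∧ ∃ C : ℝ, 0 < C ∧
      ∀ (Ω : Set (TentSAT.Pt d)) (_ : IsOpen Ω)
        (sys : TentSAT.System d b) (_ : sys.IsAdmissible Ω Λ γ cbar)
        (𝒯 : TentSAT.Mesh d Ω) (_ : 𝒯.ShapeRegular κ) (_ : sys.HasNormalTraces 𝒯)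
        (h : ℝ) (_ : 𝒯.IsMeshSize h)
        (v : TentSAT.Pt d) (_ : {v} ∈ 𝒯.complex.faces) (_ : v ∈ Ω)
        (φbot φtop : TentSAT.Pt d → ℝ) (_ : TentSAT.IsTent 𝒯 v cmax φbot φtop)
        (M0 M1 A : Module.End ℝ (TentSAT.DG (𝒯.patch v) b p))
        (_ : M0 = TentSAT.M₀ sys φbot) (_ : M1 = TentSAT.M₁ sys φbot φtop)
        (_ : A = TentSAT.A sys φbot φtop)
        (r : ℕ) (_ : 1 ≤ r) (_ : (1 / r : ℝ) ≤ c₀ * h ^ (1 / s : ℝ))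
        (u : TentSAT.DG (𝒯.patch v) b p),
        TentSAT.energyNorm (M0 - M1) (TentSAT.composedR s (1 / r : ℝ) M0 M1 A r u) ≤
          (1 + C * h) * TentSAT.energyNorm M0 u := by
  obtain ⟨CA, hCA, hA⟩ := TentSAT.exists_aForm_bound hd b p κ Λ hcmax
  set q₀ : ℝ := (|Λ| + d * |Λ| * (1 / cmax)) * b with hq₀
  set q₁ : ℝ := d * |Λ| * (2 / cmax) * b with hq₁
  have hq₀0 : 0 ≤ q₀ := by positivity
  have hq₁0 : 0 ≤ q₁ := by positivity
  -- The strict gap between `cbar` and `cmax` keeps the coercivity constant positive.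
  set m : ℝ := (1 - max cbar 0 / cmax) * γ with hm
  have hm0 : 0 < m := by
    refine mul_pos ?_ hγ
    rw [sub_pos, div_lt_one hcmax]
    exact max_lt hc hcmax
  set C : ℝ := CA + q₀ + q₁ with hC
  have hC0 : 0 ≤ C := by positivity
  set k : ℝ := TentSAT.stepConst m (2 * (2 * C)) s *
    Real.exp (TentSAT.stepConst m (2 * (2 * C)) s) with hk
  have hk0 : 0 ≤ k :=
    mul_nonneg (TentSAT.stepConst_nonneg hm0 (by positivity) s) (Real.exp_pos _).le
  -- The step restriction serves only to give `τ^s ≤ h`, so `c₀ = 1` suffices; adding `1` to `k`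
  -- makes `C` strictly positive.
  refine ⟨1, one_pos, k + 1, by positivity, ?_⟩
  intro Ω hΩ sys H 𝒯 hκ hN h hh v _ hv φbot φtop hT M0 M1 A hM0 hM1 hAeq r hr hτ u
  choose gb gδ hg using fun K : 𝒯.patch v => hT.exists_affine hd K.2
  have hP : ∀ K ∈ 𝒯.patch v, TentSAT.IsSimplex K := TentSAT.Mesh.isSimplex_of_mem_patch
  have hb₀ := TentSAT.boundedCoeff_bot H hg
  have hb₁ := TentSAT.boundedCoeff_height H hg
  have e₀ : ∀ u w : TentSAT.DG (𝒯.patch v) b p, TentSAT.ip (M0 u) w = TentSAT.matForm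
      (fun K x => sys.𝒢 x - sys.normalMatrix (TentSAT.affGrad (gb K)) x) u w := fun u w => by
    rw [hM0, TentSAT.M₀_eq_opOf hg, TentSAT.ip_opOf hP hb₀.isBilinearMap]
  have e₁ : ∀ u w : TentSAT.DG (𝒯.patch v) b p, TentSAT.ip (M1 u) w = TentSAT.matForm
      (fun K x => sys.normalMatrix (TentSAT.affGrad (gδ K)) x) u w := fun u w => by
    rw [hM1, TentSAT.M₁_eq_opOf hg, TentSAT.ip_opOf hP hb₁.isBilinearMap]
  have eA : ∀ u w : TentSAT.DG (𝒯.patch v) b p,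
      TentSAT.ip (A u) w = TentSAT.aForm sys φbot φtop u w := fun u w => by
    rw [hAeq, TentSAT.A_eq_opOf, TentSAT.ip_opOf hP (TentSAT.isBilinearMap_aForm H hκ hd hT)]
  have hip : ∀ u : TentSAT.DG (𝒯.patch v) b p, 0 ≤ TentSAT.ip u u := fun u => by
    rw [TentSAT.ip_self]
    exact Finset.sum_nonneg fun K _ => TentSAT.sqNorm_nonneg u K
  have hstable := TentSAT.stable_of_core (TentSAT.dgCore b p hP) (M0 := M0) (M1 := M1) (A := A) hm0
    hC0
    (fun u w => by
      show TentSAT.ip (M0 u) w = TentSAT.ip (M0 w) u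
      rw [e₀, e₀]
      refine TentSAT.matForm_comm (fun K x hx => ?_) u w
      have hx' := TentSAT.Mesh.hull_subset_of_mem_patch K hx
      exact (H.symm_𝒢 x hx').sub (H.isSymm_normalMatrix _ hx'))
    (fun u w => by
      show TentSAT.ip (M1 u) w = TentSAT.ip (M1 w) u
      rw [e₁, e₁]
      exact TentSAT.matForm_comm (fun K x hx => H.isSymm_normalMatrix _
        (TentSAT.Mesh.hull_subset_of_mem_patch K hx)) u w)
    (fun t h0 h1 u => by
      show m * TentSAT.ip u u ≤ TentSAT.ip (M0 u) u - t * TentSAT.ip (M1 u) u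
      rw [e₀, e₁]
      exact TentSAT.mass_coercive H hγ hcmax hc hg h0 h1 u)
    (fun u w => by
      show |TentSAT.ip (M0 u) w| ≤ C * (TentSAT.ip u u + TentSAT.ip w w)
      rw [e₀]
      refine (hb₀.abs_matForm_le u w).trans
        (mul_le_mul_of_nonneg_right ?_ (add_nonneg (hip u) (hip w)))
      linarith)
    (fun u w => by
      show |TentSAT.ip (M1 u) w| ≤ C * (TentSAT.ip u u + TentSAT.ip w w)
      rw [e₁]
      refine (hb₁.abs_matForm_le u w).trans
        (mul_le_mul_of_nonneg_right ?_ (add_nonneg (hip u) (hip w)))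
      linarith)
    (fun u w => by
      show |TentSAT.ip (A u) w| ≤ C * (TentSAT.ip u u + TentSAT.ip w w)
      rw [eA]
      refine (hA Ω sys γ cbar H 𝒯 hκ v φbot φtop hT u w).trans
        (mul_le_mul_of_nonneg_right ?_ (add_nonneg (hip u) (hip w)))
      linarith)
    (fun u => by
      show 2 * TentSAT.ip (A u) u + TentSAT.ip (M1 u) u ≤ 0
      rw [eA, e₁]
      exact TentSAT.aForm_dissipative hΩ H hκ hN hd hv hg u)
    hr s u
  have hh0 : 0 ≤ h := by
    obtain ⟨K, -, hK⟩ := hh.1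
    rw [← hK]
    exact Metric.diam_nonneg
  have hs0 : (s : ℝ) ≠ 0 := by exact_mod_cast (by omega : s ≠ 0)
  have hτs : (1 / r : ℝ) ^ s ≤ h := by
    rw [one_mul] at hτ
    refine (pow_le_pow_left₀ (by positivity) hτ s).trans (le_of_eq ?_)
    rw [← Real.rpow_natCast, ← Real.rpow_mul hh0, one_div, inv_mul_cancel₀ hs0, Real.rpow_one]
  refine hstable.trans (mul_le_mul_of_nonneg_right ?_ (Real.sqrt_nonneg _))
  have := mul_le_mul_of_nonneg_left hτs hk0
  linarith
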